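/- **Setting.** Let $\Gamma\subset\mathbb R^3$ be a compact connected smooth embedded surface without boundary, and let $U\supset\Gamma$ be an open set such that every $x\in U$ has a unique closest point $\pi(x)\in\Gamma$. Let $k\ge 1$. Fix a Lagrange element of degree $k$ on the reference triangle $K\subset\mathbb R^2$: unisolvent nodes for $\mathbb P^k(K)$ which contain the vertices, are invariant under permutation of the barycentric coordinates and have $k+1$ points on each edge, with nodal basis $(\phi_j)$. Consider conforming triangulations, shape regular with constant $\kappa>0$ (each triangle $\widetilde K$ contains a disc of its plane of radius $\operatorname{diam}(\widetilde K)/\kappa$), of closed polyhedral surfaces $\Gamma_h\subset U$ with vertices on $\Gamma$ (each edge belongs to exactly two triangles); $h$ is the largest diameter of a triangle. For a triangle $\widetilde K$ with nodes $x_j$ put $F_{\widehat K}=\sum_j\pi(x_j)\phi_j:K\to\mathbb R^3$ and $\widehat K=F_{\widehat K}(K)$. The elements $\widehat K$ form the set $\widehat{\mathcal T}_h$ and make up the discrete surface $\Gamma_h^k$; $dA$ and $ds$ are its surface and arc length measures. $\widehat{\mathcal E}_h$ is the set of the curved edges $e=\widehat K^+\cap\widehat K^-$, with an arbitrary choice of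 $\widehat K^+$ and $\widehat K^-$ for each of them, $h_e=\operatorname{diam}(e)$, and $n^\pm$ is the outward unit conormal of $\widehat K^\pm$ along $e$ (tangent to $\widehat K^\pm$, orthogonal to $e$). Let $$S_h=\{v: v|_{\widehat K}\circ F_{\widehat K}\in\mathbb P^k(K)\ \forall \widehat K\},\qquad \Sigma_h=\{\tau:\tau|_{\widehat K}\circ F_{\widehat K}=\nabla F_{\widehat K}(\nabla F_{\widehat K}^{T}\nabla F_{\widehat K})^{-1}q,\ q\in\mathbb P^k(K)^2\ \forall \widehat K\},$$ where the elements of $S_h$ and $\Sigma_h$ are defined elementwise, and let $\nabla$ denote the elementwise tangential gradient. On edges put, for scalars $q$ and vector fields $\varphi$, $$\{q\}=\tfrac12(q^++q^-),\quad [q]=q^+-q^-,\quad \{\varphi;n\}=\tfrac12(\varphi^+\!\cdot n^+-\varphi^-\!\cdot n^-),\quad [\varphi;n]=\varphi^+\!\cdot n^++\varphi^-\!\cdot n^-.$$ The lifts $r_e(\phi),l_e(\phi)\in\Sigma_h$ are defined by $\int_{\Gamma_h^k} r_e(\phi)\cdot\tau\,dA=-\int_e\phi\{\tau;n\}\,ds$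 and $\int_{\Gamma_h^k} l_e(\phi)\cdot\tau\,dA=-\int_e\phi[\tau;n]\,ds$ for all $\tau\in\Sigma_h$; $r_h=\sum_e r_e$, $l_h=\sum_e l_e$. For $\alpha>0$ put $\eta_e=\alpha$ and $\beta_e=\alpha k^2h_e^{-1}$, and let $\beta$ be a vector field, constant on each edge, with $|\beta|\le B$. **Methods.** With $\sigma_h=\nabla u-r_h([\hat u-u])-l_h(\{\hat u-u\})$ and $\hat\sigma^\pm=\pm X n^\pm$, the numerical fluxes are * IP: $\hat u^\pm=\{u\}$, $X=\{\nabla u;n\}-\beta_e[u]$; * NIPG: $\hat u^\pm=\{u\}\pm[u]$, $X$ as for IP; * IIPG: $\hat u^\pm=u^\pm$, $X$ as for IP; * Brezzi et al.: $\hat u^\pm=\{u\}$, $X=\{\sigma_h+\eta_e r_e([u]);n\}$; * Bassi et al.: $\hat u^\pm=\{u\}$, $X=\{\nabla u+\eta_e r_e([u]);n\}$; * LDG: $\hat u^\pm=\{u\}-\beta\cdot n^+[u]$, $X=\{\sigma_h;n\}-\beta_e[u]+\beta\cdot n^+[\sigma_h;n]$. The form of a method is $$\mathcal A(u,v)=\sum_{\widehat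 K}\int_{\widehat K}\nabla u\cdot\nabla v+uv\,dA+\sum_e\int_e [\hat u-u]\{\nabla v;n\}-\{\hat\sigma;n\}[v]\,ds+\sum_e\int_e\{\hat u-u\}[\nabla v;n]-[\hat\sigma;n]\{v\}\,ds .$$ Its DG norm is $\|u\|_{DG}^2=\sum_{\widehat K}\|u\|_{H^1(\widehat K)}^2+\mathcal S(u,u)$, with $\mathcal S(u,v)=\sum_e\beta_e\int_e[u][v]\,ds$ for IP, NIPG, IIPG and LDG, and $\mathcal S(u,v)=\sum_e\eta_e\int_{\Gamma_h^k}r_e([u])\cdot r_e([v])\,dA$ for Brezzi et al. and Bassi et al. **Lemma.** There are $h_0>0$ and $\alpha_0>0$, depending only on $\Gamma$, $U$, $k$, the Lagrange element and $\kappa$, such that for each of the six methods, every $\alpha>0$ and every $B$ the following holds with constants $C,c,C'>0$ independent of the mesh and of $\beta$, for all meshes as above with $h\le h_0$ and all $\beta$ with $|\beta|\le B$. 1. (Continuity) $\mathcal A$ is bilinear on $S_h$ and $|\mathcal A(u,v)|\le C\|u\|_{DG}\|v\|_{DG}$ for all $u,v\in S_h$. 2. (Coercivity) $\mathcal A(u,u)\ge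 c\|u\|_{DG}^2$ for all $u\in S_h$, provided that $\alpha\ge\alpha_0$ in the case of IP, Bassi et al. and IIPG. 3. (Well-posedness) Under the same proviso, for every $f_h\in L^2(\Gamma_h^k)$ there is exactly one $u_h\in S_h$ with $\mathcal A(u_h,v)=\int_{\Gamma_h^k}f_hv\,dA$ for all $v\in S_h$, and $\|u_h\|_{DG}\le C'\|f_h\|_{L^2(\Gamma_h^k)}$. -/

import Mathlib

open MeasureTheory Set
open scoped Matrix ContDiff

noncomputable section

namespace SurfaceDG

/-- Ambient Euclidean space. -/
abbrev E3 := EuclideanSpace ℝ (Fin 3)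

/-- Coordinate plane of the reference element. -/
abbrev R2 := Fin 2 → ℝ

/-! ### The smooth surface and the closest point projection -/

/-- `Γ` is a compact, connected, smoothly embedded surface without boundary in `ℝ³`: near each of
its points it is the zero set of a smooth function with nowhere vanishing derivative. -/
structure IsClosedSmoothSurface (Γ : Set E3) : Prop where
  isCompact : IsCompact Γ
  isConnected : IsConnected Γ
  exists_levelSet : ∀ p ∈ Γ, ∃ (V : Set E3) (g : E3 → ℝ), IsOpen V ∧ p ∈ V ∧
    ContDiffOn ℝ ∞ g V ∧ (∀ x ∈ V, fderiv ℝ g x ≠ 0) ∧ Γ ∩ V = {x ∈ V | g x = 0}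

/-- `U` is an open neighbourhood of `Γ` each of whose points has exactly one closest point
on `Γ`. -/
structure IsTube (Γ U : Set E3) : Prop where
  isOpen : IsOpen U
  subset : Γ ⊆ U
  existsUnique_closest : ∀ x ∈ U, ∃! ξ : E3, ξ ∈ Γ ∧ dist x ξ = Metric.infDist x Γ

open Classical in
/-- The closest point projection `π` onto `Γ`; it is only used in a tube, where the closest point
exists and is unique. -/
def closestPoint (Γ : Set E3) (x : E3) : E3 :=
  if h : ∃ ξ : E3, ξ ∈ Γ ∧ dist x ξ = Metric.infDist x Γ then h.choose else x

/-! ### The reference triangle and Lagrange elements on it -/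

/-- Vertices of the reference triangle. -/
def refVertex : Fin 3 → R2 := ![![0, 0], ![1, 0], ![0, 1]]

/-- The closed reference triangle `K`. -/
def refTriangle : Set R2 := {x | 0 ≤ x 0 ∧ 0 ≤ x 1 ∧ x 0 + x 1 ≤ 1}

/-- Barycentric coordinates with respect to `refVertex`. -/
def bary (x : R2) : Fin 3 → ℝ := ![1 - x 0 - x 1, x 0, x 1]

/-- Polynomials in two variables of total degree at most `k`. -/
abbrev Pk (k : ℕ) : Submodule ℝ (MvPolynomial (Fin 2) ℝ) :=
  MvPolynomial.restrictTotalDegree (Fin 2) ℝ k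

/-- A Lagrange element of degree `k` on the reference triangle: nodal points that determine the
polynomials of degree at most `k`, and the associated nodal basis. As usual, the vertices are
nodes, the nodes are invariant under the symmetries of the triangle, and each edge carries `k + 1`
of them (so that nodes and interpolants of adjacent triangles match along the common edge). -/
structure LagrangeElement (k : ℕ) where
  /-- number of nodes -/
  n : ℕ
  /-- the nodal points -/
  node : Fin n → R2
  /-- the nodal basis -/
  basis : Fin n → Pk k
  node_mem : ∀ j, node j ∈ refTriangle
  eval_basis : ∀ i j, MvPolynomial.eval (node j) (basis i : MvPolynomial (Fin 2) ℝ)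
    = if i = j then 1 else 0
  unisolvent : ∀ p ∈ Pk k, (∀ j, MvPolynomial.eval (node j) p = 0) → p = 0
  vertex_node : ∀ i, ∃ j, node j = refVertex i
  symmetric : ∀ (σ : Equiv.Perm (Fin 3)) (j : Fin n), ∃ j', bary (node j') = bary (node j) ∘ σ
  card_edge : ∀ l : Fin 3, {j | bary (node j) l = 0}.ncard = k + 1

/-! ### Triangulated polyhedral surfaces -/

/-- The two sides `+` and `-` of an edge. -/
inductive Side
  | plus
  | minus

/-- A conforming triangulation of a closed polyhedral surface `Γ_h ⊆ U` by planar triangles with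
vertices on `Γ`, together with an enumeration of its edges and, for each edge, a (free) choice of
which of the two adjacent triangles is `K⁺` and which is `K⁻`. -/
structure SurfaceMesh (Γ U : Set E3) where
  /-- number of triangles -/
  numElts : ℕ
  /-- number of edges -/
  numEdges : ℕ
  /-- the vertices of the triangles -/
  vertex : Fin numElts → Fin 3 → E3
  affineIndependent : ∀ K, AffineIndependent ℝ (vertex K)
  vertex_mem : ∀ K i, vertex K i ∈ Γ
  subset_tube : ∀ K, convexHull ℝ (range (vertex K)) ⊆ U
  /-- distinct triangles have distinct vertex sets -/
  vertexSet_injective : Function.Injective fun K => range (vertex K)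
  /-- two triangles meet in the hull of their common vertices: nothing, a vertex or an edge -/
  conforming : ∀ K K', K ≠ K' →
    convexHull ℝ (range (vertex K)) ∩ convexHull ℝ (range (vertex K'))
      = convexHull ℝ (range (vertex K) ∩ range (vertex K'))
  /-- the triangles `K⁺`, `K⁻` adjacent to an edge -/
  edgeElt : Fin numEdges → Side → Fin numElts
  /-- local numbers, in `K⁺` and in `K⁻`, of the two end points of an edge -/
  edgeLoc : Fin numEdges → Side → Fin 2 → Fin 3
  edgeElt_ne : ∀ e, edgeElt e .plus ≠ edgeElt e .minus
  edgeLoc_injective : ∀ e s, Function.Injective (edgeLoc e s)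
  edge_match : ∀ e i, vertex (edgeElt e .plus) (edgeLoc e .plus i)
    = vertex (edgeElt e .minus) (edgeLoc e .minus i)
  /-- each edge is listed once, hence belongs to no more than two triangles -/
  edge_injective : Function.Injective fun e =>
    range fun i => vertex (edgeElt e .plus) (edgeLoc e .plus i)
  /-- the edge opposite to the vertex `l` of the triangle `K` is listed, hence belongs to two
  triangles: the polyhedral surface has no boundary -/
  edge_cover : ∀ K (l : Fin 3), ∃ e s, edgeElt e s = K ∧ ∀ i, edgeLoc e s i ≠ l

namespace SurfaceMesh

variable {Γ U : Set E3} (M : SurfaceMesh Γ U)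

/-- The planar triangle with number `K`. -/
def flat (K : Fin M.numElts) : Set E3 := convexHull ℝ (range (M.vertex K))

/-- The mesh size `h`: the largest diameter of a triangle. -/
def meshSize : ℝ := ⨆ K, Metric.diam (M.flat K)

/-- Shape regularity with constant `κ`: each triangle `K` contains a disc of its plane with radius
`diam K / κ`. -/
def ShapeRegular (κ : ℝ) : Prop :=
  ∀ K, ∃ c ∈ affineSpan ℝ (range (M.vertex K)), ∀ y ∈ affineSpan ℝ (range (M.vertex K)),
    κ * dist y c ≤ Metric.diam (M.flat K) → y ∈ M.flat K

/-- The point of the planar triangle `K` with reference coordinates `x`. -/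
def flatPoint (K : Fin M.numElts) (x : R2) : E3 := ∑ i, bary x i • M.vertex K i

end SurfaceMesh

section Discrete

variable {Γ U : Set E3} {k : ℕ} (L : LagrangeElement k) (M : SurfaceMesh Γ U)

/-! ### The discrete surface `Γ_h^k`

The element `K̂` is the image of the reference triangle under `F_K = π_k ∘ flatPoint K`. Functions
and vector fields on `K̂` are written in the reference coordinates `x`. -/

/-- The parametrization `F_K` of `K̂`: the degree `k` Lagrange interpolant of the projection `π` on
the planar triangle `K`. -/
def param (K : Fin M.numElts) (x : R2) : E3 :=
  ∑ j, MvPolynomial.eval x (L.basis j : MvPolynomial (Fin 2) ℝ) •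
    closestPoint Γ (M.flatPoint K (L.node j))

/-- The partial derivatives of `F_K`, that is, the columns of `∇F_K`. -/
def dparam (K : Fin M.numElts) (x : R2) (m : Fin 2) : E3 :=
  ∑ j, MvPolynomial.eval x (MvPolynomial.pderiv m (L.basis j : MvPolynomial (Fin 2) ℝ)) •
    closestPoint Γ (M.flatPoint K (L.node j))

/-- The image `∇F_K w` of a reference vector. -/
def pushVec (K : Fin M.numElts) (x w : R2) : E3 := ∑ m, w m • dparam L M K x m

/-- The Gram matrix `∇F_Kᵀ ∇F_K`. -/
def gram (K : Fin M.numElts) (x : R2) : Matrix (Fin 2) (Fin 2) ℝ :=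
  Matrix.of fun i j => inner ℝ (dparam L M K x i) (dparam L M K x j)

/-- The tangent vector `∇F_K (∇F_Kᵀ ∇F_K)⁻¹ q`, that is, the transposed pseudo-inverse of `∇F_K`
applied to `q`. -/
def pushCovec (K : Fin M.numElts) (x q : R2) : E3 := pushVec L M K x ((gram L M K x)⁻¹ *ᵥ q)

/-- The surface measure of `K̂` in reference coordinates. -/
def dA (K : Fin M.numElts) : Measure R2 :=
  (volume.restrict refTriangle).withDensity fun x => ENNReal.ofReal √(gram L M K x).det

/-! ### Edges -/

/-- The reference coordinates, on the given side, of the point of an edge with parameter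
`t ∈ [0, 1]`. -/
def edgePoint (e : Fin M.numEdges) (s : Side) (t : ℝ) : R2 :=
  (1 - t) • refVertex (M.edgeLoc e s 0) + t • refVertex (M.edgeLoc e s 1)

/-- The derivative in `t` of the parametrization `t ↦ F_K (edgePoint t)` of the curved edge. -/
def edgeTangent (e : Fin M.numEdges) (s : Side) (t : ℝ) : E3 :=
  pushVec L M (M.edgeElt e s) (edgePoint M e s t)
    (refVertex (M.edgeLoc e s 1) - refVertex (M.edgeLoc e s 0))

/-- A tangent vector of `K̂` at an edge point, orthogonal to the edge and pointing into `K̂`: the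
image of the vector from an end point of the reference edge to the centroid, minus its component
along the edge. -/
def inwardVec (e : Fin M.numEdges) (s : Side) (t : ℝ) : E3 :=
  let w := pushVec L M (M.edgeElt e s) (edgePoint M e s t)
    ((fun _ => 1 / 3) - refVertex (M.edgeLoc e s 0))
  let τ := edgeTangent L M e s t
  w - (inner ℝ w τ / inner ℝ τ τ) • τ

/-- The outward unit conormal `n_h^±` of `K̂^±` along an edge. -/
def conormal (e : Fin M.numEdges) (t : ℝ) (s : Side) : E3 :=
  -(‖inwardVec L M e s t‖⁻¹ • inwardVec L M e s t)

/-- The arc length measure of a curved edge in the parameter `t`. -/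
def dS (e : Fin M.numEdges) : Measure ℝ :=
  (volume.restrict (Icc 0 1)).withDensity fun t => ENNReal.ofReal ‖edgeTangent L M e .plus t‖

/-- The diameter of a curved edge. -/
def edgeDiam (e : Fin M.numEdges) : ℝ :=
  Metric.diam ((fun t => param L M (M.edgeElt e .plus) (edgePoint M e .plus t)) '' Icc 0 1)

/-! ### Trace operators, at one point of an edge -/

/-- `{q}` -/
def avg (q : Side → ℝ) : ℝ := (q .plus + q .minus) / 2

/-- `[q]` -/
def jump (q : Side → ℝ) : ℝ := q .plus - q .minus

/-- `{φ; n}` -/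
def navg (φ n : Side → E3) : ℝ := (inner ℝ (φ .plus) (n .plus) - inner ℝ (φ .minus) (n .minus)) / 2

/-- `[φ; n]` -/
def njump (φ n : Side → E3) : ℝ := inner ℝ (φ .plus) (n .plus) + inner ℝ (φ .minus) (n .minus)

/-! ### Discrete spaces -/

/-- The DG space `Ŝ_hk`: on each element, a polynomial of degree at most `k` in the reference
coordinates. -/
abbrev DGSpace (k : ℕ) (M : SurfaceMesh Γ U) := Fin M.numElts → Pk k

/-- The vector valued space `Σ̂_hk`, through the reference fields `τ ∈ [P^k(K)]²`. -/
abbrev FluxSpace (k : ℕ) (M : SurfaceMesh Γ U) := Fin M.numElts → Fin 2 → Pk k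

variable {M}

/-- The values of a function in the DG space. -/
def value (v : DGSpace k M) (K : Fin M.numElts) (x : R2) : ℝ :=
  MvPolynomial.eval x (v K : MvPolynomial (Fin 2) ℝ)

/-- The values of a field in `Σ̂_hk`. -/
def fluxValue (ρ : FluxSpace k M) (K : Fin M.numElts) (x : R2) : E3 :=
  pushCovec L M K x fun m => MvPolynomial.eval x (ρ K m : MvPolynomial (Fin 2) ℝ)

/-- The surface gradient of a function in the DG space. -/
def surfGrad (v : DGSpace k M) (K : Fin M.numElts) (x : R2) : E3 :=
  pushCovec L M K x fun m =>
    MvPolynomial.eval x (MvPolynomial.pderiv m (v K : MvPolynomial (Fin 2) ℝ))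

/-- The two traces on an edge of an elementwise defined function or field. -/
def trace {X : Type} (w : Fin M.numElts → R2 → X) (e : Fin M.numEdges) (t : ℝ) (s : Side) : X :=
  w (M.edgeElt e s) (edgePoint M e s t)

/-! ### DG lifting operators -/

/-- `ρ` is the lift `r_e(φ)`. -/
def IsLiftR (e : Fin M.numEdges) (φ : ℝ → ℝ) (ρ : FluxSpace k M) : Prop :=
  ∀ τ : FluxSpace k M,
    ∑ K, ∫ x, inner ℝ (fluxValue L ρ K x) (fluxValue L τ K x) ∂(dA L M K)
      = -∫ t, φ t * navg (trace (fluxValue L τ) e t) (conormal L M e t) ∂(dS L M e)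

/-- `ρ` is the lift `l_e(q)`. -/
def IsLiftL (e : Fin M.numEdges) (q : ℝ → ℝ) (ρ : FluxSpace k M) : Prop :=
  ∀ τ : FluxSpace k M,
    ∑ K, ∫ x, inner ℝ (fluxValue L ρ K x) (fluxValue L τ K x) ∂(dA L M K)
      = -∫ t, q t * njump (trace (fluxValue L τ) e t) (conormal L M e t) ∂(dS L M e)

open Classical in
/-- The lifting operator `r_e`. -/
def liftR (e : Fin M.numEdges) (φ : ℝ → ℝ) : FluxSpace k M :=
  if h : ∃ ρ, IsLiftR L e φ ρ then h.choose else 0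

open Classical in
/-- The lifting operator `l_e`. -/
def liftL (e : Fin M.numEdges) (q : ℝ → ℝ) : FluxSpace k M :=
  if h : ∃ ρ, IsLiftL L e q ρ then h.choose else 0

/-- The global lift `r_h = ∑_e r_e`. -/
def liftRh (φ : Fin M.numEdges → ℝ → ℝ) : FluxSpace k M := ∑ e, liftR L e (φ e)

/-- The global lift `l_h = ∑_e l_e`. -/
def liftLh (q : Fin M.numEdges → ℝ → ℝ) : FluxSpace k M := ∑ e, liftL L e (q e)

/-! ### The methods: numerical fluxes, bilinear forms and norms -/

/-- The surface DG methods. -/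
inductive DGMethod
  | IP
  | NIPG
  | IIPG
  | LDG
  | Brezzi
  | Bassi

/-- The penalty coefficient `β_e = α k² / h_e`. The coefficient `η_e` is `α` itself. -/
def penalty (α : ℝ) (e : Fin M.numEdges) : ℝ := α * (k : ℝ) ^ 2 * (edgeDiam L M e)⁻¹

/-- The jump `[u]` on the edges. -/
def jumpOn (u : DGSpace k M) (e : Fin M.numEdges) (t : ℝ) : ℝ := jump (trace (value u) e t)

/-- The numerical flux `û^±`; the vector field `β`, constant on each edge, only enters LDG. -/
def uHat (m : DGMethod) (β : Fin M.numEdges → E3) (u : DGSpace k M)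
    (e : Fin M.numEdges) (t : ℝ) (s : Side) : ℝ :=
  let q := trace (value u) e t
  match m, s with
  | .IP, _ => avg q
  | .Brezzi, _ => avg q
  | .Bassi, _ => avg q
  | .NIPG, .plus => avg q + jump q
  | .NIPG, .minus => avg q - jump q
  | .IIPG, s => q s
  | .LDG, _ => avg q - inner ℝ (β e) (conormal L M e t .plus) * jump q

/-- The difference `û - u`, on both sides of the edges. -/
def uDefect (m : DGMethod) (β : Fin M.numEdges → E3) (u : DGSpace k M)
    (e : Fin M.numEdges) (t : ℝ) (s : Side) : ℝ :=
  uHat L m β u e t s - trace (value u) e t s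

/-- The discrete flux `σ_h(u) = ∇u - r_h([û - u]) - l_h({û - u})`. -/
def sigmaH (m : DGMethod) (β : Fin M.numEdges → E3) (u : DGSpace k M)
    (K : Fin M.numElts) (x : R2) : E3 :=
  surfGrad L u K x
    - fluxValue L (liftRh L fun e t => jump (uDefect L m β u e t)) K x
    - fluxValue L (liftLh L fun e t => avg (uDefect L m β u e t)) K x

/-- The scalar `X` in `σ̂⁺ = X n⁺`, `σ̂⁻ = -X n⁻`. -/
def normalFlux (m : DGMethod) (α : ℝ) (β : Fin M.numEdges → E3) (u : DGSpace k M)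
    (e : Fin M.numEdges) (t : ℝ) : ℝ :=
  let n := conormal L M e t
  match m with
  | .IP | .NIPG | .IIPG => navg (trace (surfGrad L u) e t) n - penalty L α e * jumpOn u e t
  | .LDG => navg (trace (sigmaH L .LDG β u) e t) n - penalty L α e * jumpOn u e t
      + inner ℝ (β e) (n .plus) * njump (trace (sigmaH L .LDG β u) e t) n
  | .Brezzi => navg (trace (fun K x => sigmaH L .Brezzi β u K x
      + α • fluxValue L (liftR L e (jumpOn u e)) K x) e t) n
  | .Bassi => navg (trace (fun K x => surfGrad L u K x
      + α • fluxValue L (liftR L e (jumpOn u e)) K x) e t) n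

/-- The numerical flux `σ̂^±`. -/
def sigmaHat (m : DGMethod) (α : ℝ) (β : Fin M.numEdges → E3) (u : DGSpace k M)
    (e : Fin M.numEdges) (t : ℝ) : Side → E3
  | .plus => normalFlux L m α β u e t • conormal L M e t .plus
  | .minus => -(normalFlux L m α β u e t • conormal L M e t .minus)

/-- The bilinear form `𝒜_h^k` of a method: the primal formulation with its numerical fluxes. -/
def dgForm (m : DGMethod) (α : ℝ) (β : Fin M.numEdges → E3) (u v : DGSpace k M) : ℝ :=
  (∑ K, ∫ x, inner ℝ (surfGrad L u K x) (surfGrad L v K x)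
      + value u K x * value v K x ∂(dA L M K))
  + (∑ e, ∫ t, jump (uDefect L m β u e t) * navg (trace (surfGrad L v) e t) (conormal L M e t)
      - navg (sigmaHat L m α β u e t) (conormal L M e t) * jumpOn v e t ∂(dS L M e))
  + (∑ e, ∫ t, avg (uDefect L m β u e t) * njump (trace (surfGrad L v) e t) (conormal L M e t)
      - njump (sigmaHat L m α β u e t) (conormal L M e t) * avg (trace (value v) e t) ∂(dS L M e))

/-- The stabilization function `S_h` of a method. -/
def stab (m : DGMethod) (α : ℝ) (u v : DGSpace k M) : ℝ :=
  match m with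
  | .IP | .NIPG | .IIPG | .LDG =>
      ∑ e, penalty L α e * ∫ t, jumpOn u e t * jumpOn v e t ∂(dS L M e)
  | .Brezzi | .Bassi =>
      ∑ e, α * ∑ K, ∫ x, inner ℝ (fluxValue L (liftR L e (jumpOn u e)) K x)
        (fluxValue L (liftR L e (jumpOn v e)) K x) ∂(dA L M K)

/-- The DG norm: `‖u‖_DG² = ∑_K ‖u‖²_{H¹(K̂)} + S_h(u, u)`. -/
def dgNorm (m : DGMethod) (α : ℝ) (u : DGSpace k M) : ℝ :=
  √((∑ K, ∫ x, value u K x ^ 2 + ‖surfGrad L u K x‖ ^ 2 ∂(dA L M K)) + stab L m α u u)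

/-- Membership in `L²(Γ_h^k)`, for functions given elementwise in reference coordinates. -/
def IsL2 (f : Fin M.numElts → R2 → ℝ) : Prop := ∀ K, MemLp (f K) 2 (dA L M K)

/-- The norm of `L²(Γ_h^k)`. -/
def l2Norm (f : Fin M.numElts → R2 → ℝ) : ℝ := √(∑ K, ∫ x, f K x ^ 2 ∂(dA L M K))

/-- `u` solves the discrete problem with right-hand side `f`. -/
def IsDiscreteSolution (m : DGMethod) (α : ℝ) (β : Fin M.numEdges → E3)
    (f : Fin M.numElts → R2 → ℝ) (u : DGSpace k M) : Prop :=
  ∀ v : DGSpace k M, dgForm L m α β u v = ∑ K, ∫ x, f K x * value v K x ∂(dA L M K)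

/-- The methods whose coercivity needs a large penalty parameter. -/
def DGMethod.NeedsLargePenalty : DGMethod → Prop
  | .IP | .Bassi | .IIPG => True
  | .NIPG | .LDG | .Brezzi => False

end Discrete

end SurfaceDG

end

/-!
The six methods differ by their numerical fluxes, but for all of them the form reduces to
`(u, v) + (∇u, ∇v) + s (R u, ∇v) + (∇u, R v) + r (R u, R v) + 𝒮(u, v)`,
where `R` is the lift of the jumps, `s ∈ {1, 0, -1}` and `r ∈ {0, 1}`
(`IsRegularMesh.dgForm_eq_methodForm`). The lift is bounded by the stabilization,
`α ‖R u‖² ≤ D 𝒮(u, u)` with `D` independent of `α`, except that it depends on `B` for LDG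
(`IsRegularMesh.mul_fluxForm_lift_le_of_ne`, `IsRegularMesh.mul_fluxForm_lift_le`). Continuity is
then the Cauchy-Schwarz inequality. For coercivity the mixed terms cancel (NIPG), or are part of the
square `‖∇u + R u‖²` (Brezzi et al. and LDG), or are absorbed for large `α` (IP, IIPG and
Bassi et al.). Well-posedness follows from coercivity in finite dimensions.

The bound of the lift rests on the discrete trace inequality (`IsRegularMesh.trace_inequality`) and
on the fact that each element has three edges (`IsRegularMesh.fluxForm_sum_lift_le`). The trace
inequality is a statement about polynomials on the reference triangle, transported to the curved
elements by the estimates collected in `IsRegularMesh`: `∇F` is comparable with the diameter of the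
triangle, and neighbouring diameters are comparable.

These estimates hold for fine meshes (`exists_isRegularMesh`), because `F` is a small perturbation
of the affine parametrization of the planar triangle. Their difference interpolates the displacement
`x ↦ closestPoint Γ x - x`, whose length is the distance of `x` to `Γ`, and this distance is
`o(diam)` on triangles with vertices on `Γ` (`exists_infDist_convexHull_le`). So only the continuous
differentiability of the surface is used, and no regularity of the closest point projection. Nor is
it needed that the curved elements match along the edges: the two sides of an edge enter through
the trace inequality and the normalization of the conormals only.
-/

namespace SurfaceDG

/-! ### Chords of a smooth surface -/

/-- Local form of `exists_infDist_convexHull_le`. In the direction `ν` in which the derivative of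
the level set function `g` at `p` is one, `g` changes sign close to any point where `g` is small. -/
lemma exists_infDist_convexHull_le_of_levelSet {Γ V : Set E3} {g : E3 → ℝ} {p : E3} (hV : IsOpen V)
    (hp : p ∈ V) (hg : ContDiffOn ℝ ∞ g V) (hg' : fderiv ℝ g p ≠ 0)
    (hΓ : Γ ∩ V = {x ∈ V | g x = 0}) {ε : ℝ} (hε : 0 < ε) :
    ∃ ρ > 0, ∀ s ⊆ Γ ∩ Metric.ball p ρ, ∀ y ∈ convexHull ℝ s,
      Metric.infDist y Γ ≤ ε * Metric.diam s := by
  obtain ⟨ν, hν⟩ : ∃ ν, fderiv ℝ g p ν = 1 := by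
    obtain ⟨w, hw⟩ : ∃ w, fderiv ℝ g p w ≠ 0 := by
      by_contra! h
      exact hg' (ContinuousLinearMap.ext h)
    exact ⟨(fderiv ℝ g p w)⁻¹ • w, by simp [hw]⟩
  have hν0 : 0 < ‖ν‖ := norm_pos_iff.2 fun h => by simp [h] at hν
  -- `δ` is the oscillation of the derivative that is allowed on the ball of radius `2 ρ`.
  obtain ⟨δ, hδ, hδ1, hδ2⟩ : ∃ δ > 0, δ * ‖ν‖ ≤ 1 / 8 ∧ 4 * δ * ‖ν‖ ≤ ε := by
    refine ⟨min (1 / 8) (ε / 4) / ‖ν‖, by positivity, ?_, ?_⟩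
    · rw [div_mul_cancel₀ _ hν0.ne']; exact min_le_left _ _
    · rw [mul_assoc, div_mul_cancel₀ _ hν0.ne']; linarith [min_le_right (1 / 8) (ε / 4)]
  have hcont : ContinuousOn (fderiv ℝ g) V := hg.continuousOn_fderiv_of_isOpen hV (by simp)
  obtain ⟨r, hr, hball⟩ : ∃ r > 0, ∀ x ∈ Metric.ball p r,
      x ∈ V ∧ ‖fderiv ℝ g x - fderiv ℝ g p‖ ≤ δ := by
    have h1 := (hcont.continuousAt (hV.mem_nhds hp)).eventually (Metric.closedBall_mem_nhds _ hδ)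
    obtain ⟨r, hr, h⟩ := Metric.eventually_nhds_iff_ball.1 ((hV.eventually_mem hp).and h1)
    refine ⟨r, hr, fun x hx => ⟨(h x hx).1, ?_⟩⟩
    simpa [dist_eq_norm] using (h x hx).2
  have hmv : ∀ x ∈ Metric.ball p r, ∀ y ∈ Metric.ball p r,
      |g y - g x - fderiv ℝ g p (y - x)| ≤ δ * ‖y - x‖ := fun x hx y hy =>
    (convex_ball p r).norm_image_sub_le_of_norm_hasFDerivWithin_le'
      (fun z hz => ((hg.contDiffAt (hV.mem_nhds (hball z hz).1)).differentiableAt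
        (by simp)).hasFDerivAt.hasFDerivWithinAt) (fun z hz => (hball z hz).2) hx hy
  refine ⟨r / 2, by positivity, fun s hs y hy => ?_⟩
  obtain ⟨v, hv⟩ : s.Nonempty := convexHull_nonempty_iff.1 ⟨y, hy⟩
  have hsb : Bornology.IsBounded s := Metric.isBounded_ball.subset fun z hz => (hs hz).2
  have hsr : ∀ z ∈ s, z ∈ Metric.ball p r := fun z hz =>
    Metric.ball_subset_ball (by linarith) (hs hz).2
  have hs0 : ∀ z ∈ s, g z = 0 := fun z hz => by
    have : z ∈ Γ ∩ V := ⟨(hs hz).1, (hball z (hsr z hz)).1⟩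
    rw [hΓ] at this
    exact this.2
  have hd : Metric.diam s ≤ r :=
    (Metric.diam_mono (fun z hz => (hs hz).2) Metric.isBounded_ball).trans
      ((Metric.diam_ball (by positivity)).trans (by linarith))
  set d := Metric.diam s with hd'
  have hd0 : 0 ≤ d := Metric.diam_nonneg
  have hyp : y ∈ Metric.ball p (r / 2) :=
    convexHull_min (fun z hz => (hs hz).2) (convex_ball _ _) hy
  have hyv : ‖y - v‖ ≤ d := by
    rw [← dist_eq_norm, hd', ← convexHull_diam]
    exact Metric.dist_le_diam_of_mem (isBounded_convexHull.2 hsb) hy (subset_convexHull _ _ hv)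
  have hlin : fderiv ℝ g p y ∈ Icc (fderiv ℝ g p v - δ * d) (fderiv ℝ g p v + δ * d) := by
    refine convexHull_min (t := fderiv ℝ g p ⁻¹' Icc _ _) (fun z hz => ?_)
      ((convex_Icc _ _).linear_preimage (fderiv ℝ g p).toLinearMap) hy
    have h := hmv v (hsr v hv) z (hsr z hz)
    rw [hs0 z hz, hs0 v hv, map_sub] at h
    have h2 : δ * ‖z - v‖ ≤ δ * d := by
      gcongr
      rw [← dist_eq_norm]
      exact Metric.dist_le_diam_of_mem hsb hz hv
    have h3 := abs_le.1 (h.trans h2)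
    constructor <;> linarith [h3.1, h3.2]
  have hgy : |g y| ≤ 2 * δ * d := by
    have h := hmv v (hsr v hv) y (Metric.ball_subset_ball (by linarith) hyp)
    rw [hs0 v hv, map_sub] at h
    have h2 : δ * ‖y - v‖ ≤ δ * d := by gcongr
    have h3 := abs_le.1 (h.trans h2)
    rw [abs_le]
    constructor <;> linarith [h3.1, h3.2, hlin.1, hlin.2]
  set T := 4 * δ * d with hT
  have hT0 : 0 ≤ T := by positivity
  have hTν : T * ‖ν‖ ≤ r / 2 := by
    calc T * ‖ν‖ = 4 * d * (δ * ‖ν‖) := by ring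
      _ ≤ 4 * d * (1 / 8) := by gcongr
      _ ≤ r / 2 := by linarith
  have hin : ∀ t ∈ Icc (-T) T, y + t • ν ∈ Metric.ball p r := fun t ht => by
    have h1 : dist (y + t • ν) y ≤ r / 2 := by
      rw [dist_eq_norm, add_sub_cancel_left, norm_smul]
      exact (mul_le_mul_of_nonneg_right (abs_le.2 ht) hν0.le).trans hTν
    have h2 := Metric.mem_ball.1 hyp
    exact Metric.mem_ball.2 (by linarith [dist_triangle (y + t • ν) y p])
  have hchange : ∀ t ∈ Icc (-T) T, |g (y + t • ν) - g y - t| ≤ |t| / 2 := fun t ht => by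
    have h := hmv y (Metric.ball_subset_ball (by linarith) hyp) _ (hin t ht)
    rw [add_sub_cancel_left, map_smul, hν, norm_smul, smul_eq_mul, mul_one, Real.norm_eq_abs] at h
    refine h.trans ?_
    have : |t| * (δ * ‖ν‖) ≤ |t| * (1 / 8) := by gcongr
    nlinarith [abs_nonneg t]
  have hcontg : ContinuousOn (fun t : ℝ => g (y + t • ν)) (Icc (-T) T) :=
    hg.continuousOn.comp (by fun_prop) fun t ht => (hball _ (hin t ht)).1
  obtain ⟨t, ht, ht0⟩ : (0 : ℝ) ∈ (fun t : ℝ => g (y + t • ν)) '' Icc (-T) T := by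
    refine intermediate_value_Icc (by linarith) hcontg ⟨?_, ?_⟩
    · have h := abs_le.1 (hchange (-T) ⟨le_rfl, by linarith⟩)
      rw [abs_neg, abs_of_nonneg hT0] at h
      linarith [h.2, (abs_le.1 hgy).2]
    · have h := abs_le.1 (hchange T ⟨by linarith, le_rfl⟩)
      rw [abs_of_nonneg hT0] at h
      linarith [h.1, (abs_le.1 hgy).1]
  have hmem : y + t • ν ∈ Γ := by
    have : y + t • ν ∈ Γ ∩ V := by
      rw [hΓ]
      exact ⟨(hball _ (hin t ht)).1, ht0⟩
    exact this.1
  calc Metric.infDist y Γ ≤ dist y (y + t • ν) := Metric.infDist_le_dist_of_mem hmem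
    _ = |t| * ‖ν‖ := by simp [dist_eq_norm, norm_smul]
    _ ≤ T * ‖ν‖ := by gcongr; exact abs_le.2 ht
    _ = 4 * δ * ‖ν‖ * d := by ring
    _ ≤ ε * d := by gcongr

/-- The convex hull of a subset of `Γ` of small diameter `d` is within distance `o(d)` of `Γ`. -/
lemma exists_infDist_convexHull_le {Γ : Set E3} (hΓ : IsClosedSmoothSurface Γ) {ε : ℝ}
    (hε : 0 < ε) :
    ∃ h₀ > 0, ∀ s ⊆ Γ, Bornology.IsBounded s → Metric.diam s ≤ h₀ → ∀ y ∈ convexHull ℝ s,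
      Metric.infDist y Γ ≤ ε * Metric.diam s := by
  have hloc : ∀ p : Γ, ∃ ρ > 0, ∀ s ⊆ Γ ∩ Metric.ball p.1 ρ, ∀ y ∈ convexHull ℝ s,
      Metric.infDist y Γ ≤ ε * Metric.diam s := fun p => by
    obtain ⟨V, g, hV, hp, hg, hg', hVΓ⟩ := hΓ.exists_levelSet p.1 p.2
    exact exists_infDist_convexHull_le_of_levelSet hV hp hg (hg' _ hp) hVΓ hε
  choose ρ hρ hs using hloc
  obtain ⟨δ, hδ, hball⟩ := lebesgue_number_lemma_of_metric (c := fun p : Γ => Metric.ball p.1 (ρ p))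
    hΓ.isCompact (fun _ => Metric.isOpen_ball)
    fun x hx => mem_iUnion.2 ⟨⟨x, hx⟩, Metric.mem_ball_self (hρ _)⟩
  refine ⟨δ / 2, by positivity, fun s hsΓ hsb hd y hy => ?_⟩
  obtain ⟨v, hv⟩ : s.Nonempty := convexHull_nonempty_iff.1 ⟨y, hy⟩
  obtain ⟨p, hp⟩ := hball v (hsΓ hv)
  refine hs p s (fun z hz => ⟨hsΓ hz, hp ?_⟩) y hy
  have := Metric.dist_le_diam_of_mem hsb hz hv
  exact Metric.mem_ball.2 (by linarith)

/-! ### The reference triangle and Lagrange interpolation -/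

lemma bary_nonneg {x : R2} (hx : x ∈ refTriangle) (i : Fin 3) : 0 ≤ bary x i := by
  obtain ⟨h0, h1, h2⟩ := hx
  fin_cases i <;> simp [bary] <;> linarith

lemma sum_bary (x : R2) : ∑ i, bary x i = 1 := by
  simp [bary, Fin.sum_univ_three]
  ring

lemma isCompact_refTriangle : IsCompact refTriangle := by
  refine (isCompact_Icc (a := (0 : R2)) (b := 1)).of_isClosed_subset ?_ ?_
  · exact (isClosed_le continuous_const (continuous_apply 0)).inter
      ((isClosed_le continuous_const (continuous_apply 1)).inter
        (isClosed_le ((continuous_apply 0).add (continuous_apply 1)) continuous_const))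
  · rintro x ⟨h0, h1, h2⟩
    refine ⟨fun i => ?_, fun i => ?_⟩ <;> fin_cases i <;> simp <;> linarith

lemma continuous_eval (p : MvPolynomial (Fin 2) ℝ) :
    Continuous fun x : R2 => MvPolynomial.eval x p := MvPolynomial.continuous_eval p

lemma pderiv_mem_Pk {k : ℕ} {p : MvPolynomial (Fin 2) ℝ} (hp : p ∈ Pk k) (m : Fin 2) :
    MvPolynomial.pderiv m p ∈ Pk k := by
  rw [p.as_sum, map_sum]
  refine Submodule.sum_mem _ fun s hs => ?_
  rw [MvPolynomial.pderiv_monomial, MvPolynomial.mem_restrictTotalDegree]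
  refine (MvPolynomial.totalDegree_monomial_le _ _).trans ?_
  rw [MvPolynomial.mem_restrictTotalDegree] at hp
  refine le_trans ?_ ((MvPolynomial.le_totalDegree hs).trans hp)
  exact Finsupp.degree_mono tsub_le_self

namespace LagrangeElement

variable {k : ℕ} (L : LagrangeElement k)

lemma sum_eval_smul_basis {p : MvPolynomial (Fin 2) ℝ} (hp : p ∈ Pk k) :
    ∑ j, MvPolynomial.eval (L.node j) p • (L.basis j : MvPolynomial (Fin 2) ℝ) = p := by
  refine sub_eq_zero.1 (L.unisolvent _ ?_ fun i => ?_)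
  · exact Submodule.sub_mem _
      (Submodule.sum_mem _ fun j _ => Submodule.smul_mem _ _ (L.basis j).2) hp
  · simp [MvPolynomial.smul_eval, L.eval_basis]

lemma one_mem_Pk (k : ℕ) : (1 : MvPolynomial (Fin 2) ℝ) ∈ Pk k := by
  simp [MvPolynomial.mem_restrictTotalDegree]

lemma X_mem_Pk (hk : 1 ≤ k) (m : Fin 2) : (MvPolynomial.X m : MvPolynomial (Fin 2) ℝ) ∈ Pk k := by
  simpa [MvPolynomial.mem_restrictTotalDegree] using hk

lemma sum_eval_basis (x : R2) :
    ∑ j, MvPolynomial.eval x (L.basis j : MvPolynomial (Fin 2) ℝ) = 1 := by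
  simpa using congrArg (MvPolynomial.eval x) (L.sum_eval_smul_basis (one_mem_Pk k))

lemma sum_eval_pderiv_basis (x : R2) (m : Fin 2) :
    ∑ j, MvPolynomial.eval x (MvPolynomial.pderiv m (L.basis j : MvPolynomial (Fin 2) ℝ)) = 0 := by
  simpa using congrArg (fun p => MvPolynomial.eval x (MvPolynomial.pderiv m p))
    (L.sum_eval_smul_basis (one_mem_Pk k))

lemma sum_node_mul_eval_basis (hk : 1 ≤ k) (x : R2) (i : Fin 2) :
    ∑ j, L.node j i * MvPolynomial.eval x (L.basis j : MvPolynomial (Fin 2) ℝ) = x i := by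
  simpa [MvPolynomial.smul_eval] using
    congrArg (MvPolynomial.eval x) (L.sum_eval_smul_basis (X_mem_Pk hk i))

lemma sum_node_mul_eval_pderiv_basis (hk : 1 ≤ k) (x : R2) (m i : Fin 2) :
    ∑ j, L.node j i *
      MvPolynomial.eval x (MvPolynomial.pderiv m (L.basis j : MvPolynomial (Fin 2) ℝ))
      = if i = m then 1 else 0 := by
  have h := congrArg (fun p => MvPolynomial.eval x (MvPolynomial.pderiv m p))
    (L.sum_eval_smul_basis (X_mem_Pk hk i))
  simp only [map_sum, Derivation.map_smul, MvPolynomial.smul_eval, MvPolynomial.eval_X,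
    MvPolynomial.pderiv_X] at h
  rw [h]
  by_cases him : i = m <;> simp [him]

/-- A bound on the reference triangle for the Lebesgue function of the nodal basis and for its
analogue with first derivatives. -/
lemma exists_sum_abs_basis_le : ∃ A > 0, ∀ x ∈ refTriangle,
    ∑ j, |MvPolynomial.eval x (L.basis j : MvPolynomial (Fin 2) ℝ)| ≤ A ∧
    ∀ m, ∑ j, |MvPolynomial.eval x
      (MvPolynomial.pderiv m (L.basis j : MvPolynomial (Fin 2) ℝ))| ≤ A := by
  obtain ⟨C, hC⟩ := isCompact_refTriangle.exists_bound_of_continuousOn (E := ℝ)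
    (f := fun x => (∑ j, |MvPolynomial.eval x (L.basis j : MvPolynomial (Fin 2) ℝ)|) +
      ∑ m, ∑ j, |MvPolynomial.eval x
      (MvPolynomial.pderiv m (L.basis j : MvPolynomial (Fin 2) ℝ))|)
    (by
      refine Continuous.continuousOn ?_
      refine .add (continuous_finsetSum _ fun j _ => (continuous_eval _).abs) ?_
      exact continuous_finsetSum _ fun m _ => continuous_finsetSum _ fun j _ =>
        (continuous_eval _).abs)
  refine ⟨max C 1, by positivity, fun x hx => ?_⟩
  have h := (le_abs_self _).trans ((hC x hx).trans (le_max_left C 1))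
  have h1 : 0 ≤ ∑ j, |MvPolynomial.eval x (L.basis j : MvPolynomial (Fin 2) ℝ)| := by positivity
  have h2 : ∀ m, ∑ j, |MvPolynomial.eval x
      (MvPolynomial.pderiv m (L.basis j : MvPolynomial (Fin 2) ℝ))| ≤ ∑ m, ∑ j,
      |MvPolynomial.eval x (MvPolynomial.pderiv m (L.basis j : MvPolynomial (Fin 2) ℝ))| :=
    fun m => Finset.single_le_sum (f := fun m => ∑ j, |MvPolynomial.eval x
      (MvPolynomial.pderiv m (L.basis j : MvPolynomial (Fin 2) ℝ))|)
      (fun m _ => by positivity) (Finset.mem_univ m)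
  have h3 : 0 ≤ ∑ j, |MvPolynomial.eval x
      (MvPolynomial.pderiv 0 (L.basis j : MvPolynomial (Fin 2) ℝ))| := by positivity
  exact ⟨by linarith [h2 0], fun m => by linarith [h2 m]⟩

end LagrangeElement

/-! ### Shape regular planar triangles -/

namespace SurfaceMesh

variable {Γ U : Set E3} (M : SurfaceMesh Γ U)

/-- The linear part of the affine map `flatPoint K` from the reference triangle to the planar
triangle `K`. -/
noncomputable def flatVec (K : Fin M.numElts) (w : R2) : E3 :=
  w 0 • (M.vertex K 1 - M.vertex K 0) + w 1 • (M.vertex K 2 - M.vertex K 0)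

lemma flatPoint_eq (K : Fin M.numElts) (x : R2) :
    M.flatPoint K x = M.vertex K 0 + M.flatVec K x := by
  simp only [flatPoint, flatVec, bary, Fin.sum_univ_three, Matrix.cons_val_zero,
    Matrix.cons_val_one, Matrix.cons_val]
  module

lemma flatPoint_refVertex (K : Fin M.numElts) (i : Fin 3) :
    M.flatPoint K (refVertex i) = M.vertex K i := by
  rw [flatPoint_eq]
  fin_cases i <;> simp [flatVec, refVertex]

lemma flatVec_sub (K : Fin M.numElts) (x y : R2) :
    M.flatVec K (x - y) = M.flatVec K x - M.flatVec K y := by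
  simp only [flatVec, Pi.sub_apply]
  module

lemma flatVec_eq_zero {K : Fin M.numElts} {w : R2} (h : M.flatVec K w = 0) : w = 0 := by
  have hli := (affineIndependent_iff_linearIndependent_vsub ℝ _ (0 : Fin 3)).1
    (M.affineIndependent K)
  rw [Fintype.linearIndependent_iff] at hli
  have key := hli (fun i => if i.1 = 1 then w 0 else w 1) ?_
  · ext i
    fin_cases i
    · simpa using key ⟨1, by decide⟩
    · simpa using key ⟨2, by decide⟩
  · rw [← h, flatVec]
    rw [← Finset.sum_subtype (p := fun i : Fin 3 => i ≠ 0) (Finset.univ.erase 0) (by simp)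
      (fun i => (if i = 1 then w 0 else w 1) • (M.vertex K i -ᵥ M.vertex K 0))]
    rw [show (Finset.univ.erase (0 : Fin 3)) = {1, 2} by decide]
    rw [Finset.sum_pair (by decide)]
    simp

lemma flatPoint_injective (K : Fin M.numElts) : Function.Injective (M.flatPoint K) := by
  intro x y h
  rw [flatPoint_eq, flatPoint_eq, add_right_inj] at h
  exact sub_eq_zero.1 (M.flatVec_eq_zero (by rw [flatVec_sub, h, sub_self]))

lemma flatPoint_mem {K : Fin M.numElts} {x : R2} (hx : x ∈ refTriangle) :
    M.flatPoint K x ∈ M.flat K :=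
  (convex_convexHull ℝ _).sum_mem (fun i _ => bary_nonneg hx i) (sum_bary x)
    fun i _ => subset_convexHull ℝ _ (mem_range_self i)

lemma exists_flatPoint_eq {K : Fin M.numElts} {y : E3} (hy : y ∈ M.flat K) :
    ∃ x ∈ refTriangle, M.flatPoint K x = y := by
  refine convexHull_min (t := M.flatPoint K '' refTriangle) ?_ ?_ hy
  · rintro _ ⟨i, rfl⟩
    refine ⟨refVertex i, ?_, M.flatPoint_refVertex K i⟩
    fin_cases i <;> simp [refTriangle, refVertex]
  · rintro _ ⟨x, hx, rfl⟩ _ ⟨y, hy, rfl⟩ a b ha hb hab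
    refine ⟨a • x + b • y, ⟨?_, ?_, ?_⟩, ?_⟩
    · have := hx.1; have := hy.1
      simp only [Pi.add_apply, Pi.smul_apply, smul_eq_mul]; positivity
    · have := hx.2.1; have := hy.2.1
      simp only [Pi.add_apply, Pi.smul_apply, smul_eq_mul]; positivity
    · simp only [Pi.add_apply, Pi.smul_apply, smul_eq_mul]
      nlinarith [hx.2.2, hy.2.2]
    · simp only [flatPoint_eq, flatVec, Pi.add_apply, Pi.smul_apply, smul_eq_mul]
      obtain rfl : a = 1 - b := by linarith
      module

/-- The diameter of the planar triangle `K`. -/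
noncomputable def eltDiam (K : Fin M.numElts) : ℝ := Metric.diam (M.flat K)

lemma isBounded_flat (K : Fin M.numElts) : Bornology.IsBounded (M.flat K) :=
  isBounded_convexHull.2 (Set.finite_range _).isBounded

lemma dist_le_eltDiam {K : Fin M.numElts} {y z : E3} (hy : y ∈ M.flat K) (hz : z ∈ M.flat K) :
    dist y z ≤ M.eltDiam K := Metric.dist_le_diam_of_mem (M.isBounded_flat K) hy hz

lemma vertex_mem_flat (K : Fin M.numElts) (i : Fin 3) : M.vertex K i ∈ M.flat K :=
  subset_convexHull ℝ _ (mem_range_self i)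

lemma eltDiam_pos (K : Fin M.numElts) : 0 < M.eltDiam K := by
  refine lt_of_lt_of_le (dist_pos.2 ?_)
    (M.dist_le_eltDiam (M.vertex_mem_flat K 0) (M.vertex_mem_flat K 1))
  exact (M.affineIndependent K).injective.ne (by decide)

lemma eltDiam_le_meshSize (K : Fin M.numElts) : M.eltDiam K ≤ M.meshSize :=
  le_ciSup (f := fun K => Metric.diam (M.flat K)) (Set.finite_range _).bddAbove K

lemma norm_flatVec_le (K : Fin M.numElts) (w : R2) :
    ‖M.flatVec K w‖ ≤ 2 * M.eltDiam K * ‖w‖ := by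
  have h : ∀ i, ‖M.vertex K i - M.vertex K 0‖ ≤ M.eltDiam K := fun i => by
    rw [← dist_eq_norm]
    exact M.dist_le_eltDiam (M.vertex_mem_flat K i) (M.vertex_mem_flat K 0)
  refine (norm_add_le _ _).trans ?_
  rw [norm_smul, norm_smul]
  have h0 := mul_le_mul (norm_le_pi_norm w 0) (h 1) (norm_nonneg _) (norm_nonneg w)
  have h1 := mul_le_mul (norm_le_pi_norm w 1) (h 2) (norm_nonneg _) (norm_nonneg w)
  linarith

/-- Moving from the centre of the inscribed disc by its radius in the direction `flatVec K w` stays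
in the triangle, so that the barycentric coordinates change by at most one. -/
lemma le_norm_flatVec {κ : ℝ} (hκ : 0 < κ) (hM : M.ShapeRegular κ) (K : Fin M.numElts) (w : R2) :
    κ⁻¹ * M.eltDiam K * ‖w‖ ≤ ‖M.flatVec K w‖ := by
  rcases eq_or_ne w 0 with rfl | hw
  · simp
  have hd : 0 < ‖M.flatVec K w‖ := norm_pos_iff.2 fun h => hw (M.flatVec_eq_zero h)
  obtain ⟨c, hc, hdisc⟩ := hM K
  have hh := M.eltDiam_pos K
  have hcK : c ∈ M.flat K := hdisc c hc (by simpa using Metric.diam_nonneg)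
  obtain ⟨x, hx, rfl⟩ := M.exists_flatPoint_eq hcK
  set s := κ⁻¹ * M.eltDiam K / ‖M.flatVec K w‖ with hs
  have hs0 : 0 < s := by positivity
  have hy : M.flatPoint K (x + s • w) = M.flatPoint K x + s • M.flatVec K w := by
    simp only [flatPoint_eq, flatVec, Pi.add_apply, Pi.smul_apply, smul_eq_mul]
    module
  have hmem : M.flatPoint K x + s • M.flatVec K w ∈ affineSpan ℝ (range (M.vertex K)) := by
    have hv : ∀ i, M.vertex K i -ᵥ M.vertex K 0 ∈ (affineSpan ℝ (range (M.vertex K))).direction :=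
      fun i => AffineSubspace.vsub_mem_direction (mem_affineSpan ℝ (mem_range_self i))
        (mem_affineSpan ℝ (mem_range_self 0))
    rw [add_comm]
    refine AffineSubspace.vadd_mem_of_mem_direction (Submodule.smul_mem _ _ ?_) hc
    exact Submodule.add_mem _ (Submodule.smul_mem _ _ (hv 1)) (Submodule.smul_mem _ _ (hv 2))
  have hin : M.flatPoint K x + s • M.flatVec K w ∈ M.flat K := by
    refine hdisc _ hmem (le_of_eq ?_)
    rw [dist_eq_norm, add_sub_cancel_left, norm_smul, Real.norm_of_nonneg hs0.le, hs,
      div_mul_cancel₀ _ hd.ne', mul_inv_cancel_left₀ hκ.ne', eltDiam]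
  obtain ⟨y, hy', hyeq⟩ := M.exists_flatPoint_eq hin
  rw [← hy] at hyeq
  obtain rfl := M.flatPoint_injective K hyeq
  have hsw : s * ‖w‖ ≤ 1 := by
    rw [← Real.norm_of_nonneg hs0.le, ← norm_smul, pi_norm_le_iff_of_nonneg zero_le_one]
    obtain ⟨a0, a1, a2⟩ := hx
    obtain ⟨b0, b1, b2⟩ := hy'
    simp only [Pi.add_apply] at b0 b1 b2
    intro i
    rw [Real.norm_eq_abs, abs_le]
    fin_cases i <;> constructor <;> simp only [Fin.zero_eta, Fin.mk_one] <;> linarith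
  rw [hs, div_mul_eq_mul_div, div_le_one hd] at hsw
  exact hsw

end SurfaceMesh

/-! ### Regularity of the curved elements -/

variable {Γ U : Set E3} {k : ℕ}

lemma dist_closestPoint (hU : IsTube Γ U) {x : E3} (hx : x ∈ U) :
    dist x (closestPoint Γ x) = Metric.infDist x Γ := by
  have h : ∃ ξ : E3, ξ ∈ Γ ∧ dist x ξ = Metric.infDist x Γ := (hU.existsUnique_closest x hx).exists
  rw [closestPoint, dif_pos h]
  exact h.choose_spec.2

lemma closestPoint_of_mem (hU : IsTube Γ U) {x : E3} (hx : x ∈ Γ) : closestPoint Γ x = x := by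
  have h := dist_closestPoint hU (hU.subset hx)
  rw [Metric.infDist_zero_of_mem hx] at h
  exact (dist_eq_zero.1 h).symm

lemma param_refVertex (hU : IsTube Γ U) (L : LagrangeElement k) (M : SurfaceMesh Γ U)
    (K : Fin M.numElts) (i : Fin 3) : param L M K (refVertex i) = M.vertex K i := by
  obtain ⟨j, hj⟩ := L.vertex_node i
  rw [param, ← hj]
  simp only [L.eval_basis, ite_smul, one_smul, zero_smul, Finset.sum_ite_eq', Finset.mem_univ,
    if_true]
  rw [hj, M.flatPoint_refVertex, closestPoint_of_mem hU (M.vertex_mem K i)]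

/-- The curved element and its parametrization differ from the planar ones by the interpolated
displacement `x ↦ closestPoint Γ x - x`. -/
lemma param_sub_flatPoint (hk : 1 ≤ k) (L : LagrangeElement k) (M : SurfaceMesh Γ U)
    (K : Fin M.numElts) (x : R2) :
    param L M K x - M.flatPoint K x =
      ∑ j, MvPolynomial.eval x (L.basis j : MvPolynomial (Fin 2) ℝ) •
        (closestPoint Γ (M.flatPoint K (L.node j)) - M.flatPoint K (L.node j)) := by
  simp only [smul_sub, Finset.sum_sub_distrib]
  rw [param]
  congr 1
  simp only [M.flatPoint_eq, SurfaceMesh.flatVec, smul_add, Finset.sum_add_distrib, smul_smul]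
  rw [← Finset.sum_smul, L.sum_eval_basis, one_smul, ← Finset.sum_smul, ← Finset.sum_smul]
  congr 3 <;> simp only [mul_comm, L.sum_node_mul_eval_basis hk]

lemma dparam_sub_flatVec (hk : 1 ≤ k) (L : LagrangeElement k) (M : SurfaceMesh Γ U)
    (K : Fin M.numElts) (x : R2) (m : Fin 2) :
    dparam L M K x m - M.flatVec K (Pi.single m 1) =
      ∑ j, MvPolynomial.eval x
        (MvPolynomial.pderiv m (L.basis j : MvPolynomial (Fin 2) ℝ)) •
        (closestPoint Γ (M.flatPoint K (L.node j)) - M.flatPoint K (L.node j)) := by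
  simp only [smul_sub, Finset.sum_sub_distrib]
  rw [dparam]
  congr 1
  simp only [M.flatPoint_eq, SurfaceMesh.flatVec, smul_add, Finset.sum_add_distrib, smul_smul]
  rw [← Finset.sum_smul, L.sum_eval_pderiv_basis, zero_smul, zero_add, ← Finset.sum_smul,
    ← Finset.sum_smul]
  congr 2 <;> simp only [mul_comm, L.sum_node_mul_eval_pderiv_basis hk, Pi.single_apply]

lemma norm_sum_smul_le {n : ℕ} (c : Fin n → ℝ) (v : Fin n → E3) {A d : ℝ} (hd : 0 ≤ d)
    (hc : ∑ j, |c j| ≤ A) (hv : ∀ j, ‖v j‖ ≤ d) : ‖∑ j, c j • v j‖ ≤ A * d := by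
  refine (norm_sum_le _ _).trans ?_
  refine le_trans (Finset.sum_le_sum (g := fun j => |c j| * d) fun j _ => ?_) ?_
  · rw [norm_smul, Real.norm_eq_abs]
    exact mul_le_mul_of_nonneg_left (hv j) (abs_nonneg _)
  · rw [← Finset.sum_mul]
    exact mul_le_mul_of_nonneg_right hc hd

/-- The uniform geometric estimates on which the analysis rests: with the constants `a` and `b`,
the parametrizations of the curved elements are comparable with the planar ones, and the diameter of
an edge and the diameters of the two adjacent triangles are comparable. -/
structure IsRegularMesh (L : LagrangeElement k) (M : SurfaceMesh Γ U) (a b : ℝ) : Prop where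
  lower_pos : 0 < a
  upper_pos : 0 < b
  le_norm_pushVec : ∀ K, ∀ x ∈ refTriangle, ∀ w, a * M.eltDiam K * ‖w‖ ≤ ‖pushVec L M K x w‖
  norm_pushVec_le : ∀ K, ∀ x ∈ refTriangle, ∀ w, ‖pushVec L M K x w‖ ≤ b * M.eltDiam K * ‖w‖
  edgeDiam_pos : ∀ e, 0 < edgeDiam L M e
  edgeDiam_le : ∀ e s, edgeDiam L M e ≤ b * M.eltDiam (M.edgeElt e s)
  eltDiam_le : ∀ e s, M.eltDiam (M.edgeElt e .plus) ≤ b * M.eltDiam (M.edgeElt e s)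

lemma refVertex_mem (i : Fin 3) : refVertex i ∈ refTriangle := by
  fin_cases i <;> simp [refTriangle, refVertex]

lemma edgePoint_mem (M : SurfaceMesh Γ U) (e : Fin M.numEdges) (s : Side) {t : ℝ}
    (ht : t ∈ Icc (0 : ℝ) 1) : edgePoint M e s t ∈ refTriangle := by
  obtain ⟨a0, a1, a2⟩ := refVertex_mem (M.edgeLoc e s 0)
  obtain ⟨b0, b1, b2⟩ := refVertex_mem (M.edgeLoc e s 1)
  have h0 := ht.1
  have h1 : 0 ≤ 1 - t := by linarith [ht.2]
  refine ⟨?_, ?_, ?_⟩ <;> simp only [edgePoint, Pi.add_apply, Pi.smul_apply, smul_eq_mul]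
  · positivity
  · positivity
  · nlinarith

lemma one_le_norm_refVertex_sub {i j : Fin 3} (h : i ≠ j) :
    1 ≤ ‖refVertex i - refVertex j‖ := by
  have h0 := norm_le_pi_norm (refVertex i - refVertex j) 0
  have h1 := norm_le_pi_norm (refVertex i - refVertex j) 1
  fin_cases i <;> fin_cases j <;> simp [refVertex] at h h0 h1 ⊢ <;> assumption

/-- If the nodes are displaced by at most a small multiple of the diameter of the triangle,
then the curved elements inherit the regularity of the planar ones. -/
lemma isRegularMesh_of_dist_closestPoint_le (hU : IsTube Γ U) (hk : 1 ≤ k) (L : LagrangeElement k)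
    {κ : ℝ} (hκ : 0 < κ) {A : ℝ}
    (hLA : ∀ x ∈ refTriangle, ∑ j, |MvPolynomial.eval x (L.basis j : MvPolynomial (Fin 2) ℝ)| ≤ A ∧
      ∀ m, ∑ j, |MvPolynomial.eval x
        (MvPolynomial.pderiv m (L.basis j : MvPolynomial (Fin 2) ℝ))| ≤ A)
    {ε : ℝ} (hε : 0 < ε) (hε1 : A * ε ≤ 1) (hε2 : 4 * (A * ε) ≤ κ⁻¹)
    (M : SurfaceMesh Γ U) (hM : M.ShapeRegular κ)
    (hclose : ∀ K, ∀ x ∈ refTriangle,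
      dist (M.flatPoint K x) (closestPoint Γ (M.flatPoint K x)) ≤ ε * M.eltDiam K) :
    IsRegularMesh L M (κ⁻¹ / 2) (4 + κ + 3 * κ) := by
  have hκ' : 0 < κ⁻¹ := inv_pos.2 hκ
  have hd : ∀ K j, ‖closestPoint Γ (M.flatPoint K (L.node j)) - M.flatPoint K (L.node j)‖
      ≤ ε * M.eltDiam K := fun K j => by
    rw [← dist_eq_norm, dist_comm]
    exact hclose K _ (L.node_mem j)
  have hp : ∀ K, 0 < M.eltDiam K := M.eltDiam_pos
  have hpush : ∀ K, ∀ x ∈ refTriangle, ∀ w, ‖pushVec L M K x w - M.flatVec K w‖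
      ≤ 2 * (A * ε) * M.eltDiam K * ‖w‖ := fun K x hx w => by
    have h : pushVec L M K x w - M.flatVec K w =
        ∑ m, w m • (dparam L M K x m - M.flatVec K (Pi.single m 1)) := by
      simp [pushVec, SurfaceMesh.flatVec, Fin.sum_univ_two]
      module
    rw [h, Fin.sum_univ_two]
    refine (norm_add_le _ _).trans ?_
    have hm : ∀ m, ‖w m • (dparam L M K x m - M.flatVec K (Pi.single m 1))‖
        ≤ ‖w‖ * (A * (ε * M.eltDiam K)) := fun m => by
      rw [norm_smul, dparam_sub_flatVec hk]
      refine mul_le_mul (norm_le_pi_norm w m) ?_ (norm_nonneg _) (norm_nonneg w)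
      exact norm_sum_smul_le _ _ (mul_nonneg hε.le (hp K).le) ((hLA x hx).2 m) (hd K)
    linarith [hm 0, hm 1]
  have hparam : ∀ K, ∀ x ∈ refTriangle, dist (param L M K x) (M.flatPoint K x) ≤ M.eltDiam K :=
    fun K x hx => by
    rw [dist_eq_norm, param_sub_flatPoint hk]
    refine (norm_sum_smul_le _ _ (mul_nonneg hε.le (hp K).le) (hLA x hx).1 (hd K)).trans ?_
    nlinarith [hp K]
  have hdist : ∀ K, ∀ x ∈ refTriangle, ∀ y ∈ refTriangle,
      dist (param L M K x) (param L M K y) ≤ 3 * M.eltDiam K := fun K x hx y hy => by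
    have h1 := hparam K x hx
    have h2 := hparam K y hy
    rw [dist_comm] at h2
    linarith [dist_triangle4 (param L M K x) (M.flatPoint K x) (M.flatPoint K y) (param L M K y),
      M.dist_le_eltDiam (M.flatPoint_mem (K := K) hx) (M.flatPoint_mem (K := K) hy)]
  -- Both adjacent triangles have a diameter comparable with the length of the planar edge.
  have hedge : ∀ e s, κ⁻¹ * M.eltDiam (M.edgeElt e s) ≤
      dist (M.vertex (M.edgeElt e .plus) (M.edgeLoc e .plus 0))
        (M.vertex (M.edgeElt e .plus) (M.edgeLoc e .plus 1)) := fun e s => by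
    have h1 : κ⁻¹ * M.eltDiam (M.edgeElt e s) ≤
        dist (M.vertex (M.edgeElt e s) (M.edgeLoc e s 0))
          (M.vertex (M.edgeElt e s) (M.edgeLoc e s 1)) := by
      rw [← M.flatPoint_refVertex, ← M.flatPoint_refVertex, dist_eq_norm, M.flatPoint_eq,
        M.flatPoint_eq, add_sub_add_left_eq_sub, ← M.flatVec_sub]
      refine le_trans ?_ (M.le_norm_flatVec hκ hM _ _)
      have h2 := one_le_norm_refVertex_sub ((M.edgeLoc_injective e s).ne (zero_ne_one))
      have := hp (M.edgeElt e s)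
      exact le_mul_of_one_le_right (by positivity) h2
    cases s with
    | plus => exact h1
    | minus => rwa [M.edge_match, M.edge_match]
  have hedge' : ∀ e s, dist (M.vertex (M.edgeElt e .plus) (M.edgeLoc e .plus 0))
        (M.vertex (M.edgeElt e .plus) (M.edgeLoc e .plus 1)) ≤ M.eltDiam (M.edgeElt e s) :=
    fun e s => by
    cases s with
    | plus => exact M.dist_le_eltDiam (M.vertex_mem_flat _ _) (M.vertex_mem_flat _ _)
    | minus =>
      rw [M.edge_match, M.edge_match]
      exact M.dist_le_eltDiam (M.vertex_mem_flat _ _) (M.vertex_mem_flat _ _)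
  have hcmp : ∀ e s, M.eltDiam (M.edgeElt e .plus) ≤ κ * M.eltDiam (M.edgeElt e s) :=
    fun e s => by
    have h := (hedge e .plus).trans (hedge' e s)
    rwa [inv_mul_le_iff₀ hκ] at h
  have hcurve : ∀ e, ∀ p ∈ (fun t => param L M (M.edgeElt e .plus) (edgePoint M e .plus t)) ''
      Icc 0 1, ∀ q ∈ (fun t => param L M (M.edgeElt e .plus) (edgePoint M e .plus t)) '' Icc 0 1,
      dist p q ≤ 3 * M.eltDiam (M.edgeElt e .plus) := by
    rintro e _ ⟨t, ht, rfl⟩ _ ⟨t', ht', rfl⟩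
    exact hdist _ _ (edgePoint_mem M e _ ht) _ (edgePoint_mem M e _ ht')
  refine ⟨by positivity, by positivity, fun K x hx w => ?_, fun K x hx w => ?_, fun e => ?_,
    fun e s => ?_, fun e s => ?_⟩
  · have h1 := M.le_norm_flatVec hκ hM K w
    have h2 := hpush K x hx w
    have h3 := norm_sub_norm_le (M.flatVec K w) (pushVec L M K x w)
    rw [norm_sub_rev] at h3
    have h4 : 2 * (A * ε) * M.eltDiam K * ‖w‖ ≤ κ⁻¹ / 2 * M.eltDiam K * ‖w‖ := by
      have := hp K
      gcongr
      linarith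
    linarith
  · have h1 := M.norm_flatVec_le K w
    have h2 := hpush K x hx w
    have h3 := norm_sub_norm_le (pushVec L M K x w) (M.flatVec K w)
    have h4 : 2 * (A * ε) * M.eltDiam K * ‖w‖ ≤ 2 * M.eltDiam K * ‖w‖ := by
      have := hp K
      gcongr
      linarith
    have h5 : 0 ≤ (κ + 3 * κ) * M.eltDiam K * ‖w‖ := by
      have := hp K
      positivity
    linarith
  · have hpos : 0 < dist (M.vertex (M.edgeElt e .plus) (M.edgeLoc e .plus 0))
        (M.vertex (M.edgeElt e .plus) (M.edgeLoc e .plus 1)) :=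
      lt_of_lt_of_le (mul_pos hκ' (hp _)) (hedge e .plus)
    refine hpos.trans_le (Metric.dist_le_diam_of_mem ?_ ?_ ?_)
    · exact Metric.isBounded_iff.2 ⟨_, fun p hp q hq => hcurve e p hp q hq⟩
    · exact ⟨0, by simp, by simp [edgePoint, param_refVertex hU]⟩
    · exact ⟨1, by simp, by simp [edgePoint, param_refVertex hU]⟩
  · have h1 : edgeDiam L M e ≤ 3 * M.eltDiam (M.edgeElt e .plus) :=
      Metric.diam_le_of_forall_dist_le (by linarith [hp (M.edgeElt e .plus)]) (hcurve e)
    have h2 := hcmp e s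
    nlinarith [hp (M.edgeElt e s)]
  · have h2 := hcmp e s
    nlinarith [hp (M.edgeElt e s)]

/-- Fine shape regular meshes are regular, with constants depending on the shape regularity. -/
theorem exists_isRegularMesh (hΓ : IsClosedSmoothSurface Γ) (hU : IsTube Γ U) (hk : 1 ≤ k)
    (L : LagrangeElement k) {κ : ℝ} (hκ : 0 < κ) :
    ∃ h₀ > 0, ∃ a b : ℝ, 0 < a ∧ 0 < b ∧ ∀ M : SurfaceMesh Γ U, M.ShapeRegular κ →
      M.meshSize ≤ h₀ → IsRegularMesh L M a b := by
  obtain ⟨A, hA, hLA⟩ := L.exists_sum_abs_basis_le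
  obtain ⟨ε, hε, hε1, hε2⟩ : ∃ ε > 0, A * ε ≤ 1 ∧ 4 * (A * ε) ≤ κ⁻¹ := by
    refine ⟨min 1 (κ⁻¹ / 4) / A, by positivity, ?_, ?_⟩
    · rw [mul_div_cancel₀ _ hA.ne']; exact min_le_left _ _
    · rw [mul_div_cancel₀ _ hA.ne']; linarith [min_le_right 1 (κ⁻¹ / 4)]
  obtain ⟨h₀, hh₀, hdist⟩ := exists_infDist_convexHull_le hΓ hε
  refine ⟨h₀, hh₀, κ⁻¹ / 2, 4 + κ + 3 * κ, by positivity, by positivity, fun M hM hMh =>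
    isRegularMesh_of_dist_closestPoint_le hU hk L hκ hLA hε hε1 hε2 M hM fun K x hx => ?_⟩
  have hmem := M.flatPoint_mem (K := K) hx
  have hdiam : Metric.diam (range (M.vertex K)) = M.eltDiam K := (convexHull_diam _).symm
  rw [dist_closestPoint hU (M.subset_tube K hmem), ← hdiam]
  refine hdist _ (range_subset_iff.2 (M.vertex_mem K)) (Set.finite_range _).isBounded ?_ _ hmem
  rw [hdiam]
  exact (M.eltDiam_le_meshSize K).trans hMh

/-! ### Polynomials on the reference triangle -/

/-- The Riesz representation for a definite, not necessarily symmetric, bilinear form on a finite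
dimensional space. -/
lemma exists_apply_eq_of_definite {V : Type*} [AddCommGroup V] [Module ℝ V]
    [FiniteDimensional ℝ V] (B : V →ₗ[ℝ] V →ₗ[ℝ] ℝ) (hB : ∀ v, B v v = 0 → v = 0)
    (l : V →ₗ[ℝ] ℝ) : ∃ w, ∀ v, B w v = l v := by
  have hinj : Function.Injective B := by
    rw [injective_iff_map_eq_zero]
    intro v hv
    exact hB v (by simp [hv])
  obtain ⟨w, hw⟩ := (LinearMap.injective_iff_surjective_of_finrank_eq_finrank
    (Subspace.dual_finrank_eq (K := ℝ) (V := V)).symm).1 hinj l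
  exact ⟨w, fun v => by rw [hw]⟩

lemma measurableSet_refTriangle : MeasurableSet refTriangle :=
  isCompact_refTriangle.isClosed.measurableSet

lemma integrable_refTriangle {f : R2 → ℝ} (hf : ContinuousOn f refTriangle) :
    Integrable f (volume.restrict refTriangle) :=
  hf.integrableOn_compact isCompact_refTriangle

lemma integrable_eval_mul_eval (p q : MvPolynomial (Fin 2) ℝ) :
    Integrable (fun x => MvPolynomial.eval x p * MvPolynomial.eval x q)
      (volume.restrict refTriangle) :=
  integrable_refTriangle ((continuous_eval p).mul (continuous_eval q)).continuousOn

/-- The `L²` inner product of polynomials on the reference triangle. -/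
noncomputable def refForm (k : ℕ) : Pk k →ₗ[ℝ] Pk k →ₗ[ℝ] ℝ :=
  LinearMap.mk₂ ℝ (fun p q => ∫ x in refTriangle, MvPolynomial.eval x (p : MvPolynomial (Fin 2) ℝ)
      * MvPolynomial.eval x (q : MvPolynomial (Fin 2) ℝ))
    (fun p p' q => by
      rw [← integral_add (integrable_eval_mul_eval _ _) (integrable_eval_mul_eval _ _)]
      simp [add_mul])
    (fun c p q => by
      rw [smul_eq_mul, ← integral_const_mul]
      simp [MvPolynomial.smul_eval, mul_assoc])
    (fun p q q' => by
      rw [← integral_add (integrable_eval_mul_eval _ _) (integrable_eval_mul_eval _ _)]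
      simp [mul_add])
    (fun c p q => by
      rw [smul_eq_mul, ← integral_const_mul]
      simp [MvPolynomial.smul_eval, mul_left_comm])

lemma refForm_apply (k : ℕ) (p q : Pk k) :
    refForm k p q = ∫ x in refTriangle, MvPolynomial.eval x (p : MvPolynomial (Fin 2) ℝ)
      * MvPolynomial.eval x (q : MvPolynomial (Fin 2) ℝ) := rfl

lemma refForm_nonneg (k : ℕ) (p : Pk k) : 0 ≤ refForm k p p :=
  integral_nonneg fun _ => mul_self_nonneg _

lemma refForm_isSymm (k : ℕ) : (refForm k : LinearMap.BilinForm ℝ (Pk k)).IsSymm :=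
  ⟨fun p q => by simp [refForm_apply, mul_comm]⟩

lemma refForm_definite (k : ℕ) (p : Pk k) (hp : refForm k p p = 0) : p = 0 := by
  rw [refForm_apply, integral_eq_zero_iff_of_nonneg (fun _ => mul_self_nonneg _)
    (integrable_eval_mul_eval _ _)] at hp
  set S : Set R2 := Set.pi univ fun _ => Ioo (0 : ℝ) (1 / 2) with hS
  have hSK : S ⊆ refTriangle := fun x hx => by
    have h0 := hx 0 (mem_univ _)
    have h1 := hx 1 (mem_univ _)
    exact ⟨h0.1.le, h1.1.le, by linarith [h0.2, h1.2]⟩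
  have hSo : IsOpen S := isOpen_set_pi finite_univ fun _ _ => isOpen_Ioo
  have h := Measure.eqOn_open_of_ae_eq (ae_restrict_of_ae_restrict_of_subset hSK hp) hSo
    ((continuous_eval _).mul (continuous_eval _)).continuousOn continuousOn_const
  refine Subtype.ext (MvPolynomial.funext_set (fun _ => Ioo (0 : ℝ) (1 / 2))
    (fun _ => Ioo_infinite (by norm_num)) fun x hx => ?_)
  simpa using h hx

/-- The inverse inequality between the maximum norm and the `L²` norm of polynomials. -/
lemma exists_eval_sq_le {k : ℕ} (L : LagrangeElement k) : ∃ C > 0, ∀ p : Pk k, ∀ x ∈ refTriangle,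
    MvPolynomial.eval x (p : MvPolynomial (Fin 2) ℝ) ^ 2 ≤ C * refForm k p p := by
  obtain ⟨A, hA, hLA⟩ := L.exists_sum_abs_basis_le
  have hrep : ∀ j, ∃ w : Pk k, ∀ p : Pk k,
      refForm k w p = MvPolynomial.eval (L.node j) (p : MvPolynomial (Fin 2) ℝ) := fun j =>
    exists_apply_eq_of_definite (refForm k) (refForm_definite k)
      ((MvPolynomial.aeval (R := ℝ) (L.node j)).toLinearMap.comp (Pk k).subtype)
  choose w hw using hrep
  set D := ∑ j, refForm k (w j) (w j) with hD
  have hD0 : 0 ≤ D := Finset.sum_nonneg fun j _ => refForm_nonneg k _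
  refine ⟨A ^ 2 * D + 1, by positivity, fun p x hx => ?_⟩
  have hp0 := refForm_nonneg k p
  have hnode : ∀ j, |MvPolynomial.eval (L.node j) (p : MvPolynomial (Fin 2) ℝ)|
      ≤ √(D * refForm k p p) := fun j => by
    rw [← hw]
    refine Real.abs_le_sqrt ?_
    refine (LinearMap.BilinForm.apply_sq_le_of_symm (refForm k) (refForm_nonneg k)
      (refForm_isSymm k) _ _).trans ?_
    gcongr
    exact Finset.single_le_sum (f := fun j => refForm k (w j) (w j))
      (fun j _ => refForm_nonneg k _) (Finset.mem_univ j)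
  have hx' : |MvPolynomial.eval x (p : MvPolynomial (Fin 2) ℝ)| ≤ A * √(D * refForm k p p) := by
    have h := congrArg (MvPolynomial.eval x) (L.sum_eval_smul_basis p.2)
    simp only [map_sum, MvPolynomial.smul_eval] at h
    rw [← h]
    refine (Finset.abs_sum_le_sum_abs _ _).trans ?_
    refine le_trans (Finset.sum_le_sum (g := fun j =>
      |MvPolynomial.eval x (L.basis j : MvPolynomial (Fin 2) ℝ)| * √(D * refForm k p p))
      fun j _ => ?_) ?_
    · rw [abs_mul, mul_comm]
      exact mul_le_mul_of_nonneg_left (hnode j) (abs_nonneg _)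
    · rw [← Finset.sum_mul]
      exact mul_le_mul_of_nonneg_right (hLA x hx).1 (Real.sqrt_nonneg _)
  rw [← sq_abs]
  calc _ ≤ (A * √(D * refForm k p p)) ^ 2 := by gcongr
    _ = A ^ 2 * D * refForm k p p := by rw [mul_pow, Real.sq_sqrt (by positivity)]; ring
    _ ≤ _ := by nlinarith

/-! ### The metric of the curved elements -/

variable {Γ U : Set E3} {k : ℕ} {L : LagrangeElement k} {M : SurfaceMesh Γ U}

lemma pushVec_add (K : Fin M.numElts) (x v w : R2) :
    pushVec L M K x (v + w) = pushVec L M K x v + pushVec L M K x w := by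
  simp [pushVec, add_smul, Finset.sum_add_distrib]

lemma pushVec_smul (K : Fin M.numElts) (x : R2) (c : ℝ) (w : R2) :
    pushVec L M K x (c • w) = c • pushVec L M K x w := by
  simp [pushVec, mul_smul]

lemma pushCovec_add (K : Fin M.numElts) (x p q : R2) :
    pushCovec L M K x (p + q) = pushCovec L M K x p + pushCovec L M K x q := by
  rw [pushCovec, Matrix.mulVec_add, pushVec_add]; rfl

lemma pushCovec_smul (K : Fin M.numElts) (x : R2) (c : ℝ) (q : R2) :
    pushCovec L M K x (c • q) = c • pushCovec L M K x q := by
  rw [pushCovec, Matrix.mulVec_smul, pushVec_smul]; rfl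

lemma inner_pushVec_pushVec (K : Fin M.numElts) (x v w : R2) :
    inner ℝ (pushVec L M K x v) (pushVec L M K x w) = v ⬝ᵥ (gram L M K x *ᵥ w) := by
  simp [pushVec, gram, Matrix.mulVec, dotProduct, Fin.sum_univ_two, inner_add_left,
    inner_add_right, inner_smul_left, inner_smul_right]
  ring

lemma det_gram (K : Fin M.numElts) (x : R2) : (gram L M K x).det =
    ‖dparam L M K x 0‖ ^ 2 * ‖dparam L M K x 1‖ ^ 2
      - inner ℝ (dparam L M K x 0) (dparam L M K x 1) ^ 2 := by
  rw [Matrix.det_fin_two]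
  simp only [gram, Matrix.of_apply, real_inner_self_eq_norm_sq]
  rw [real_inner_comm (dparam L M K x 0) (dparam L M K x 1)]
  ring

lemma norm_single_one (m : Fin 2) : ‖(Pi.single m 1 : R2)‖ = 1 := by
  rw [Pi.norm_single, norm_one]

lemma pushVec_single (K : Fin M.numElts) (x : R2) (m : Fin 2) :
    pushVec L M K x (Pi.single m 1) = dparam L M K x m := by
  fin_cases m <;> simp [pushVec]

namespace IsRegularMesh

variable {a b : ℝ} (hM : IsRegularMesh L M a b)
include hM

lemma sqrt_det_gram_le (K : Fin M.numElts) {x : R2} (hx : x ∈ refTriangle) :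
    √(gram L M K x).det ≤ b ^ 2 * M.eltDiam K ^ 2 := by
  have h : ∀ m, ‖dparam L M K x m‖ ≤ b * M.eltDiam K := fun m => by
    simpa [pushVec_single, norm_single_one] using hM.norm_pushVec_le K x hx (Pi.single m 1)
  have hb := hM.upper_pos
  have hh := M.eltDiam_pos K
  rw [Real.sqrt_le_left (by positivity), det_gram]
  have h0 := mul_le_mul (pow_le_pow_left₀ (norm_nonneg _) (h 0) 2)
    (pow_le_pow_left₀ (norm_nonneg _) (h 1) 2) (by positivity) (by positivity)
  nlinarith [sq_nonneg (inner ℝ (dparam L M K x 0) (dparam L M K x 1))]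

/-- The lower bound for the area element comes from the component of the second column of `∇F_K`
orthogonal to the first one. -/
lemma le_det_gram (K : Fin M.numElts) {x : R2} (hx : x ∈ refTriangle) :
    (a ^ 2 * M.eltDiam K ^ 2) ^ 2 ≤ (gram L M K x).det := by
  have ha := hM.lower_pos
  have hh := M.eltDiam_pos K
  set d0 := dparam L M K x 0 with hd0
  set d1 := dparam L M K x 1 with hd1
  have h0 : a * M.eltDiam K ≤ ‖d0‖ := by
    simpa [pushVec_single, norm_single_one] using hM.le_norm_pushVec K x hx (Pi.single 0 1)
  have hd : 0 < ‖d0‖ := lt_of_lt_of_le (by positivity) h0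
  have h1 := hM.le_norm_pushVec K x hx ![-inner ℝ d0 d1, ‖d0‖ ^ 2]
  have h2 : ‖d0‖ ^ 2 ≤ ‖(![-inner ℝ d0 d1, ‖d0‖ ^ 2] : R2)‖ := by
    exact (le_abs_self _).trans (norm_le_pi_norm (![-inner ℝ d0 d1, ‖d0‖ ^ 2] : R2) 1)
  have h3 : ‖pushVec L M K x ![-inner ℝ d0 d1, ‖d0‖ ^ 2]‖ ^ 2 =
      ‖d0‖ ^ 2 * (gram L M K x).det := by
    rw [det_gram, ← real_inner_self_eq_norm_sq (pushVec _ _ _ _ _)]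
    simp only [pushVec, Fin.sum_univ_two, Matrix.cons_val_zero, Matrix.cons_val_one,
      inner_add_left, inner_add_right, inner_smul_left, inner_smul_right,
      real_inner_self_eq_norm_sq, ← hd0, ← hd1, real_inner_comm d0 d1]
    simp
    ring
  have h4 : (a * M.eltDiam K * ‖d0‖ ^ 2) ^ 2 ≤ ‖d0‖ ^ 2 * (gram L M K x).det := by
    rw [← h3]
    refine pow_le_pow_left₀ (by positivity) (le_trans ?_ h1) 2
    gcongr
  have h5 : (a * M.eltDiam K) ^ 2 * ‖d0‖ ^ 2 ≤ (gram L M K x).det := by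
    refine le_of_mul_le_mul_left ?_ (pow_pos hd 2)
    linarith
  refine le_trans ?_ h5
  have h6 : (a * M.eltDiam K) ^ 2 ≤ ‖d0‖ ^ 2 := by gcongr
  nlinarith [pow_pos (mul_pos ha hh) 2]

lemma det_gram_pos (K : Fin M.numElts) {x : R2} (hx : x ∈ refTriangle) :
    0 < (gram L M K x).det := by
  have ha := hM.lower_pos
  have hh := M.eltDiam_pos K
  exact lt_of_lt_of_le (by positivity) (hM.le_det_gram K hx)

lemma le_sqrt_det_gram (K : Fin M.numElts) {x : R2} (hx : x ∈ refTriangle) :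
    a ^ 2 * M.eltDiam K ^ 2 ≤ √(gram L M K x).det :=
  Real.le_sqrt_of_sq_le (hM.le_det_gram K hx)

lemma inner_pushVec_pushCovec (K : Fin M.numElts) {x : R2} (hx : x ∈ refTriangle) (w q : R2) :
    inner ℝ (pushVec L M K x w) (pushCovec L M K x q) = w ⬝ᵥ q := by
  rw [pushCovec, inner_pushVec_pushVec, Matrix.mulVec_mulVec,
    Matrix.mul_nonsing_inv _ (hM.det_gram_pos K hx).ne'.isUnit, Matrix.one_mulVec]

lemma norm_le_norm_pushCovec (K : Fin M.numElts) {x : R2} (hx : x ∈ refTriangle) (q : R2) :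
    ‖q‖ ≤ b * M.eltDiam K * ‖pushCovec L M K x q‖ := by
  rcases eq_or_ne q 0 with rfl | hq
  · have := hM.upper_pos
    have := M.eltDiam_pos K
    simp only [norm_zero]
    positivity
  have h1 : ‖q‖ ^ 2 ≤ q ⬝ᵥ q := by
    obtain ⟨i, hi⟩ : ∃ i, ‖q‖ = ‖q i‖ := by
      obtain ⟨i, -, hi⟩ := Finset.exists_mem_eq_sup' (s := (Finset.univ : Finset (Fin 2)))
        Finset.univ_nonempty (fun i => ‖q i‖₊)
      refine ⟨i, ?_⟩
      rw [Pi.norm_def, ← Finset.sup'_eq_sup Finset.univ_nonempty, hi, coe_nnnorm]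
    rw [hi, Real.norm_eq_abs, sq_abs, sq]
    exact Finset.single_le_sum (f := fun i => q i * q i) (fun i _ => mul_self_nonneg _)
      (Finset.mem_univ i)
  rw [← hM.inner_pushVec_pushCovec K hx] at h1
  have h2 := real_inner_le_norm (pushVec L M K x q) (pushCovec L M K x q)
  have h3 := mul_le_mul_of_nonneg_right (hM.norm_pushVec_le K x hx q)
    (norm_nonneg (pushCovec L M K x q))
  refine le_of_mul_le_mul_left ?_ (norm_pos_iff.2 hq)
  nlinarith

lemma norm_pushCovec_le (K : Fin M.numElts) {x : R2} (hx : x ∈ refTriangle) (q : R2) :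
    a * M.eltDiam K * ‖pushCovec L M K x q‖ ≤ 2 * ‖q‖ := by
  set z := (gram L M K x)⁻¹ *ᵥ q
  have h1 : ‖pushCovec L M K x q‖ ^ 2 = z ⬝ᵥ q := by
    rw [← hM.inner_pushVec_pushCovec K hx, ← real_inner_self_eq_norm_sq]
    rfl
  have h2 : z ⬝ᵥ q ≤ 2 * ‖z‖ * ‖q‖ := by
    have h : ∀ i, z i * q i ≤ ‖z‖ * ‖q‖ := fun i => by
      refine (le_abs_self _).trans ?_
      rw [abs_mul]
      exact mul_le_mul (norm_le_pi_norm z i) (norm_le_pi_norm q i) (abs_nonneg _) (norm_nonneg _)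
    rw [dotProduct, Fin.sum_univ_two]
    linarith [h 0, h 1]
  have h3 : a * M.eltDiam K * ‖z‖ ≤ ‖pushCovec L M K x q‖ := hM.le_norm_pushVec K x hx z
  rcases eq_or_lt_of_le (norm_nonneg (pushCovec L M K x q)) with h | h
  · rw [← h]; simp
  refine le_of_mul_le_mul_left ?_ h
  have h4 : 0 < a * M.eltDiam K := mul_pos hM.lower_pos (M.eltDiam_pos K)
  have h5 := mul_le_mul_of_nonneg_right h3 (norm_nonneg q)
  nlinarith [mul_le_mul_of_nonneg_left (h1.le.trans h2) h4.le]

end IsRegularMesh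
/-! ### Continuity of the geometric quantities -/

lemma continuous_dparam (K : Fin M.numElts) (m : Fin 2) :
    Continuous fun x => dparam L M K x m :=
  continuous_finsetSum _ fun _ _ => (continuous_eval _).smul continuous_const

lemma continuous_det_gram (K : Fin M.numElts) : Continuous fun x => (gram L M K x).det := by
  simp only [det_gram]
  have := continuous_dparam (L := L) K
  exact ((((this 0).norm.pow 2).mul ((this 1).norm.pow 2)).sub (((this 0).inner (this 1)).pow 2))

lemma continuousOn_pushVec {X : Type*} [TopologicalSpace X] {s : Set X} (K : Fin M.numElts)
    {f w : X → R2} (hf : ContinuousOn f s) (hw : ContinuousOn w s) :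
    ContinuousOn (fun y => pushVec L M K (f y) (w y)) s :=
  continuousOn_finsetSum _ fun m _ => (((continuous_apply m).comp_continuousOn hw)).smul
    ((continuous_dparam K m).comp_continuousOn hf)

lemma continuous_edgePoint (e : Fin M.numEdges) (s : Side) : Continuous (edgePoint M e s) := by
  unfold edgePoint
  fun_prop

lemma continuousOn_edgeTangent (e : Fin M.numEdges) (s : Side) :
    ContinuousOn (edgeTangent L M e s) (Icc 0 1) :=
  continuousOn_pushVec _ (continuous_edgePoint e s).continuousOn continuousOn_const

/-- The direction from an end point of a reference edge to the centroid is transversal to the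
edge. -/
lemma centroid_sub_ne_smul {i j : Fin 3} (h : i ≠ j) (c : ℝ) :
    ((fun _ => 1 / 3) - refVertex i : R2) - c • (refVertex j - refVertex i) ≠ 0 := by
  intro h'
  have h0 := congrFun h' 0
  have h1 := congrFun h' 1
  simp only [Pi.sub_apply, Pi.smul_apply, smul_eq_mul, Pi.zero_apply] at h0 h1
  fin_cases i <;> fin_cases j <;> simp [refVertex] at h h0 h1 <;> linarith

lemma ae_dS {e : Fin M.numEdges} {p : ℝ → Prop}
    (h : ∀ t ∈ Icc (0 : ℝ) 1, p t) : ∀ᵐ t ∂(dS L M e), p t :=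
  (withDensity_absolutelyContinuous _ _).ae_le (ae_restrict_of_forall_mem measurableSet_Icc h)

namespace IsRegularMesh

variable {a b : ℝ} (hM : IsRegularMesh L M a b)
include hM

lemma pushVec_ne_zero (K : Fin M.numElts) {x : R2} (hx : x ∈ refTriangle) {w : R2} (hw : w ≠ 0) :
    pushVec L M K x w ≠ 0 := by
  have h := hM.le_norm_pushVec K x hx w
  have h1 := mul_pos (mul_pos hM.lower_pos (M.eltDiam_pos K)) (norm_pos_iff.2 hw)
  exact norm_pos_iff.1 (h1.trans_le h)

lemma continuousOn_pushCovec (K : Fin M.numElts) {q : R2 → R2} (hq : ContinuousOn q refTriangle) :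
    ContinuousOn (fun x => pushCovec L M K x (q x)) refTriangle := by
  refine continuousOn_pushVec K continuousOn_id ?_
  have hd := continuous_dparam (L := L) K
  have hdet : ContinuousOn (fun x => ((gram L M K x).det)⁻¹) refTriangle :=
    (continuous_det_gram K).continuousOn.inv₀ fun x hx => (hM.det_gram_pos K hx).ne'
  have hg : ∀ i j, ContinuousOn (fun x => gram L M K x i j) refTriangle := fun i j =>
    ((hd i).inner (hd j)).continuousOn
  have hinv : ContinuousOn (fun x => (gram L M K x)⁻¹) refTriangle := by
    simp only [Matrix.inv_def, Ring.inverse_eq_inv', Matrix.adjugate_fin_two]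
    refine hdet.smul (continuousOn_pi.2 fun i => continuousOn_pi.2 fun j => ?_)
    fin_cases i <;> fin_cases j
    · exact hg 1 1
    · exact (hg 0 1).neg
    · exact (hg 1 0).neg
    · exact hg 0 0
  refine continuousOn_pi.2 fun i => ?_
  simp only [Matrix.mulVec, dotProduct]
  refine continuousOn_finsetSum _ fun j _ => ?_
  exact (((continuous_apply_apply i j).comp_continuousOn hinv)).mul
    ((continuous_apply j).comp_continuousOn hq)

lemma continuousOn_fluxValue (ρ : FluxSpace k M) (K : Fin M.numElts) :
    ContinuousOn (fluxValue L ρ K) refTriangle :=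
  hM.continuousOn_pushCovec K
    (continuous_pi fun m => continuous_eval (ρ K m : MvPolynomial (Fin 2) ℝ)).continuousOn

lemma edgeTangent_ne_zero (e : Fin M.numEdges) (s : Side) {t : ℝ} (ht : t ∈ Icc (0 : ℝ) 1) :
    edgeTangent L M e s t ≠ 0 := by
  refine hM.pushVec_ne_zero _ (edgePoint_mem M e s ht) fun h => ?_
  have := one_le_norm_refVertex_sub ((M.edgeLoc_injective e s).ne (one_ne_zero))
  rw [h, norm_zero] at this
  linarith

lemma inwardVec_ne_zero (e : Fin M.numEdges) (s : Side) {t : ℝ} (ht : t ∈ Icc (0 : ℝ) 1) :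
    inwardVec L M e s t ≠ 0 := by
  simp only [inwardVec]
  rw [edgeTangent, ← pushVec_smul, sub_eq_add_neg, ← neg_one_smul ℝ (pushVec _ _ _ _ (_ • _)),
    ← pushVec_smul, ← pushVec_add, neg_one_smul, ← sub_eq_add_neg]
  exact hM.pushVec_ne_zero _ (edgePoint_mem M e s ht)
    (centroid_sub_ne_smul ((M.edgeLoc_injective e s).ne (zero_ne_one)) _)

lemma norm_conormal (e : Fin M.numEdges) (s : Side) {t : ℝ} (ht : t ∈ Icc (0 : ℝ) 1) :
    ‖conormal L M e t s‖ = 1 := by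
  rw [conormal, norm_neg, norm_smul, norm_inv, norm_norm,
    inv_mul_cancel₀ (norm_ne_zero_iff.2 (hM.inwardVec_ne_zero e s ht))]

lemma continuousOn_conormal (e : Fin M.numEdges) (s : Side) :
    ContinuousOn (fun t => conormal L M e t s) (Icc 0 1) := by
  have hτ := continuousOn_edgeTangent (L := L) e s
  have hw : ContinuousOn (fun t => pushVec L M (M.edgeElt e s) (edgePoint M e s t)
      ((fun _ => 1 / 3) - refVertex (M.edgeLoc e s 0))) (Icc 0 1) :=
    continuousOn_pushVec _ (continuous_edgePoint e s).continuousOn continuousOn_const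
  have hi : ContinuousOn (inwardVec L M e s) (Icc 0 1) :=
    hw.sub (ContinuousOn.smul ((ContinuousOn.inner (𝕜 := ℝ) hw hτ).div (hτ.inner hτ) fun t ht =>
      inner_self_ne_zero.2 (hM.edgeTangent_ne_zero e s ht)) hτ)
  exact ((hi.norm.inv₀ fun t ht => norm_ne_zero_iff.2 (hM.inwardVec_ne_zero e s ht)).smul hi).neg

lemma continuousOn_trace_fluxValue (τ : FluxSpace k M) (e : Fin M.numEdges) (s : Side) :
    ContinuousOn (fun t => trace (fluxValue L τ) e t s) (Icc 0 1) :=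
  (hM.continuousOn_fluxValue τ _).comp (continuous_edgePoint e s).continuousOn
    fun _ ht => edgePoint_mem M e s ht

/-! ### The surface and arc length measures -/

lemma dA_le (K : Fin M.numElts) : dA L M K ≤
    ENNReal.ofReal (b ^ 2 * M.eltDiam K ^ 2) • volume.restrict refTriangle := by
  rw [dA, ← withDensity_const]
  exact withDensity_mono (ae_restrict_of_forall_mem measurableSet_refTriangle fun x hx =>
    ENNReal.ofReal_le_ofReal (hM.sqrt_det_gram_le K hx))

lemma le_dA (K : Fin M.numElts) :
    ENNReal.ofReal (a ^ 2 * M.eltDiam K ^ 2) • volume.restrict refTriangle ≤ dA L M K := by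
  rw [dA, ← withDensity_const]
  exact withDensity_mono (ae_restrict_of_forall_mem measurableSet_refTriangle fun x hx =>
    ENNReal.ofReal_le_ofReal (hM.le_sqrt_det_gram K hx))

lemma integrable_dA (K : Fin M.numElts) {f : R2 → ℝ} (hf : ContinuousOn f refTriangle) :
    Integrable f (dA L M K) :=
  ((integrable_refTriangle hf).smul_measure ENNReal.ofReal_ne_top).mono_measure (hM.dA_le K)

lemma mul_integral_le_integral_dA (K : Fin M.numElts) {f : R2 → ℝ}
    (hf : ContinuousOn f refTriangle) (hf0 : ∀ x, 0 ≤ f x) :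
    a ^ 2 * M.eltDiam K ^ 2 * ∫ x in refTriangle, f x ≤ ∫ x, f x ∂(dA L M K) := by
  have h := integral_mono_measure (hM.le_dA K) (Filter.Eventually.of_forall hf0)
    (hM.integrable_dA K hf)
  rwa [integral_smul_measure, ENNReal.toReal_ofReal (by positivity), smul_eq_mul] at h

lemma dS_le (e : Fin M.numEdges) : dS L M e ≤
    ENNReal.ofReal (b * M.eltDiam (M.edgeElt e .plus)) • volume.restrict (Icc 0 1) := by
  rw [dS, ← withDensity_const]
  refine withDensity_mono (ae_restrict_of_forall_mem measurableSet_Icc fun t ht =>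
    ENNReal.ofReal_le_ofReal ?_)
  refine (hM.norm_pushVec_le _ _ (edgePoint_mem M e _ ht) _).trans ?_
  have hb := hM.upper_pos
  have hh := M.eltDiam_pos (M.edgeElt e .plus)
  refine mul_le_of_le_one_right (by positivity) ?_
  rw [pi_norm_le_iff_of_nonneg zero_le_one]
  obtain ⟨a0, a1, a2⟩ := refVertex_mem (M.edgeLoc e .plus 0)
  obtain ⟨b0, b1, b2⟩ := refVertex_mem (M.edgeLoc e .plus 1)
  intro i
  rw [Real.norm_eq_abs, abs_le]
  fin_cases i <;> constructor <;> simp only [Fin.zero_eta, Fin.mk_one, Pi.sub_apply] <;> linarith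

lemma integrable_dS (e : Fin M.numEdges) {f : ℝ → ℝ} (hf : ContinuousOn f (Icc 0 1)) :
    Integrable f (dS L M e) :=
  ((hf.integrableOn_compact isCompact_Icc).smul_measure
    ENNReal.ofReal_ne_top).mono_measure (hM.dS_le e)

lemma integral_dS_le (e : Fin M.numEdges) {f : ℝ → ℝ} (hf : ContinuousOn f (Icc 0 1))
    (hf0 : ∀ t, 0 ≤ f t) {C : ℝ} (hC : ∀ t ∈ Icc (0 : ℝ) 1, f t ≤ C) :
    ∫ t, f t ∂(dS L M e) ≤ b * M.eltDiam (M.edgeElt e .plus) * C := by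
  have hb := hM.upper_pos
  have hh := M.eltDiam_pos (M.edgeElt e .plus)
  have hfi : IntegrableOn f (Icc 0 1) := hf.integrableOn_compact isCompact_Icc
  have h := integral_mono_measure (hM.dS_le e) (Filter.Eventually.of_forall hf0)
    (hfi.smul_measure ENNReal.ofReal_ne_top)
  rw [integral_smul_measure, ENNReal.toReal_ofReal (by positivity), smul_eq_mul] at h
  refine h.trans (mul_le_mul_of_nonneg_left ?_ (by positivity))
  have h2 := setIntegral_mono_on hfi (integrableOn_const (by simp) (by simp) (C := C))
    measurableSet_Icc hC
  simpa using h2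

end IsRegularMesh
lemma fluxValue_add (ρ τ : FluxSpace k M) (K : Fin M.numElts) (x : R2) :
    fluxValue L (ρ + τ) K x = fluxValue L ρ K x + fluxValue L τ K x := by
  rw [fluxValue, fluxValue, fluxValue, ← pushCovec_add]
  congr 1
  ext m
  simp

lemma fluxValue_smul (c : ℝ) (ρ : FluxSpace k M) (K : Fin M.numElts) (x : R2) :
    fluxValue L (c • ρ) K x = c • fluxValue L ρ K x := by
  rw [fluxValue, fluxValue, ← pushCovec_smul]
  congr 1
  ext m
  simp [MvPolynomial.smul_eval]

lemma fluxValue_congr {ρ τ : FluxSpace k M} {K : Fin M.numElts} (h : ρ K = τ K) :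
    fluxValue L ρ K = fluxValue L τ K := by
  ext1 x
  rw [fluxValue, fluxValue, h]

/-- Young's inequality with the weight `ε`, for a combination of two normal fluxes. -/
lemma neg_mul_le_of_abs_le_one {x y c d ε : ℝ} (hε : 0 < ε) (hc : |c| ≤ 1) (hd : |d| ≤ 1) (φ : ℝ) :
    -(φ * (c * x + d * y)) ≤ (2 * ε)⁻¹ * φ ^ 2 + ε * (x ^ 2 + y ^ 2) := by
  have hc2 : c ^ 2 ≤ 1 := (sq_le_one_iff_abs_le_one c).2 hc
  have hd2 : d ^ 2 ≤ 1 := (sq_le_one_iff_abs_le_one d).2 hd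
  have h1 : (c * x + d * y) ^ 2 ≤ 2 * (x ^ 2 + y ^ 2) := by
    nlinarith [sq_nonneg (c * x - d * y), mul_le_mul_of_nonneg_right hc2 (sq_nonneg x),
      mul_le_mul_of_nonneg_right hd2 (sq_nonneg y)]
  have h2 : 0 ≤ (2 * ε)⁻¹ * (φ + ε * (c * x + d * y)) ^ 2 := by positivity
  have h3 : (2 * ε)⁻¹ * (φ + ε * (c * x + d * y)) ^ 2 = (2 * ε)⁻¹ * φ ^ 2 + φ * (c * x + d * y)
      + ε / 2 * (c * x + d * y) ^ 2 := by
    field_simp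
    ring
  nlinarith

namespace IsRegularMesh

variable {a b : ℝ} (hM : IsRegularMesh L M a b)

/-! ### The inner product of discrete fluxes -/

lemma integrable_inner_fluxValue (hM : IsRegularMesh L M a b) (ρ τ : FluxSpace k M)
    (K : Fin M.numElts) :
    Integrable (fun x => inner ℝ (fluxValue L ρ K x) (fluxValue L τ K x)) (dA L M K) :=
  hM.integrable_dA K ((hM.continuousOn_fluxValue ρ K).inner (hM.continuousOn_fluxValue τ K))

/-- The `L²` inner product of discrete fluxes on one element. -/
noncomputable def eltForm (hM : IsRegularMesh L M a b) (K : Fin M.numElts) :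
    FluxSpace k M →ₗ[ℝ] FluxSpace k M →ₗ[ℝ] ℝ :=
  LinearMap.mk₂ ℝ (fun ρ τ => ∫ x, inner ℝ (fluxValue L ρ K x) (fluxValue L τ K x) ∂(dA L M K))
    (fun ρ ρ' τ => by
      rw [← integral_add (hM.integrable_inner_fluxValue _ _ _)
        (hM.integrable_inner_fluxValue _ _ _)]
      simp only [fluxValue_add, inner_add_left])
    (fun c ρ τ => by
      rw [smul_eq_mul, ← integral_const_mul]
      simp only [fluxValue_smul, inner_smul_left, RCLike.conj_to_real])
    (fun ρ τ τ' => by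
      rw [← integral_add (hM.integrable_inner_fluxValue _ _ _)
        (hM.integrable_inner_fluxValue _ _ _)]
      simp only [fluxValue_add, inner_add_right])
    (fun c ρ τ => by
      rw [smul_eq_mul, ← integral_const_mul]
      simp only [fluxValue_smul, inner_smul_right])

lemma eltForm_apply (K : Fin M.numElts) (ρ τ : FluxSpace k M) : hM.eltForm K ρ τ =
    ∫ x, inner ℝ (fluxValue L ρ K x) (fluxValue L τ K x) ∂(dA L M K) := rfl

lemma eltForm_self (K : Fin M.numElts) (ρ : FluxSpace k M) :
    hM.eltForm K ρ ρ = ∫ x, ‖fluxValue L ρ K x‖ ^ 2 ∂(dA L M K) := by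
  simp only [eltForm_apply, real_inner_self_eq_norm_sq]

lemma eltForm_self_nonneg (K : Fin M.numElts) (ρ : FluxSpace k M) : 0 ≤ hM.eltForm K ρ ρ := by
  rw [eltForm_self]
  exact integral_nonneg fun _ => by positivity

/-- The `L²(Γ_h^k)` inner product of discrete fluxes. -/
noncomputable def fluxForm (hM : IsRegularMesh L M a b) :
    FluxSpace k M →ₗ[ℝ] FluxSpace k M →ₗ[ℝ] ℝ :=
  ∑ K, hM.eltForm K

lemma fluxForm_eq_sum (ρ τ : FluxSpace k M) : hM.fluxForm ρ τ = ∑ K, hM.eltForm K ρ τ := by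
  simp [fluxForm]

lemma fluxForm_apply (ρ τ : FluxSpace k M) : hM.fluxForm ρ τ =
    ∑ K, ∫ x, inner ℝ (fluxValue L ρ K x) (fluxValue L τ K x) ∂(dA L M K) :=
  hM.fluxForm_eq_sum ρ τ

lemma fluxForm_self_nonneg (ρ : FluxSpace k M) : 0 ≤ hM.fluxForm ρ ρ := by
  rw [fluxForm_eq_sum]
  exact Finset.sum_nonneg fun K _ => hM.eltForm_self_nonneg K ρ

lemma fluxForm_comm (ρ τ : FluxSpace k M) : hM.fluxForm ρ τ = hM.fluxForm τ ρ := by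
  simp only [fluxForm_apply, real_inner_comm]

lemma fluxForm_sq_le (ρ τ : FluxSpace k M) :
    hM.fluxForm ρ τ ^ 2 ≤ hM.fluxForm ρ ρ * hM.fluxForm τ τ :=
  LinearMap.BilinForm.apply_sq_le_of_symm hM.fluxForm hM.fluxForm_self_nonneg
    ⟨fun ρ τ => hM.fluxForm_comm ρ τ⟩ ρ τ

/-- The inverse inequality for the reference coordinates of a discrete flux. It is independent of
the size of the element, as the scalings of the flux and of the area element cancel. -/
lemma eval_sq_le_eltForm {C : ℝ} (hC0 : 0 < C) (hC : ∀ p : Pk k, ∀ x ∈ refTriangle,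
      MvPolynomial.eval x (p : MvPolynomial (Fin 2) ℝ) ^ 2 ≤ C * refForm k p p)
    (τ : FluxSpace k M) (K : Fin M.numElts) (m : Fin 2) {x : R2} (hx : x ∈ refTriangle) :
    MvPolynomial.eval x (τ K m : MvPolynomial (Fin 2) ℝ) ^ 2
      ≤ C * (b ^ 2 / a ^ 2) * hM.eltForm K τ τ := by
  have ha := hM.lower_pos
  have hb := hM.upper_pos
  have hh := M.eltDiam_pos K
  have hcont : ContinuousOn (fun x => ‖fluxValue L τ K x‖ ^ 2) refTriangle :=
    (hM.continuousOn_fluxValue τ K).norm.pow 2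
  have h1 : refForm k (τ K m) (τ K m) ≤ b ^ 2 * M.eltDiam K ^ 2 *
      ∫ x in refTriangle, ‖fluxValue L τ K x‖ ^ 2 := by
    rw [refForm_apply, ← integral_const_mul]
    refine setIntegral_mono_on (integrable_eval_mul_eval _ _)
      ((integrable_refTriangle hcont).const_mul _) measurableSet_refTriangle fun y hy => ?_
    have h := hM.norm_le_norm_pushCovec K hy
      fun m => MvPolynomial.eval y (τ K m : MvPolynomial (Fin 2) ℝ)
    have h' := (norm_le_pi_norm
      (fun m => MvPolynomial.eval y (τ K m : MvPolynomial (Fin 2) ℝ)) m).trans h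
    rw [← sq, ← sq_abs, ← mul_pow, ← mul_pow]
    exact pow_le_pow_left₀ (abs_nonneg _) h' 2
  have h2 := hM.mul_integral_le_integral_dA K hcont fun x => by positivity
  rw [← hM.eltForm_self] at h2
  have h3 : b ^ 2 * M.eltDiam K ^ 2 * ∫ x in refTriangle, ‖fluxValue L τ K x‖ ^ 2 ≤
      b ^ 2 / a ^ 2 * hM.eltForm K τ τ := by
    rw [div_mul_eq_mul_div, le_div_iff₀ (by positivity)]
    nlinarith [mul_le_mul_of_nonneg_left h2 (sq_nonneg b)]
  calc _ ≤ C * refForm k (τ K m) (τ K m) := hC _ x hx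
    _ ≤ C * (b ^ 2 / a ^ 2 * hM.eltForm K τ τ) := by gcongr; exact h1.trans h3
    _ = _ := by ring

lemma fluxForm_definite (τ : FluxSpace k M) (hτ : hM.fluxForm τ τ = 0) : τ = 0 := by
  obtain ⟨C, hC0, hC⟩ := exists_eval_sq_le L
  rw [fluxForm_eq_sum, Finset.sum_eq_zero_iff_of_nonneg
    fun K _ => hM.eltForm_self_nonneg K τ] at hτ
  ext1 K; ext1 m
  refine refForm_definite k _ ?_
  rw [refForm_apply, setIntegral_congr_fun (g := fun _ => 0) measurableSet_refTriangle]
  · simp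
  · intro x hx
    have h := hM.eval_sq_le_eltForm hC0 hC τ K m hx
    rw [hτ K (Finset.mem_univ K), mul_zero] at h
    have h0 := pow_eq_zero_iff (two_ne_zero) |>.1 (le_antisymm h (sq_nonneg _))
    simp [h0]

/-- The discrete trace inequality. -/
lemma trace_inequality {C : ℝ} (hC0 : 0 < C) (hC : ∀ p : Pk k, ∀ x ∈ refTriangle,
      MvPolynomial.eval x (p : MvPolynomial (Fin 2) ℝ) ^ 2 ≤ C * refForm k p p)
    (τ : FluxSpace k M) (e : Fin M.numEdges) (s : Side) :
    edgeDiam L M e * ∫ t, ‖trace (fluxValue L τ) e t s‖ ^ 2 ∂(dS L M e)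
      ≤ 4 * C * b ^ 5 / a ^ 4 * hM.eltForm (M.edgeElt e s) τ τ := by
  have ha := hM.lower_pos
  have hb := hM.upper_pos
  set K := M.edgeElt e s with hK
  have hh := M.eltDiam_pos K
  have hE := hM.eltForm_self_nonneg K τ
  have hpt : ∀ t ∈ Icc (0 : ℝ) 1, ‖trace (fluxValue L τ) e t s‖ ^ 2 ≤
      4 * C * b ^ 2 / a ^ 4 / M.eltDiam K ^ 2 * hM.eltForm K τ τ := fun t ht => by
    have hx := edgePoint_mem M e s ht
    have h1 : a * M.eltDiam K * ‖trace (fluxValue L τ) e t s‖ ≤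
        2 * √(C * (b ^ 2 / a ^ 2) * hM.eltForm K τ τ) := by
      refine (hM.norm_pushCovec_le K hx _).trans ?_
      gcongr
      rw [pi_norm_le_iff_of_nonneg (Real.sqrt_nonneg _)]
      exact fun m => Real.abs_le_sqrt (hM.eval_sq_le_eltForm hC0 hC τ K m hx)
    have h2 := pow_le_pow_left₀ (by positivity) h1 2
    rw [mul_pow 2, Real.sq_sqrt (by positivity), mul_pow] at h2
    calc ‖trace (fluxValue L τ) e t s‖ ^ 2 =
        (a * M.eltDiam K) ^ 2 * ‖trace (fluxValue L τ) e t s‖ ^ 2 / (a * M.eltDiam K) ^ 2 := by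
          field_simp
      _ ≤ 2 ^ 2 * (C * (b ^ 2 / a ^ 2) * hM.eltForm K τ τ) / (a * M.eltDiam K) ^ 2 := by gcongr
      _ = _ := by field_simp; ring
  have hcont : ContinuousOn (fun t => ‖trace (fluxValue L τ) e t s‖ ^ 2) (Icc 0 1) :=
    (hM.continuousOn_trace_fluxValue τ e s).norm.pow 2
  have hint := hM.integral_dS_le e hcont (fun _ => by positivity) hpt
  have h1 := hM.edgeDiam_le e s
  have h2 := hM.eltDiam_le e s
  have h3 := hM.edgeDiam_pos e
  calc _ ≤ (b * M.eltDiam K) * (b * (b * M.eltDiam K) *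
        (4 * C * b ^ 2 / a ^ 4 / M.eltDiam K ^ 2 * hM.eltForm K τ τ)) := by
        refine mul_le_mul h1 (hint.trans ?_) (integral_nonneg fun _ => by positivity)
          (by positivity)
        gcongr
    _ = _ := by field_simp

end IsRegularMesh
/-! ### Elements and their edges -/

namespace SurfaceMesh

/-- The edge `e` is an edge of the triangle `K`. -/
def IsEdgeOf (M : SurfaceMesh Γ U) (e : Fin M.numEdges) (K : Fin M.numElts) : Prop :=
  M.edgeElt e .plus = K ∨ M.edgeElt e .minus = K

lemma range_edge (e : Fin M.numEdges) (s : Side) :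
    (range fun i => M.vertex (M.edgeElt e .plus) (M.edgeLoc e .plus i)) =
      range fun i => M.vertex (M.edgeElt e s) (M.edgeLoc e s i) := by
  cases s with
  | plus => rfl
  | minus => simp only [M.edge_match]

open Classical in
lemma card_isEdgeOf_le (K : Fin M.numElts) :
    (Finset.univ.filter fun e => M.IsEdgeOf e K).card ≤ 3 := by
  have hside : ∀ e, M.IsEdgeOf e K → ∃ s, M.edgeElt e s = K := by
    rintro e (h | h)
    exacts [⟨_, h⟩, ⟨_, h⟩]
  have : Nonempty Side := ⟨.plus⟩
  choose! side hs using hside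
  have h3 : (Finset.powersetCard 2 (Finset.univ : Finset (Fin 3))).card = 3 := by decide
  rw [← h3]
  refine Finset.card_le_card_of_injOn
    (fun e => Finset.univ.image (M.edgeLoc e (side e))) (fun e he => ?_) fun e he e' he' h => ?_
  · simp [Finset.mem_powersetCard, Finset.card_image_of_injective _ (M.edgeLoc_injective _ _)]
  · refine M.edge_injective ?_
    have he := hs e (by simpa using he)
    have he' := hs e' (by simpa using he')
    have h' : range (M.edgeLoc e (side e)) = range (M.edgeLoc e' (side e')) := by
      simpa using congrArg (fun s : Finset (Fin 3) => (s : Set (Fin 3))) h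
    change (range fun i => _) = (range fun i => _)
    rw [M.range_edge e (side e), M.range_edge e' (side e'), he, he']
    have h2 := congrArg (fun s => M.vertex K '' s) h'
    rwa [← range_comp, ← range_comp] at h2

open Classical in
lemma sum_sum_isEdgeOf_le (f : Fin M.numElts → ℝ) (hf : ∀ K, 0 ≤ f K) :
    ∑ e, ∑ K, (if M.IsEdgeOf e K then f K else 0) ≤ 3 * ∑ K, f K := by
  rw [Finset.sum_comm, Finset.mul_sum]
  refine Finset.sum_le_sum fun K _ => ?_
  rw [← Finset.sum_filter, Finset.sum_const, nsmul_eq_mul]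
  exact mul_le_mul_of_nonneg_right (by exact_mod_cast M.card_isEdgeOf_le K) (hf K)

end SurfaceMesh

/-! ### Lifting operators -/

/-- A combination of the two normal fluxes on an edge; its special cases are `{τ; n}` and
`[τ; n]`. -/
noncomputable def edgeFlux (L : LagrangeElement k) (c d : ℝ) (e : Fin M.numEdges)
    (τ : FluxSpace k M) (t : ℝ) : ℝ :=
  c * inner ℝ (trace (fluxValue L τ) e t .plus) (conormal L M e t .plus) +
    d * inner ℝ (trace (fluxValue L τ) e t .minus) (conormal L M e t .minus)

lemma navg_eq_edgeFlux (e : Fin M.numEdges) (τ : FluxSpace k M) (t : ℝ) :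
    navg (trace (fluxValue L τ) e t) (conormal L M e t) = edgeFlux L (1 / 2) (-(1 / 2)) e τ t := by
  rw [navg, edgeFlux]
  ring

lemma njump_eq_edgeFlux (e : Fin M.numEdges) (τ : FluxSpace k M) (t : ℝ) :
    njump (trace (fluxValue L τ) e t) (conormal L M e t) = edgeFlux L 1 1 e τ t := by
  rw [njump, edgeFlux]
  ring

lemma edgeFlux_add (c d : ℝ) (e : Fin M.numEdges) (ρ τ : FluxSpace k M) (t : ℝ) :
    edgeFlux L c d e (ρ + τ) t = edgeFlux L c d e ρ t + edgeFlux L c d e τ t := by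
  simp only [edgeFlux, trace, fluxValue_add, inner_add_left]
  ring

lemma edgeFlux_smul (c d r : ℝ) (e : Fin M.numEdges) (τ : FluxSpace k M) (t : ℝ) :
    edgeFlux L c d e (r • τ) t = r * edgeFlux L c d e τ t := by
  simp only [edgeFlux, trace, fluxValue_smul, inner_smul_left, RCLike.conj_to_real]
  ring

/-- `ρ` represents the functional `τ ↦ -∫_e φ (c τ⁺ ⬝ n⁺ + d τ⁻ ⬝ n⁻)`; the lifts `r_e` and `l_e`
are special cases. -/
def IsLift (L : LagrangeElement k) (c d : ℝ) (e : Fin M.numEdges) (φ : ℝ → ℝ)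
    (ρ : FluxSpace k M) : Prop :=
  ∀ τ : FluxSpace k M,
    ∑ K, ∫ x, inner ℝ (fluxValue L ρ K x) (fluxValue L τ K x) ∂(dA L M K)
      = -∫ t, φ t * edgeFlux L c d e τ t ∂(dS L M e)

lemma isLiftR_iff {e : Fin M.numEdges} {φ : ℝ → ℝ} {ρ : FluxSpace k M} :
    IsLiftR L e φ ρ ↔ IsLift L (1 / 2) (-(1 / 2)) e φ ρ := by
  simp only [IsLiftR, IsLift, navg_eq_edgeFlux]

lemma isLiftL_iff {e : Fin M.numEdges} {φ : ℝ → ℝ} {ρ : FluxSpace k M} :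
    IsLiftL L e φ ρ ↔ IsLift L 1 1 e φ ρ := by
  simp only [IsLiftL, IsLift, njump_eq_edgeFlux]

open Classical in
/-- The restriction of a discrete flux to the two elements adjacent to an edge. -/
noncomputable def restrictEdge (e : Fin M.numEdges) (τ : FluxSpace k M) :
    FluxSpace k M :=
  fun K => if M.IsEdgeOf e K then τ K else 0

lemma edgeFlux_restrictEdge (c d : ℝ) (e : Fin M.numEdges) (τ : FluxSpace k M)
    (t : ℝ) : edgeFlux L c d e (restrictEdge e τ) t = edgeFlux L c d e τ t := by
  have h : ∀ s, fluxValue L (restrictEdge e τ) (M.edgeElt e s) = fluxValue L τ (M.edgeElt e s) :=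
    fun s => fluxValue_congr (if_pos (by cases s; exacts [.inl rfl, .inr rfl]))
  simp only [edgeFlux, trace, h]

namespace IsRegularMesh

variable {a b : ℝ} (hM : IsRegularMesh L M a b)

include hM in
lemma continuousOn_edgeFlux (c d : ℝ) (e : Fin M.numEdges) (τ : FluxSpace k M) :
    ContinuousOn (edgeFlux L c d e τ) (Icc 0 1) :=
  (continuousOn_const.mul ((hM.continuousOn_trace_fluxValue τ e .plus).inner
    (hM.continuousOn_conormal e .plus))).add
  (continuousOn_const.mul ((hM.continuousOn_trace_fluxValue τ e .minus).inner
    (hM.continuousOn_conormal e .minus)))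

include hM in
lemma integrable_mul_edgeFlux (c d : ℝ) (e : Fin M.numEdges) {φ : ℝ → ℝ}
    (hφ : ContinuousOn φ (Icc 0 1)) (τ : FluxSpace k M) :
    Integrable (fun t => φ t * edgeFlux L c d e τ t) (dS L M e) :=
  hM.integrable_dS e (hφ.mul (hM.continuousOn_edgeFlux c d e τ))

include hM in
lemma exists_isLift (c d : ℝ) (e : Fin M.numEdges) {φ : ℝ → ℝ} (hφ : ContinuousOn φ (Icc 0 1)) :
    ∃ ρ, IsLift L c d e φ ρ := by
  let l : FluxSpace k M →ₗ[ℝ] ℝ :=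
    { toFun := fun τ => -∫ t, φ t * edgeFlux L c d e τ t ∂(dS L M e)
      map_add' := fun ρ τ => by
        rw [← neg_add, ← integral_add (hM.integrable_mul_edgeFlux c d e hφ ρ)
          (hM.integrable_mul_edgeFlux c d e hφ τ)]
        simp only [edgeFlux_add, mul_add]
      map_smul' := fun r τ => by
        rw [RingHom.id_apply, smul_eq_mul, mul_neg, ← integral_const_mul]
        simp only [edgeFlux_smul, mul_left_comm] }
  obtain ⟨ρ, hρ⟩ := exists_apply_eq_of_definite hM.fluxForm hM.fluxForm_definite l
  exact ⟨ρ, fun τ => by rw [← hM.fluxForm_apply, hρ]; rfl⟩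

include hM in
lemma isLift_unique {c d : ℝ} {e : Fin M.numEdges} {φ : ℝ → ℝ} {ρ ρ' : FluxSpace k M}
    (h : IsLift L c d e φ ρ) (h' : IsLift L c d e φ ρ') : ρ = ρ' := by
  refine sub_eq_zero.1 (hM.fluxForm_definite _ ?_)
  rw [map_sub, hM.fluxForm_comm _ ρ, hM.fluxForm_comm _ ρ', hM.fluxForm_apply, hM.fluxForm_apply,
    h, h', sub_self]

include hM in
lemma isLift_add {c d : ℝ} {e : Fin M.numEdges} {φ φ' : ℝ → ℝ} (hφ : ContinuousOn φ (Icc 0 1))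
    (hφ' : ContinuousOn φ' (Icc 0 1)) {ρ ρ' : FluxSpace k M}
    (h : IsLift L c d e φ ρ) (h' : IsLift L c d e φ' ρ') :
    IsLift L c d e (fun t => φ t + φ' t) (ρ + ρ') := fun τ => by
  rw [← hM.fluxForm_apply, map_add, LinearMap.add_apply, hM.fluxForm_apply, hM.fluxForm_apply, h,
    h', ← neg_add, ← integral_add (hM.integrable_mul_edgeFlux c d e hφ τ)
      (hM.integrable_mul_edgeFlux c d e hφ' τ)]
  simp only [add_mul]

include hM in
lemma isLift_smul {c d : ℝ} {e : Fin M.numEdges} {φ : ℝ → ℝ} (r : ℝ) {ρ : FluxSpace k M}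
    (h : IsLift L c d e φ ρ) : IsLift L c d e (fun t => r * φ t) (r • ρ) := fun τ => by
  rw [← hM.fluxForm_apply, map_smul, LinearMap.smul_apply, hM.fluxForm_apply, h, smul_eq_mul,
    mul_neg, ← integral_const_mul]
  simp only [mul_assoc]

open Classical in
lemma fluxForm_restrictEdge (e : Fin M.numEdges) (τ : FluxSpace k M) :
    hM.fluxForm (restrictEdge e τ) (restrictEdge e τ) =
      ∑ K, if M.IsEdgeOf e K then hM.eltForm K τ τ else 0 := by
  rw [fluxForm_eq_sum]
  refine Finset.sum_congr rfl fun K _ => ?_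
  simp only [eltForm_self]
  split_ifs with h
  · rw [fluxValue_congr (ρ := restrictEdge e τ) (τ := τ) (if_pos h)]
  · rw [fluxValue_congr (ρ := restrictEdge e τ) (τ := 0) (if_neg h)]
    simp [fluxValue, pushCovec, pushVec, ← Pi.zero_def]

/-- Each element has three edges, and the lifts on an edge only see the two adjacent elements, so
that the lifts on the different edges are almost orthogonal. -/
lemma fluxForm_sum_lift_le {c d : ℝ} {φ : Fin M.numEdges → ℝ → ℝ}
    {ρ : Fin M.numEdges → FluxSpace k M} (h : ∀ e, IsLift L c d e (φ e) (ρ e)) :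
    hM.fluxForm (∑ e, ρ e) (∑ e, ρ e) ≤ 3 * ∑ e, hM.fluxForm (ρ e) (ρ e) := by
  classical
  set R := ∑ e, ρ e with hR
  have h1 : ∀ e, hM.fluxForm (ρ e) R ≤ 3 / 2 * hM.fluxForm (ρ e) (ρ e) +
      1 / 6 * hM.fluxForm (restrictEdge e R) (restrictEdge e R) := fun e => by
    have hloc : hM.fluxForm (ρ e) R = hM.fluxForm (ρ e) (restrictEdge e R) := by
      rw [fluxForm_apply, fluxForm_apply, h e, h e]
      simp only [edgeFlux_restrictEdge]
    rw [hloc]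
    have h2 := hM.fluxForm_self_nonneg ((3 : ℝ) • ρ e - restrictEdge e R)
    simp only [map_sub, map_smul, LinearMap.sub_apply, LinearMap.smul_apply, smul_eq_mul,
      hM.fluxForm_comm (restrictEdge e R) (ρ e)] at h2
    linarith
  have h2 : ∑ e, hM.fluxForm (restrictEdge e R) (restrictEdge e R) ≤ 3 * hM.fluxForm R R := by
    simp only [fluxForm_restrictEdge]
    rw [hM.fluxForm_eq_sum]
    exact M.sum_sum_isEdgeOf_le _ fun K => hM.eltForm_self_nonneg K R
  have h3 : hM.fluxForm R R = ∑ e, hM.fluxForm (ρ e) R := by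
    rw [← LinearMap.sum_apply, ← map_sum]
  have h4 := Finset.sum_le_sum fun e (_ : e ∈ Finset.univ) => h1 e
  rw [← h3, Finset.sum_add_distrib, ← Finset.mul_sum, ← Finset.mul_sum] at h4
  linarith

/-- The stability of the lifts, from testing with the lift itself and the trace inequality. -/
lemma fluxForm_lift_le {C : ℝ} (hC0 : 0 < C) (hC : ∀ p : Pk k, ∀ x ∈ refTriangle,
      MvPolynomial.eval x (p : MvPolynomial (Fin 2) ℝ) ^ 2 ≤ C * refForm k p p)
    {c d : ℝ} (hc : |c| ≤ 1) (hd : |d| ≤ 1) {e : Fin M.numEdges} {φ : ℝ → ℝ}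
    (hφ : ContinuousOn φ (Icc 0 1)) {ρ : FluxSpace k M} (h : IsLift L c d e φ ρ) :
    hM.fluxForm ρ ρ ≤
      8 * C * b ^ 5 / a ^ 4 * ((edgeDiam L M e)⁻¹ * ∫ t, φ t ^ 2 ∂(dS L M e)) := by
  have ha := hM.lower_pos
  have hb := hM.upper_pos
  have he := hM.edgeDiam_pos e
  set T := 4 * C * b ^ 5 / a ^ 4 with hT
  have hT0 : 0 < T := by positivity
  -- With this weight in Young's inequality, the trace terms are absorbed into the left-hand side.
  set ε := edgeDiam L M e / (2 * T) with hε
  have hε0 : 0 < ε := by positivity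
  have hcont : ∀ s, ContinuousOn (fun t => ‖trace (fluxValue L ρ) e t s‖ ^ 2) (Icc 0 1) :=
    fun s => (hM.continuousOn_trace_fluxValue ρ e s).norm.pow 2
  have hi1 := (hM.integrable_dS e (f := fun t => φ t ^ 2) (hφ.pow 2)).const_mul (2 * ε)⁻¹
  have hi2 : Integrable (fun t => ε * (‖trace (fluxValue L ρ) e t .plus‖ ^ 2 +
      ‖trace (fluxValue L ρ) e t .minus‖ ^ 2)) (dS L M e) := ((hM.integrable_dS e (hcont .plus)).add
    (hM.integrable_dS e (hcont .minus))).const_mul ε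
  have h1 : -∫ t, φ t * edgeFlux L c d e ρ t ∂(dS L M e) ≤
      ∫ t, ((2 * ε)⁻¹ * φ t ^ 2 + ε * (‖trace (fluxValue L ρ) e t .plus‖ ^ 2 +
        ‖trace (fluxValue L ρ) e t .minus‖ ^ 2)) ∂(dS L M e) := by
    rw [← integral_neg]
    refine integral_mono_ae (hM.integrable_mul_edgeFlux c d e hφ ρ).neg (hi1.add hi2)
      (ae_dS fun t ht => ?_)
    refine (neg_mul_le_of_abs_le_one hε0 hc hd _).trans ?_
    have hn : ∀ s, inner ℝ (trace (fluxValue L ρ) e t s) (conormal L M e t s) ^ 2 ≤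
        ‖trace (fluxValue L ρ) e t s‖ ^ 2 := fun s => by
      have := abs_real_inner_le_norm (trace (fluxValue L ρ) e t s) (conormal L M e t s)
      rw [hM.norm_conormal e s ht, mul_one] at this
      rw [← sq_abs]
      exact pow_le_pow_left₀ (abs_nonneg _) this 2
    exact add_le_add le_rfl
      (mul_le_mul_of_nonneg_left (add_le_add (hn .plus) (hn .minus)) hε0.le)
  have h2 : ∫ t, ((2 * ε)⁻¹ * φ t ^ 2 + ε * (‖trace (fluxValue L ρ) e t .plus‖ ^ 2 +
        ‖trace (fluxValue L ρ) e t .minus‖ ^ 2)) ∂(dS L M e) =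
      (2 * ε)⁻¹ * ∫ t, φ t ^ 2 ∂(dS L M e) +
        ε * (∫ t, ‖trace (fluxValue L ρ) e t .plus‖ ^ 2 ∂(dS L M e) +
        ∫ t, ‖trace (fluxValue L ρ) e t .minus‖ ^ 2 ∂(dS L M e)) := by
    rw [integral_add hi1 hi2, integral_const_mul, integral_const_mul]
    congr 2
    exact integral_add (hM.integrable_dS e (hcont .plus)) (hM.integrable_dS e (hcont .minus))
  have h3 : ∀ s, ε * ∫ t, ‖trace (fluxValue L ρ) e t s‖ ^ 2 ∂(dS L M e) ≤
      1 / 2 * hM.eltForm (M.edgeElt e s) ρ ρ := fun s => by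
    have := hM.trace_inequality hC0 hC ρ e s
    rw [hε, div_mul_eq_mul_div, div_le_iff₀ (by positivity)]
    linarith
  have h4 : hM.eltForm (M.edgeElt e .plus) ρ ρ + hM.eltForm (M.edgeElt e .minus) ρ ρ ≤
      hM.fluxForm ρ ρ := by
    rw [fluxForm_eq_sum, ← Finset.sum_pair (f := fun K => hM.eltForm K ρ ρ) (M.edgeElt_ne e)]
    exact Finset.sum_le_sum_of_subset_of_nonneg (Finset.subset_univ _)
      fun K _ _ => hM.eltForm_self_nonneg K ρ
  have h5 : hM.fluxForm ρ ρ = -∫ t, φ t * edgeFlux L c d e ρ t ∂(dS L M e) := by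
    rw [fluxForm_apply, h]
  have h6 : (2 * ε)⁻¹ = T * (edgeDiam L M e)⁻¹ := by
    rw [hε]
    field_simp
  have h7 : 8 * C * b ^ 5 / a ^ 4 = 2 * T := by
    rw [hT]
    ring
  rw [h2, h6] at h1
  rw [h7]
  linarith [h3 .plus, h3 .minus]

end IsRegularMesh
/-! ### The bilinear forms on the discontinuous space -/

lemma value_add (u v : DGSpace k M) (K : Fin M.numElts) (x : R2) :
    value (u + v) K x = value u K x + value v K x := by
  simp [value]

lemma value_smul (c : ℝ) (u : DGSpace k M) (K : Fin M.numElts) (x : R2) :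
    value (c • u) K x = c * value u K x := by
  simp [value, MvPolynomial.smul_eval]

lemma continuous_value (u : DGSpace k M) (K : Fin M.numElts) : Continuous (value u K) :=
  continuous_eval _

lemma jumpOn_add (u v : DGSpace k M) (e : Fin M.numEdges) (t : ℝ) :
    jumpOn (u + v) e t = jumpOn u e t + jumpOn v e t := by
  simp only [jumpOn, jump, trace, value_add]
  ring

lemma jumpOn_smul (c : ℝ) (u : DGSpace k M) (e : Fin M.numEdges) (t : ℝ) :
    jumpOn (c • u) e t = c * jumpOn u e t := by
  simp only [jumpOn, jump, trace, value_smul]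
  ring

lemma continuousOn_jumpOn (u : DGSpace k M) (e : Fin M.numEdges) :
    ContinuousOn (jumpOn u e) (Icc 0 1) :=
  (((continuous_value u _).comp (continuous_edgePoint e .plus)).sub
    ((continuous_value u _).comp (continuous_edgePoint e .minus))).continuousOn

/-- The elementwise surface gradient, as an element of the space of discrete fluxes. -/
noncomputable def grad : DGSpace k M →ₗ[ℝ] FluxSpace k M where
  toFun u K m := ⟨MvPolynomial.pderiv m (u K : MvPolynomial (Fin 2) ℝ), pderiv_mem_Pk (u K).2 m⟩
  map_add' u v := by
    ext1 K; ext1 m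
    exact Subtype.ext (by simp)
  map_smul' c u := by
    ext1 K; ext1 m
    exact Subtype.ext (by simp)

lemma fluxValue_grad (u : DGSpace k M) : fluxValue L (grad u) = surfGrad L u := rfl

/-- The weighted jump `β ⬝ n⁺ [u]` of the LDG method. -/
noncomputable def weightedJump (L : LagrangeElement k) (β : Fin M.numEdges → E3) (u : DGSpace k M)
    (e : Fin M.numEdges) (t : ℝ) : ℝ :=
  inner ℝ (β e) (conormal L M e t .plus) * jumpOn u e t

namespace IsRegularMesh

variable {a b : ℝ} (hM : IsRegularMesh L M a b)

lemma integrable_value_mul_value (hM : IsRegularMesh L M a b) (u v : DGSpace k M)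
    (K : Fin M.numElts) : Integrable (fun x => value u K x * value v K x) (dA L M K) :=
  hM.integrable_dA K ((continuous_value u K).mul (continuous_value v K)).continuousOn

/-- The `L²(Γ_h^k)` inner product of scalar functions. -/
noncomputable def massForm (hM : IsRegularMesh L M a b) : DGSpace k M →ₗ[ℝ] DGSpace k M →ₗ[ℝ] ℝ :=
  LinearMap.mk₂ ℝ (fun u v => ∑ K, ∫ x, value u K x * value v K x ∂(dA L M K))
    (fun u u' v => by
      rw [← Finset.sum_add_distrib]
      refine Finset.sum_congr rfl fun K _ => ?_
      rw [← integral_add (hM.integrable_value_mul_value _ _ _)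
        (hM.integrable_value_mul_value _ _ _)]
      simp only [value_add, add_mul])
    (fun c u v => by
      rw [smul_eq_mul, Finset.mul_sum]
      refine Finset.sum_congr rfl fun K _ => ?_
      rw [← integral_const_mul]
      simp only [value_smul, mul_assoc])
    (fun u v v' => by
      rw [← Finset.sum_add_distrib]
      refine Finset.sum_congr rfl fun K _ => ?_
      rw [← integral_add (hM.integrable_value_mul_value _ _ _)
        (hM.integrable_value_mul_value _ _ _)]
      simp only [value_add, mul_add])
    (fun c u v => by
      rw [smul_eq_mul, Finset.mul_sum]
      refine Finset.sum_congr rfl fun K _ => ?_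
      rw [← integral_const_mul]
      simp only [value_smul, mul_left_comm])

lemma massForm_apply (u v : DGSpace k M) :
    hM.massForm u v = ∑ K, ∫ x, value u K x * value v K x ∂(dA L M K) := rfl

lemma massForm_self_nonneg (u : DGSpace k M) : 0 ≤ hM.massForm u u := by
  rw [massForm_apply]
  exact Finset.sum_nonneg fun _ _ => integral_nonneg fun _ => mul_self_nonneg _

lemma massForm_isSymm : (hM.massForm : LinearMap.BilinForm ℝ (DGSpace k M)).IsSymm :=
  ⟨fun u v => by simp only [massForm_apply, mul_comm, RingHom.id_apply]⟩

lemma massForm_definite (u : DGSpace k M) (hu : hM.massForm u u = 0) : u = 0 := by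
  rw [massForm_apply, Finset.sum_eq_zero_iff_of_nonneg
    fun K _ => integral_nonneg fun _ => mul_self_nonneg _] at hu
  ext1 K
  refine refForm_definite k _ (le_antisymm ?_ (refForm_nonneg k _))
  have h := hM.mul_integral_le_integral_dA K (f := fun x => value u K x * value u K x)
    ((continuous_value u K).mul (continuous_value u K)).continuousOn fun _ => mul_self_nonneg _
  rw [hu K (Finset.mem_univ K)] at h
  have ha := hM.lower_pos
  have hh := M.eltDiam_pos K
  exact nonpos_of_mul_nonpos_right h (by positivity)

lemma integrable_jumpOn_mul_jumpOn (hM : IsRegularMesh L M a b) (u v : DGSpace k M)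
    (e : Fin M.numEdges) : Integrable (fun t => jumpOn u e t * jumpOn v e t) (dS L M e) :=
  hM.integrable_dS e ((continuousOn_jumpOn u e).mul (continuousOn_jumpOn v e))

/-- The `L²` inner product of the jumps on an edge. -/
noncomputable def jumpForm (hM : IsRegularMesh L M a b) (e : Fin M.numEdges) :
    DGSpace k M →ₗ[ℝ] DGSpace k M →ₗ[ℝ] ℝ :=
  LinearMap.mk₂ ℝ (fun u v => ∫ t, jumpOn u e t * jumpOn v e t ∂(dS L M e))
    (fun u u' v => by
      rw [← integral_add (hM.integrable_jumpOn_mul_jumpOn _ _ _)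
        (hM.integrable_jumpOn_mul_jumpOn _ _ _)]
      simp only [jumpOn_add, add_mul])
    (fun c u v => by
      rw [smul_eq_mul, ← integral_const_mul]
      simp only [jumpOn_smul, mul_assoc])
    (fun u v v' => by
      rw [← integral_add (hM.integrable_jumpOn_mul_jumpOn _ _ _)
        (hM.integrable_jumpOn_mul_jumpOn _ _ _)]
      simp only [jumpOn_add, mul_add])
    (fun c u v => by
      rw [smul_eq_mul, ← integral_const_mul]
      simp only [jumpOn_smul, mul_left_comm])

lemma jumpForm_apply (e : Fin M.numEdges) (u v : DGSpace k M) :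
    hM.jumpForm e u v = ∫ t, jumpOn u e t * jumpOn v e t ∂(dS L M e) := rfl

lemma jumpForm_self_nonneg (e : Fin M.numEdges) (u : DGSpace k M) : 0 ≤ hM.jumpForm e u u :=
  integral_nonneg fun _ => mul_self_nonneg _

/-! ### Lifts of jumps -/

include hM in
lemma isLift_liftR (e : Fin M.numEdges) {φ : ℝ → ℝ} (hφ : ContinuousOn φ (Icc 0 1)) :
    IsLift L (1 / 2) (-(1 / 2)) e φ (liftR L e φ) := by
  have h : ∃ ρ : FluxSpace k M, IsLiftR L e φ ρ := by
    obtain ⟨ρ, hρ⟩ := hM.exists_isLift (1 / 2) (-(1 / 2)) e hφ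
    exact ⟨ρ, isLiftR_iff.2 hρ⟩
  rw [liftR, dif_pos h]
  exact isLiftR_iff.1 h.choose_spec

include hM in
lemma isLift_liftL (e : Fin M.numEdges) {φ : ℝ → ℝ} (hφ : ContinuousOn φ (Icc 0 1)) :
    IsLift L 1 1 e φ (liftL L e φ) := by
  have h : ∃ ρ : FluxSpace k M, IsLiftL L e φ ρ := by
    obtain ⟨ρ, hρ⟩ := hM.exists_isLift 1 1 e hφ
    exact ⟨ρ, isLiftL_iff.2 hρ⟩
  rw [liftL, dif_pos h]
  exact isLiftL_iff.1 h.choose_spec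

include hM in
lemma liftR_mul (e : Fin M.numEdges) {φ : ℝ → ℝ} (hφ : ContinuousOn φ (Icc 0 1)) (r : ℝ) :
    liftR L e (fun t => r * φ t) = r • liftR L e φ :=
  hM.isLift_unique (hM.isLift_liftR e (continuousOn_const.mul hφ))
    (hM.isLift_smul r (hM.isLift_liftR e hφ))

include hM in
lemma liftL_mul (e : Fin M.numEdges) {φ : ℝ → ℝ} (hφ : ContinuousOn φ (Icc 0 1)) (r : ℝ) :
    liftL L e (fun t => r * φ t) = r • liftL L e φ :=
  hM.isLift_unique (hM.isLift_liftL e (continuousOn_const.mul hφ))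
    (hM.isLift_smul r (hM.isLift_liftL e hφ))

/-- The lift `r_e([u])`. -/
noncomputable def jumpLiftR (hM : IsRegularMesh L M a b) (e : Fin M.numEdges) :
    DGSpace k M →ₗ[ℝ] FluxSpace k M where
  toFun u := liftR L e (jumpOn u e)
  map_add' u v := by
    refine hM.isLift_unique (hM.isLift_liftR e (continuousOn_jumpOn _ e)) ?_
    have h := hM.isLift_add (continuousOn_jumpOn u e) (continuousOn_jumpOn v e)
      (hM.isLift_liftR e (continuousOn_jumpOn u e)) (hM.isLift_liftR e (continuousOn_jumpOn v e))
    simpa only [← jumpOn_add] using h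
  map_smul' c u := by
    rw [funext (jumpOn_smul c u e), hM.liftR_mul e (continuousOn_jumpOn u e) c]
    rfl

include hM in
lemma continuousOn_weightedJump (β : Fin M.numEdges → E3) (u : DGSpace k M)
    (e : Fin M.numEdges) : ContinuousOn (weightedJump L β u e) (Icc 0 1) :=
  (continuousOn_const.inner (hM.continuousOn_conormal e .plus)).mul (continuousOn_jumpOn u e)

/-- The lift `l_e(β ⬝ n⁺ [u])`. -/
noncomputable def jumpLiftL (hM : IsRegularMesh L M a b) (β : Fin M.numEdges → E3)
    (e : Fin M.numEdges) : DGSpace k M →ₗ[ℝ] FluxSpace k M where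
  toFun u := liftL L e (weightedJump L β u e)
  map_add' u v := by
    refine hM.isLift_unique (hM.isLift_liftL e (hM.continuousOn_weightedJump β _ e)) ?_
    have h := hM.isLift_add (hM.continuousOn_weightedJump β u e)
      (hM.continuousOn_weightedJump β v e)
      (hM.isLift_liftL e (hM.continuousOn_weightedJump β u e))
      (hM.isLift_liftL e (hM.continuousOn_weightedJump β v e))
    have h' : weightedJump L β (u + v) e =
        fun t => weightedJump L β u e t + weightedJump L β v e t := by
      ext t
      simp only [weightedJump, jumpOn_add, mul_add]
    rwa [h']
  map_smul' c u := by
    have h : weightedJump L β (c • u) e = fun t => c * weightedJump L β u e t := by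
      ext t
      simp only [weightedJump, jumpOn_smul]
      ring
    rw [h, hM.liftL_mul e (hM.continuousOn_weightedJump β u e) c]
    rfl

lemma integral_jumpOn_mul_navg (e : Fin M.numEdges) (u : DGSpace k M) (τ : FluxSpace k M) :
    ∫ t, jumpOn u e t * navg (trace (fluxValue L τ) e t) (conormal L M e t) ∂(dS L M e) =
      -hM.fluxForm (hM.jumpLiftR e u) τ := by
  have h := hM.isLift_liftR e (continuousOn_jumpOn u e) τ
  rw [← hM.fluxForm_apply] at h
  simp only [navg_eq_edgeFlux]
  exact (neg_eq_iff_eq_neg.2 h).symm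

lemma integral_weightedJump_mul_njump (β : Fin M.numEdges → E3) (e : Fin M.numEdges)
    (u : DGSpace k M) (τ : FluxSpace k M) :
    ∫ t, weightedJump L β u e t * njump (trace (fluxValue L τ) e t) (conormal L M e t) ∂(dS L M e) =
      -hM.fluxForm (hM.jumpLiftL β e u) τ := by
  have h := hM.isLift_liftL e (hM.continuousOn_weightedJump β u e) τ
  rw [← hM.fluxForm_apply] at h
  simp only [njump_eq_edgeFlux]
  exact (neg_eq_iff_eq_neg.2 h).symm

include hM in
lemma integrable_mul_navg (e : Fin M.numEdges) {φ : ℝ → ℝ} (hφ : ContinuousOn φ (Icc 0 1))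
    (τ : FluxSpace k M) : Integrable (fun t => φ t *
      navg (trace (fluxValue L τ) e t) (conormal L M e t)) (dS L M e) := by
  simp only [navg_eq_edgeFlux]
  exact hM.integrable_mul_edgeFlux _ _ e hφ τ

include hM in
lemma integrable_mul_njump (e : Fin M.numEdges) {φ : ℝ → ℝ} (hφ : ContinuousOn φ (Icc 0 1))
    (τ : FluxSpace k M) : Integrable (fun t => φ t *
      njump (trace (fluxValue L τ) e t) (conormal L M e t)) (dS L M e) := by
  simp only [njump_eq_edgeFlux]
  exact hM.integrable_mul_edgeFlux _ _ e hφ τ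

end IsRegularMesh
/-! ### The methods in terms of lifts -/

lemma fluxValue_sub (ρ τ : FluxSpace k M) (K : Fin M.numElts) (x : R2) :
    fluxValue L (ρ - τ) K x = fluxValue L ρ K x - fluxValue L τ K x := by
  rw [sub_eq_add_neg, ← neg_one_smul ℝ τ, fluxValue_add, fluxValue_smul, neg_one_smul,
    ← sub_eq_add_neg]

/-- The factor of `(R u, ∇v)` in the bilinear form, where `R` is the lift of the jumps. -/
def DGMethod.symmCoeff : DGMethod → ℝ
  | .NIPG => -1
  | .IIPG => 0
  | _ => 1

/-- The factor of `(R u, R v)` in the bilinear form, where `R` is the lift of the jumps. -/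
def DGMethod.liftCoeff : DGMethod → ℝ
  | .Brezzi | .LDG => 1
  | _ => 0

lemma jump_uDefect (m : DGMethod) (β : Fin M.numEdges → E3) (u : DGSpace k M)
    (e : Fin M.numEdges) (t : ℝ) :
    jump (uDefect L m β u e t) = -m.symmCoeff * jumpOn u e t := by
  cases m <;> simp only [jump, uDefect, uHat, avg, jumpOn, DGMethod.symmCoeff] <;> ring

lemma avg_uDefect_LDG (β : Fin M.numEdges → E3) (u : DGSpace k M) (e : Fin M.numEdges) (t : ℝ) :
    avg (uDefect L .LDG β u e t) = -1 * weightedJump L β u e t := by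
  simp only [jump, uDefect, uHat, avg, jumpOn, weightedJump]
  ring

lemma avg_uDefect {m : DGMethod} (hm : m ≠ .LDG) (β : Fin M.numEdges → E3) (u : DGSpace k M)
    (e : Fin M.numEdges) (t : ℝ) : avg (uDefect L m β u e t) = 0 := by
  cases m <;> first | exact absurd rfl hm | (simp only [jump, uDefect, uHat, avg]; ring)

namespace IsRegularMesh

variable {a b : ℝ} (hM : IsRegularMesh L M a b)

/-- The lift of the jump on one edge that enters a method: `r_e([u])`, and for LDG
`r_e([u]) + l_e(β ⬝ n⁺ [u])`. -/
noncomputable def edgeLift (hM : IsRegularMesh L M a b) (m : DGMethod) (β : Fin M.numEdges → E3)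
    (e : Fin M.numEdges) : DGSpace k M →ₗ[ℝ] FluxSpace k M :=
  match m with
  | .LDG => hM.jumpLiftR e + hM.jumpLiftL β e
  | _ => hM.jumpLiftR e

/-- The global lift of the jumps that enters a method. -/
noncomputable def lift (hM : IsRegularMesh L M a b) (m : DGMethod) (β : Fin M.numEdges → E3) :
    DGSpace k M →ₗ[ℝ] FluxSpace k M :=
  ∑ e, hM.edgeLift m β e

/-- The contribution of an edge to the stabilization. -/
noncomputable def edgeStab (hM : IsRegularMesh L M a b) (m : DGMethod) (α : ℝ)
    (e : Fin M.numEdges) : DGSpace k M →ₗ[ℝ] DGSpace k M →ₗ[ℝ] ℝ :=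
  match m with
  | .IP | .NIPG | .IIPG | .LDG => penalty L α e • hM.jumpForm e
  | .Brezzi | .Bassi => α • hM.fluxForm.compl₁₂ (hM.jumpLiftR e) (hM.jumpLiftR e)

lemma stab_eq_sum (m : DGMethod) (α : ℝ) (u v : DGSpace k M) :
    stab L m α u v = ∑ e, hM.edgeStab m α e u v := by
  cases m <;> simp only [stab, edgeStab, LinearMap.smul_apply, smul_eq_mul, jumpForm_apply,
    LinearMap.compl₁₂_apply, fluxForm_apply] <;> rfl

lemma liftRh_jump_uDefect (m : DGMethod) (β : Fin M.numEdges → E3) (u : DGSpace k M) :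
    liftRh L (fun e t => jump (uDefect L m β u e t)) =
      -m.symmCoeff • ∑ e, hM.jumpLiftR e u := by
  simp only [liftRh, jump_uDefect, Finset.smul_sum]
  exact Finset.sum_congr rfl fun e _ => hM.liftR_mul e (continuousOn_jumpOn u e) _

include hM in
lemma liftLh_zero : liftLh L (fun (_ : Fin M.numEdges) _ => (0 : ℝ)) = 0 := by
  refine Finset.sum_eq_zero fun e _ => ?_
  have h := hM.liftL_mul e (φ := fun _ => 0) continuousOn_const 0
  simpa using h

lemma sigmaH_Brezzi (β : Fin M.numEdges → E3) (u : DGSpace k M) :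
    sigmaH L .Brezzi β u = fluxValue L (grad u + hM.lift .Brezzi β u) := by
  ext1 K; ext1 x
  rw [sigmaH, hM.liftRh_jump_uDefect, ← fluxValue_grad, ← fluxValue_sub, ← fluxValue_sub]
  simp only [avg_uDefect (m := .Brezzi) (by simp)]
  rw [hM.liftLh_zero]
  congr 1
  simp only [lift, edgeLift, DGMethod.symmCoeff, LinearMap.sum_apply]
  module

lemma sigmaH_LDG (β : Fin M.numEdges → E3) (u : DGSpace k M) :
    sigmaH L .LDG β u = fluxValue L (grad u + hM.lift .LDG β u) := by
  ext1 K; ext1 x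
  have h : liftLh L (fun e t => avg (uDefect L .LDG β u e t)) =
      (-1 : ℝ) • ∑ e, hM.jumpLiftL β e u := by
    simp only [liftLh, avg_uDefect_LDG]
    rw [Finset.smul_sum]
    exact Finset.sum_congr rfl fun e _ =>
      hM.liftL_mul e (hM.continuousOn_weightedJump β u e) _
  rw [sigmaH, hM.liftRh_jump_uDefect, h, ← fluxValue_grad, ← fluxValue_sub, ← fluxValue_sub]
  congr 1
  simp only [lift, edgeLift, DGMethod.symmCoeff, LinearMap.sum_apply, LinearMap.add_apply,
    Finset.sum_add_distrib]
  module

/-- The edge integral of a numerical flux against a jump, in terms of lifts. -/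
lemma integral_mul_jumpOn (β : Fin M.numEdges → E3) (e : Fin M.numEdges) (u v : DGSpace k M)
    (τ : FluxSpace k M) (p q : ℝ) {X : ℝ → ℝ} (hX : ∀ t, X t =
      navg (trace (fluxValue L τ) e t) (conormal L M e t) - p * jumpOn u e t + q *
        (inner ℝ (β e) (conormal L M e t .plus) *
          njump (trace (fluxValue L τ) e t) (conormal L M e t))) :
    Integrable (fun t => X t * jumpOn v e t) (dS L M e) ∧
    ∫ t, X t * jumpOn v e t ∂(dS L M e) = -hM.fluxForm (hM.jumpLiftR e v) τ
      - p * hM.jumpForm e u v - q * hM.fluxForm (hM.jumpLiftL β e v) τ := by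
  have h : (fun t => X t * jumpOn v e t) = fun t =>
      (jumpOn v e t * navg (trace (fluxValue L τ) e t) (conormal L M e t)
        - p * (jumpOn u e t * jumpOn v e t)) + q * (weightedJump L β v e t *
          njump (trace (fluxValue L τ) e t) (conormal L M e t)) := by
    ext t
    rw [hX, weightedJump]
    ring
  have h1 := hM.integrable_mul_navg e (continuousOn_jumpOn v e) τ
  have h2 := (hM.integrable_jumpOn_mul_jumpOn u v e).const_mul p
  have h3 := (hM.integrable_mul_njump e (hM.continuousOn_weightedJump β v e) τ).const_mul q
  have h12 : Integrable (fun t => jumpOn v e t *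
      navg (trace (fluxValue L τ) e t) (conormal L M e t) - p * (jumpOn u e t * jumpOn v e t))
      (dS L M e) := h1.sub h2
  rw [h]
  refine ⟨h12.add h3, ?_⟩
  rw [integral_add h12 h3, integral_sub h1 h2, integral_const_mul, integral_const_mul,
    hM.integral_jumpOn_mul_navg, hM.integral_weightedJump_mul_njump, ← hM.jumpForm_apply]
  ring

lemma integral_normalFlux_mul_jumpOn (m : DGMethod) (α : ℝ) (β : Fin M.numEdges → E3)
    (e : Fin M.numEdges) (u v : DGSpace k M) :
    Integrable (fun t => normalFlux L m α β u e t * jumpOn v e t) (dS L M e) ∧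
    ∫ t, normalFlux L m α β u e t * jumpOn v e t ∂(dS L M e) =
      -hM.fluxForm (hM.edgeLift m β e v) (grad u + m.liftCoeff • hM.lift m β u)
        - hM.edgeStab m α e u v := by
  have hIP : ∀ m : DGMethod, m = .IP ∨ m = .NIPG ∨ m = .IIPG →
      Integrable (fun t => normalFlux L m α β u e t * jumpOn v e t) (dS L M e) ∧
      ∫ t, normalFlux L m α β u e t * jumpOn v e t ∂(dS L M e) =
        -hM.fluxForm (hM.edgeLift m β e v) (grad u + m.liftCoeff • hM.lift m β u)
          - hM.edgeStab m α e u v := by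
    intro m hm
    have h := hM.integral_mul_jumpOn β e u v (grad u) (penalty L α e) 0
      (X := normalFlux L m α β u e) fun t => by
        rw [fluxValue_grad]
        rcases hm with rfl | rfl | rfl <;> simp [normalFlux]
    refine ⟨h.1, h.2.trans ?_⟩
    rcases hm with rfl | rfl | rfl <;> simp [edgeLift, edgeStab, DGMethod.liftCoeff]
  have htr : ∀ (ρ τ : FluxSpace k M) t, trace (fun K x => fluxValue L ρ K x + α •
      fluxValue L τ K x) e t = trace (fluxValue L (ρ + α • τ)) e t := fun ρ τ t => by
    ext1 s
    simp only [trace, fluxValue_add, fluxValue_smul]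
  cases m with
  | IP => exact hIP _ (by simp)
  | NIPG => exact hIP _ (by simp)
  | IIPG => exact hIP _ (by simp)
  | LDG =>
    have h := hM.integral_mul_jumpOn β e u v (grad u + hM.lift .LDG β u) (penalty L α e) 1
      (X := normalFlux L .LDG α β u e) fun t => by
        simp only [normalFlux, hM.sigmaH_LDG, one_mul]
    refine ⟨h.1, h.2.trans ?_⟩
    simp [edgeLift, edgeStab, DGMethod.liftCoeff]
    ring
  | Brezzi =>
    have h := hM.integral_mul_jumpOn β e u v
      (grad u + hM.lift .Brezzi β u + α • hM.jumpLiftR e u) 0 0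
      (X := normalFlux L .Brezzi α β u e) fun t => by
        simp only [normalFlux, hM.sigmaH_Brezzi, zero_mul, sub_zero, add_zero]
        rw [← htr]
        rfl
    refine ⟨h.1, h.2.trans ?_⟩
    simp [edgeLift, edgeStab, DGMethod.liftCoeff, hM.fluxForm_comm (hM.jumpLiftR e u)]
    ring
  | Bassi =>
    have h := hM.integral_mul_jumpOn β e u v (grad u + α • hM.jumpLiftR e u) 0 0
      (X := normalFlux L .Bassi α β u e) fun t => by
        simp only [normalFlux, zero_mul, sub_zero, add_zero]
        rw [← htr]
        rfl
    refine ⟨h.1, h.2.trans ?_⟩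
    simp [edgeLift, edgeStab, DGMethod.liftCoeff, hM.fluxForm_comm (hM.jumpLiftR e u)]
    ring

include hM in
/-- The numerical flux `σ̂` has the normal component `X` on both sides of an edge, as the conormals
are unit vectors. -/
lemma navg_njump_sigmaHat (m : DGMethod) (α : ℝ) (β : Fin M.numEdges → E3) (u : DGSpace k M)
    (e : Fin M.numEdges) {t : ℝ} (ht : t ∈ Icc (0 : ℝ) 1) :
    navg (sigmaHat L m α β u e t) (conormal L M e t) = normalFlux L m α β u e t ∧
    njump (sigmaHat L m α β u e t) (conormal L M e t) = 0 := by
  have h : ∀ s, inner ℝ (conormal L M e t s) (conormal L M e t s) = (1 : ℝ) := fun s => by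
    rw [real_inner_self_eq_norm_sq, hM.norm_conormal e s ht, one_pow]
  constructor
  · simp only [navg, sigmaHat, inner_neg_left, inner_smul_left, h, RCLike.conj_to_real]
    ring
  · simp only [njump, sigmaHat, inner_neg_left, inner_smul_left, h, RCLike.conj_to_real]
    ring

lemma integral_edge_terms (m : DGMethod) (α : ℝ) (β : Fin M.numEdges → E3) (e : Fin M.numEdges)
    (u v : DGSpace k M) :
    (∫ t, jump (uDefect L m β u e t) * navg (trace (surfGrad L v) e t) (conormal L M e t)
      - navg (sigmaHat L m α β u e t) (conormal L M e t) * jumpOn v e t ∂(dS L M e))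
    + (∫ t, avg (uDefect L m β u e t) * njump (trace (surfGrad L v) e t) (conormal L M e t)
      - njump (sigmaHat L m α β u e t) (conormal L M e t) * avg (trace (value v) e t) ∂(dS L M e))
    = m.symmCoeff * hM.fluxForm (hM.edgeLift m β e u) (grad v) +
      hM.fluxForm (hM.edgeLift m β e v) (grad u + m.liftCoeff • hM.lift m β u) +
        hM.edgeStab m α e u v := by
  obtain ⟨hXi, hX⟩ := hM.integral_normalFlux_mul_jumpOn m α β e u v
  have h1 : ∫ t, jump (uDefect L m β u e t) * navg (trace (surfGrad L v) e t) (conormal L M e t)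
      - navg (sigmaHat L m α β u e t) (conormal L M e t) * jumpOn v e t ∂(dS L M e) =
      m.symmCoeff * hM.fluxForm (hM.jumpLiftR e u) (grad v) +
      hM.fluxForm (hM.edgeLift m β e v) (grad u + m.liftCoeff • hM.lift m β u) +
        hM.edgeStab m α e u v := by
    rw [integral_congr_ae (g := fun t => -m.symmCoeff * (jumpOn u e t *
      navg (trace (fluxValue L (grad v)) e t) (conormal L M e t))
      - normalFlux L m α β u e t * jumpOn v e t) (ae_dS fun t ht => by
        rw [jump_uDefect, (hM.navg_njump_sigmaHat m α β u e ht).1, mul_assoc, fluxValue_grad])]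
    rw [integral_sub ((hM.integrable_mul_navg e (continuousOn_jumpOn u e) _).const_mul _) hXi,
      integral_const_mul, hM.integral_jumpOn_mul_navg, hX]
    ring
  have h2 : ∫ t, avg (uDefect L m β u e t) * njump (trace (surfGrad L v) e t) (conormal L M e t)
      - njump (sigmaHat L m α β u e t) (conormal L M e t) * avg (trace (value v) e t) ∂(dS L M e) =
      ∫ t, avg (uDefect L m β u e t) *
        njump (trace (fluxValue L (grad v)) e t) (conormal L M e t) ∂(dS L M e) :=
    integral_congr_ae (ae_dS fun t ht => by
      simp only [(hM.navg_njump_sigmaHat m α β u e ht).2, zero_mul, sub_zero, fluxValue_grad])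
  rw [h1, h2]
  by_cases hm : m = .LDG
  · subst hm
    simp only [avg_uDefect_LDG, mul_assoc]
    rw [integral_const_mul, hM.integral_weightedJump_mul_njump]
    simp [edgeLift, DGMethod.symmCoeff]
    ring
  · simp only [avg_uDefect hm, zero_mul, integral_zero, add_zero]
    cases m <;> first | exact absurd rfl hm | rfl

/-- The bilinear form of a method, as a sum of forms composed with the gradient and the lift. -/
noncomputable def methodForm (hM : IsRegularMesh L M a b) (m : DGMethod) (α : ℝ)
    (β : Fin M.numEdges → E3) : DGSpace k M →ₗ[ℝ] DGSpace k M →ₗ[ℝ] ℝ :=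
  hM.massForm + hM.fluxForm.compl₁₂ grad grad
    + m.symmCoeff • hM.fluxForm.compl₁₂ (hM.lift m β) grad
    + hM.fluxForm.compl₁₂ grad (hM.lift m β)
    + m.liftCoeff • hM.fluxForm.compl₁₂ (hM.lift m β) (hM.lift m β) + ∑ e, hM.edgeStab m α e

lemma methodForm_apply (m : DGMethod) (α : ℝ) (β : Fin M.numEdges → E3) (u v : DGSpace k M) :
    hM.methodForm m α β u v = hM.massForm u v + hM.fluxForm (grad u) (grad v)
      + m.symmCoeff * hM.fluxForm (hM.lift m β u) (grad v)
      + hM.fluxForm (grad u) (hM.lift m β v)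
      + m.liftCoeff * hM.fluxForm (hM.lift m β u) (hM.lift m β v) + stab L m α u v := by
  simp [methodForm, hM.stab_eq_sum]

lemma dgForm_eq_methodForm (m : DGMethod) (α : ℝ) (β : Fin M.numEdges → E3)
    (u v : DGSpace k M) : dgForm L m α β u v = hM.methodForm m α β u v := by
  have hvol : ∑ K, ∫ x, inner ℝ (surfGrad L u K x) (surfGrad L v K x)
      + value u K x * value v K x ∂(dA L M K) =
      hM.massForm u v + hM.fluxForm (grad u) (grad v) := by
    rw [massForm_apply, fluxForm_apply, ← Finset.sum_add_distrib]
    refine Finset.sum_congr rfl fun K _ => ?_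
    rw [add_comm, ← integral_add (hM.integrable_inner_fluxValue (grad u) (grad v) K)
      (hM.integrable_value_mul_value u v K)]
    rfl
  have hsum : ∀ w, hM.lift m β w = ∑ e, hM.edgeLift m β e w := fun w => by
    simp [lift, LinearMap.sum_apply]
  rw [dgForm, hvol, add_assoc, ← Finset.sum_add_distrib,
    Finset.sum_congr rfl fun e _ => hM.integral_edge_terms m α β e u v, Finset.sum_add_distrib,
    Finset.sum_add_distrib, ← Finset.mul_sum, ← hM.stab_eq_sum, methodForm_apply]
  have h1 : ∑ e, hM.fluxForm (hM.edgeLift m β e u) (grad v) =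
      hM.fluxForm (hM.lift m β u) (grad v) := by
    rw [hsum, map_sum, LinearMap.sum_apply]
  have h2 : ∑ e, hM.fluxForm (hM.edgeLift m β e v) (grad u + m.liftCoeff • hM.lift m β u) =
      hM.fluxForm (grad u) (hM.lift m β v)
      + m.liftCoeff * hM.fluxForm (hM.lift m β u) (hM.lift m β v) := by
    rw [← LinearMap.sum_apply, ← map_sum, ← hsum, map_add, map_smul, hM.fluxForm_comm _ (grad u),
      hM.fluxForm_comm _ (hM.lift m β u), smul_eq_mul]
  rw [h1, h2]
  ring

end IsRegularMesh
/-! ### Continuity, coercivity and well-posedness -/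

lemma abs_le_mul_of_sq_le {x p q D n n' : ℝ} (h : x ^ 2 ≤ p * q) (hq : 0 ≤ q) (hD : 0 ≤ D)
    (hn : 0 ≤ n) (hn' : 0 ≤ n') (hpn : p ≤ D * n ^ 2) (hqn : q ≤ D * n' ^ 2) :
    |x| ≤ D * n * n' := by
  refine abs_le_of_sq_le_sq (h.trans ?_) (by positivity)
  calc p * q ≤ (D * n ^ 2) * (D * n' ^ 2) := mul_le_mul hpn hqn hq (by positivity)
    _ = _ := by ring

lemma penalty_nonneg {α : ℝ} (hα : 0 ≤ α) (e : Fin M.numEdges) : 0 ≤ penalty L α e := by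
  have : 0 ≤ edgeDiam L M e := Metric.diam_nonneg
  unfold penalty
  positivity

namespace IsRegularMesh

variable {a b : ℝ} (hM : IsRegularMesh L M a b)

lemma edgeStab_self_nonneg (m : DGMethod) {α : ℝ} (hα : 0 ≤ α) (e : Fin M.numEdges)
    (u : DGSpace k M) : 0 ≤ hM.edgeStab m α e u u := by
  have h1 := mul_nonneg (penalty_nonneg (L := L) hα e) (hM.jumpForm_self_nonneg e u)
  have h2 := mul_nonneg hα (hM.fluxForm_self_nonneg (hM.jumpLiftR e u))
  cases m <;> assumption

lemma edgeStab_comm (m : DGMethod) (α : ℝ) (e : Fin M.numEdges) (u v : DGSpace k M) :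
    hM.edgeStab m α e u v = hM.edgeStab m α e v u := by
  have h1 : hM.jumpForm e u v = hM.jumpForm e v u := by simp only [jumpForm_apply, mul_comm]
  have h2 := hM.fluxForm_comm (hM.jumpLiftR e u) (hM.jumpLiftR e v)
  cases m <;> simp only [edgeStab, LinearMap.smul_apply, LinearMap.compl₁₂_apply, h1, h2]

include hM in
lemma stab_self_nonneg (m : DGMethod) {α : ℝ} (hα : 0 ≤ α) (u : DGSpace k M) :
    0 ≤ stab L m α u u := by
  rw [hM.stab_eq_sum]
  exact Finset.sum_nonneg fun e _ => hM.edgeStab_self_nonneg m hα e u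

include hM in
lemma stab_sq_le (m : DGMethod) {α : ℝ} (hα : 0 ≤ α) (u v : DGSpace k M) :
    stab L m α u v ^ 2 ≤ stab L m α u u * stab L m α v v := by
  have heq : ∀ u v, stab L m α u v = (∑ e, hM.edgeStab m α e) u v := fun u v => by
    simp [hM.stab_eq_sum]
  have h := LinearMap.BilinForm.apply_sq_le_of_symm (∑ e, hM.edgeStab m α e)
    (fun u => by rw [← heq]; exact hM.stab_self_nonneg m hα u)
    ⟨fun u v => by
      rw [← heq, ← heq, hM.stab_eq_sum, hM.stab_eq_sum, RingHom.id_apply]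
      exact Finset.sum_congr rfl fun e _ => hM.edgeStab_comm m α e u v⟩ u v
  simpa only [heq] using h

lemma dgNorm_sq (m : DGMethod) {α : ℝ} (hα : 0 ≤ α) (u : DGSpace k M) :
    dgNorm L m α u ^ 2 =
      hM.massForm u u + hM.fluxForm (grad u) (grad u) + stab L m α u u := by
  have h : ∑ K, ∫ x, value u K x ^ 2 + ‖surfGrad L u K x‖ ^ 2 ∂(dA L M K) =
      hM.massForm u u + hM.fluxForm (grad u) (grad u) := by
    rw [massForm_apply, fluxForm_apply, ← Finset.sum_add_distrib]
    refine Finset.sum_congr rfl fun K _ => ?_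
    rw [← integral_add (hM.integrable_value_mul_value u u K)
      (hM.integrable_inner_fluxValue (grad u) (grad u) K)]
    simp only [sq, fluxValue_grad, real_inner_self_eq_norm_mul_norm]
  rw [dgNorm, h, Real.sq_sqrt]
  linarith [hM.massForm_self_nonneg u, hM.fluxForm_self_nonneg (grad u),
    hM.stab_self_nonneg m hα u]

lemma mul_edgeDiam_inv_jumpForm_le (hk : 1 ≤ k) {α : ℝ} (hα : 0 ≤ α) (e : Fin M.numEdges)
    (u : DGSpace k M) :
    α * ((edgeDiam L M e)⁻¹ * hM.jumpForm e u u) ≤ penalty L α e * hM.jumpForm e u u := by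
  have he := hM.edgeDiam_pos e
  have hJ := hM.jumpForm_self_nonneg e u
  have hk' : (1 : ℝ) ≤ (k : ℝ) ^ 2 := one_le_pow₀ (by exact_mod_cast hk)
  have h : 0 ≤ α * ((edgeDiam L M e)⁻¹ * hM.jumpForm e u u) := by positivity
  unfold penalty
  nlinarith [mul_le_mul_of_nonneg_right hk' h]

/-- The lifts of the jumps are bounded by the jumps, weighted by the penalty parameter. -/
lemma mul_fluxForm_sum_jumpLiftR_le (hk : 1 ≤ k) {C : ℝ} (hC0 : 0 < C)
    (hC : ∀ p : Pk k, ∀ x ∈ refTriangle,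
      MvPolynomial.eval x (p : MvPolynomial (Fin 2) ℝ) ^ 2 ≤ C * refForm k p p)
    {α : ℝ} (hα : 0 ≤ α) (u : DGSpace k M) :
    α * hM.fluxForm (∑ e, hM.jumpLiftR e u) (∑ e, hM.jumpLiftR e u) ≤
      3 * (8 * C * b ^ 5 / a ^ 4) * ∑ e, penalty L α e * hM.jumpForm e u u := by
  have ha := hM.lower_pos
  have hb := hM.upper_pos
  have h1 := hM.fluxForm_sum_lift_le fun e => hM.isLift_liftR e (continuousOn_jumpOn u e)
  have h2 : ∀ e, hM.fluxForm (hM.jumpLiftR e u) (hM.jumpLiftR e u) ≤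
      8 * C * b ^ 5 / a ^ 4 * ((edgeDiam L M e)⁻¹ * hM.jumpForm e u u) := fun e => by
    have h := hM.fluxForm_lift_le hC0 hC (by norm_num [abs_of_pos]) (by norm_num [abs_of_pos])
      (continuousOn_jumpOn u e) (hM.isLift_liftR e (continuousOn_jumpOn u e))
    simp only [sq (jumpOn _ _ _)] at h
    exact h
  calc _ ≤ α * (3 * ∑ e, hM.fluxForm (hM.jumpLiftR e u) (hM.jumpLiftR e u)) := by
        gcongr; exact h1
    _ = 3 * ∑ e, α * hM.fluxForm (hM.jumpLiftR e u) (hM.jumpLiftR e u) := by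
        rw [← Finset.mul_sum]; ring
    _ ≤ 3 * ∑ e, 8 * C * b ^ 5 / a ^ 4 * (penalty L α e * hM.jumpForm e u u) := by
        refine mul_le_mul_of_nonneg_left (Finset.sum_le_sum fun e _ => ?_) (by norm_num)
        have h3 := mul_le_mul_of_nonneg_left (hM.mul_edgeDiam_inv_jumpForm_le hk hα e u)
          (show 0 ≤ 8 * C * b ^ 5 / a ^ 4 by positivity)
        nlinarith [mul_le_mul_of_nonneg_left (h2 e) hα]
    _ = _ := by rw [← Finset.mul_sum]; ring

lemma mul_fluxForm_sum_jumpLiftL_le (hk : 1 ≤ k) {C : ℝ} (hC0 : 0 < C)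
    (hC : ∀ p : Pk k, ∀ x ∈ refTriangle,
      MvPolynomial.eval x (p : MvPolynomial (Fin 2) ℝ) ^ 2 ≤ C * refForm k p p)
    {α B : ℝ} (hα : 0 ≤ α) {β : Fin M.numEdges → E3} (hβ : ∀ e, ‖β e‖ ≤ B) (u : DGSpace k M) :
    α * hM.fluxForm (∑ e, hM.jumpLiftL β e u) (∑ e, hM.jumpLiftL β e u) ≤
      3 * (8 * C * b ^ 5 / a ^ 4) * B ^ 2 * ∑ e, penalty L α e * hM.jumpForm e u u := by
  have ha := hM.lower_pos
  have hb := hM.upper_pos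
  have h1 := hM.fluxForm_sum_lift_le fun e =>
    hM.isLift_liftL e (hM.continuousOn_weightedJump β u e)
  have hw : ∀ e, ∫ t, weightedJump L β u e t ^ 2 ∂(dS L M e) ≤ B ^ 2 * hM.jumpForm e u u :=
    fun e => by
    rw [jumpForm_apply, ← integral_const_mul]
    refine integral_mono_ae (hM.integrable_dS e ((hM.continuousOn_weightedJump β u e).pow 2))
      ((hM.integrable_jumpOn_mul_jumpOn u u e).const_mul _) (ae_dS fun t ht => ?_)
    have h := abs_real_inner_le_norm (β e) (conormal L M e t .plus)
    rw [hM.norm_conormal e _ ht, mul_one] at h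
    have h' := pow_le_pow_left₀ (abs_nonneg _) (h.trans (hβ e)) 2
    rw [sq_abs] at h'
    simp only [weightedJump, mul_pow, ← sq]
    gcongr
  have h2 : ∀ e, hM.fluxForm (hM.jumpLiftL β e u) (hM.jumpLiftL β e u) ≤
      8 * C * b ^ 5 / a ^ 4 * (B ^ 2 * ((edgeDiam L M e)⁻¹ * hM.jumpForm e u u)) := fun e => by
    have h := hM.fluxForm_lift_le hC0 hC (by simp) (by simp)
      (hM.continuousOn_weightedJump β u e)
      (hM.isLift_liftL e (hM.continuousOn_weightedJump β u e))
    refine h.trans ?_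
    rw [mul_left_comm (B ^ 2)]
    have := hM.edgeDiam_pos e
    gcongr
    exact hw e
  calc _ ≤ α * (3 * ∑ e, hM.fluxForm (hM.jumpLiftL β e u) (hM.jumpLiftL β e u)) := by
        gcongr; exact h1
    _ = 3 * ∑ e, α * hM.fluxForm (hM.jumpLiftL β e u) (hM.jumpLiftL β e u) := by
        rw [← Finset.mul_sum]; ring
    _ ≤ 3 * ∑ e, 8 * C * b ^ 5 / a ^ 4 * B ^ 2 * (penalty L α e * hM.jumpForm e u u) := by
        refine mul_le_mul_of_nonneg_left (Finset.sum_le_sum fun e _ => ?_) (by norm_num)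
        have h3 := mul_le_mul_of_nonneg_left (hM.mul_edgeDiam_inv_jumpForm_le hk hα e u)
          (show 0 ≤ 8 * C * b ^ 5 / a ^ 4 * B ^ 2 by positivity)
        nlinarith [mul_le_mul_of_nonneg_left (h2 e) hα]
    _ = _ := by rw [← Finset.mul_sum]; ring

lemma mul_fluxForm_lift_le_of_ne (hk : 1 ≤ k) {C : ℝ} (hC0 : 0 < C)
    (hC : ∀ p : Pk k, ∀ x ∈ refTriangle,
      MvPolynomial.eval x (p : MvPolynomial (Fin 2) ℝ) ^ 2 ≤ C * refForm k p p)
    {m : DGMethod} (hm : m ≠ .LDG) {α : ℝ} (hα : 0 ≤ α) (β : Fin M.numEdges → E3)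
    (u : DGSpace k M) :
    α * hM.fluxForm (hM.lift m β u) (hM.lift m β u) ≤
      (3 + 3 * (8 * C * b ^ 5 / a ^ 4)) * stab L m α u u := by
  have ha := hM.lower_pos
  have hb := hM.upper_pos
  have hstab := hM.stab_self_nonneg m hα u
  have hlift : hM.lift m β u = ∑ e, hM.jumpLiftR e u := by
    rw [lift, LinearMap.sum_apply]
    cases m <;> first | rfl | exact absurd rfl hm
  have hD : 0 ≤ 3 * (8 * C * b ^ 5 / a ^ 4) * stab L m α u u := by positivity
  rw [hlift]
  have hpen : stab L m α u u = ∑ e, penalty L α e * hM.jumpForm e u u →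
      α * hM.fluxForm (∑ e, hM.jumpLiftR e u) (∑ e, hM.jumpLiftR e u) ≤
      (3 + 3 * (8 * C * b ^ 5 / a ^ 4)) * stab L m α u u := fun h => by
    have h1 := hM.mul_fluxForm_sum_jumpLiftR_le hk hC0 hC hα u
    rw [← h] at h1
    linarith
  have hlft : stab L m α u u = ∑ e, α * hM.fluxForm (hM.jumpLiftR e u) (hM.jumpLiftR e u) →
      α * hM.fluxForm (∑ e, hM.jumpLiftR e u) (∑ e, hM.jumpLiftR e u) ≤
      (3 + 3 * (8 * C * b ^ 5 / a ^ 4)) * stab L m α u u := fun h => by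
    have h1 := mul_le_mul_of_nonneg_left
      (hM.fluxForm_sum_lift_le fun e => hM.isLift_liftR e (continuousOn_jumpOn u e)) hα
    rw [mul_left_comm, Finset.mul_sum] at h1
    have h2 : α * hM.fluxForm (∑ e, hM.jumpLiftR e u) (∑ e, hM.jumpLiftR e u) ≤
      3 * stab L m α u u := by
      rw [h]
      exact h1
    linarith
  cases m with
  | IP => exact hpen rfl
  | NIPG => exact hpen rfl
  | IIPG => exact hpen rfl
  | LDG => exact absurd rfl hm
  | Brezzi => exact hlft (by rw [hM.stab_eq_sum]; rfl)
  | Bassi => exact hlft (by rw [hM.stab_eq_sum]; rfl)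

lemma mul_fluxForm_lift_le (hk : 1 ≤ k) {C : ℝ} (hC0 : 0 < C)
    (hC : ∀ p : Pk k, ∀ x ∈ refTriangle,
      MvPolynomial.eval x (p : MvPolynomial (Fin 2) ℝ) ^ 2 ≤ C * refForm k p p)
    (m : DGMethod) {α B : ℝ} (hα : 0 ≤ α) {β : Fin M.numEdges → E3} (hβ : ∀ e, ‖β e‖ ≤ B)
    (u : DGSpace k M) :
    α * hM.fluxForm (hM.lift m β u) (hM.lift m β u) ≤
      (3 + 6 * (8 * C * b ^ 5 / a ^ 4)) * (1 + B ^ 2) * stab L m α u u := by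
  have ha := hM.lower_pos
  have hb := hM.upper_pos
  have hstab := hM.stab_self_nonneg m hα u
  set T := 8 * C * b ^ 5 / a ^ 4 with hT
  have hT0 : 0 ≤ T := by positivity
  by_cases hm : m = .LDG
  · subst hm
    have hlift : hM.lift .LDG β u = ∑ e, hM.jumpLiftR e u + ∑ e, hM.jumpLiftL β e u := by
      rw [lift, LinearMap.sum_apply, ← Finset.sum_add_distrib]
      rfl
    have h1 := hM.mul_fluxForm_sum_jumpLiftR_le hk hC0 hC hα u
    have h2 := hM.mul_fluxForm_sum_jumpLiftL_le hk hC0 hC hα hβ u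
    have h3 : stab L .LDG α u u = ∑ e, penalty L α e * hM.jumpForm e u u := rfl
    rw [← h3, ← hT] at h1 h2
    rw [hlift]
    set x := ∑ e, hM.jumpLiftR e u
    set y := ∑ e, hM.jumpLiftL β e u
    have h4 := mul_nonneg hα (hM.fluxForm_self_nonneg (x - y))
    simp only [map_sub, map_add, LinearMap.sub_apply, LinearMap.add_apply] at h4 ⊢
    have h5 : 0 ≤ 3 * (1 + B ^ 2) * stab L .LDG α u u := by positivity
    nlinarith
  · refine (hM.mul_fluxForm_lift_le_of_ne hk hC0 hC hm hα β u).trans ?_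
    gcongr
    nlinarith [sq_nonneg B]

/-- Continuity: each of the six terms of the form is estimated by the Cauchy-Schwarz inequality. -/
lemma abs_dgForm_le {m : DGMethod} {α D : ℝ} (hα : 0 ≤ α) (hD : 1 ≤ D) {β : Fin M.numEdges → E3}
    (hlift : ∀ u : DGSpace k M,
      hM.fluxForm (hM.lift m β u) (hM.lift m β u) ≤ D * stab L m α u u) (u v : DGSpace k M) :
    |dgForm L m α β u v| ≤ 6 * D * dgNorm L m α u * dgNorm L m α v := by
  have hn : ∀ w : DGSpace k M, 0 ≤ dgNorm L m α w := fun w => Real.sqrt_nonneg _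
  have hbd : ∀ w : DGSpace k M, hM.massForm w w ≤ D * dgNorm L m α w ^ 2 ∧
      hM.fluxForm (grad w) (grad w) ≤ D * dgNorm L m α w ^ 2 ∧
      hM.fluxForm (hM.lift m β w) (hM.lift m β w) ≤ D * dgNorm L m α w ^ 2 ∧
      stab L m α w w ≤ D * dgNorm L m α w ^ 2 := fun w => by
    have h := hM.dgNorm_sq m hα w
    have h1 := hM.massForm_self_nonneg w
    have h2 := hM.fluxForm_self_nonneg (grad w)
    have h3 := hM.stab_self_nonneg m hα w
    have h4 : dgNorm L m α w ^ 2 ≤ D * dgNorm L m α w ^ 2 :=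
      le_mul_of_one_le_left (sq_nonneg _) hD
    have h5 : D * stab L m α w w ≤ D * dgNorm L m α w ^ 2 := by
      gcongr
      linarith
    exact ⟨by linarith, by linarith, (hlift w).trans h5, by linarith⟩
  obtain ⟨u1, u2, u3, u4⟩ := hbd u
  obtain ⟨v1, v2, v3, v4⟩ := hbd v
  have hD0 : 0 ≤ D := by linarith
  have t1 := abs_le_mul_of_sq_le (LinearMap.BilinForm.apply_sq_le_of_symm hM.massForm
    hM.massForm_self_nonneg hM.massForm_isSymm u v) (hM.massForm_self_nonneg v) hD0 (hn u) (hn v)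
    u1 v1
  have tF := fun (ρ τ : FluxSpace k M) (h1 : hM.fluxForm ρ ρ ≤ D * dgNorm L m α u ^ 2)
    (h2 : hM.fluxForm τ τ ≤ D * dgNorm L m α v ^ 2) =>
    abs_le_mul_of_sq_le (hM.fluxForm_sq_le ρ τ) (hM.fluxForm_self_nonneg τ) hD0 (hn u) (hn v) h1 h2
  have t6 := abs_le_mul_of_sq_le (hM.stab_sq_le m hα u v) (hM.stab_self_nonneg m hα v) hD0 (hn u)
    (hn v) u4 v4
  have hs : |m.symmCoeff| ≤ 1 := by cases m <;> simp [DGMethod.symmCoeff]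
  have hl : |m.liftCoeff| ≤ 1 := by cases m <;> simp [DGMethod.liftCoeff]
  have t2 := tF _ _ u2 v2
  have t3 := tF _ _ u3 v2
  have t4 := tF _ _ u2 v3
  have t5 := tF _ _ u3 v3
  have t3' : |m.symmCoeff * hM.fluxForm (hM.lift m β u) (grad v)| ≤
      D * dgNorm L m α u * dgNorm L m α v := by
    rw [abs_mul]
    exact (mul_le_of_le_one_left (abs_nonneg _) hs).trans t3
  have t5' : |m.liftCoeff * hM.fluxForm (hM.lift m β u) (hM.lift m β v)| ≤
      D * dgNorm L m α u * dgNorm L m α v := by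
    rw [abs_mul]
    exact (mul_le_of_le_one_left (abs_nonneg _) hl).trans t5
  rw [hM.dgForm_eq_methodForm, methodForm_apply]
  rw [abs_le] at *
  constructor <;> linarith [t1.1, t1.2, t2.1, t2.2, t3'.1, t3'.2, t4.1, t4.2, t5'.1, t5'.2,
    t6.1, t6.2]

/-- Coercivity. For IP, IIPG and Bassi the mixed terms have to be absorbed into the stabilization,
which needs a large penalty parameter; for NIPG they cancel, and for Brezzi and LDG they are part of
the square `‖∇u + R u‖²`. -/
lemma le_dgForm_self {m : DGMethod} {α D : ℝ} (hα : 0 ≤ α) (hD : 1 ≤ D) {β : Fin M.numEdges → E3}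
    (hlift : ∀ u : DGSpace k M,
      hM.fluxForm (hM.lift m β u) (hM.lift m β u) ≤ D * stab L m α u u)
    (hlarge : m.NeedsLargePenalty → ∀ u : DGSpace k M,
      4 * hM.fluxForm (hM.lift m β u) (hM.lift m β u) ≤ stab L m α u u) (u : DGSpace k M) :
    (4 * D)⁻¹ * dgNorm L m α u ^ 2 ≤ dgForm L m α β u u := by
  have h1 := hM.massForm_self_nonneg u
  have h2 := hM.fluxForm_self_nonneg (grad u)
  have h3 := hM.stab_self_nonneg m hα u
  have h4 := hM.fluxForm_self_nonneg (hM.lift m β u)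
  have h5 := hlift u
  have hcomm := hM.fluxForm_comm (hM.lift m β u) (grad u)
  have h6 := hM.fluxForm_self_nonneg (grad u + hM.lift m β u)
  have h7 := hM.fluxForm_self_nonneg (grad u + (2 : ℝ) • hM.lift m β u)
  simp only [map_add, map_smul, LinearMap.add_apply, LinearMap.smul_apply, smul_eq_mul,
    hcomm] at h6 h7
  have hsmall : m.NeedsLargePenalty ∨ m = .NIPG →
      (4 * D)⁻¹ * dgNorm L m α u ^ 2 ≤ 1 / 2 * dgNorm L m α u ^ 2 := fun _ => by
    gcongr
    rw [one_div]
    exact inv_anti₀ two_pos (by linarith)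
  have hsq := hM.dgNorm_sq m hα u
  rw [hM.dgForm_eq_methodForm, methodForm_apply, hcomm]
  have hlifted : m.symmCoeff = 1 → m.liftCoeff = 1 → (4 * D)⁻¹ * dgNorm L m α u ^ 2 ≤
      hM.massForm u u + hM.fluxForm (grad u) (grad u)
        + m.symmCoeff * hM.fluxForm (grad u) (hM.lift m β u)
        + hM.fluxForm (grad u) (hM.lift m β u)
        + m.liftCoeff * hM.fluxForm (hM.lift m β u) (hM.lift m β u) + stab L m α u u :=
    fun hs hl => by
    rw [hs, hl, inv_mul_le_iff₀ (by linarith), hsq]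
    set P := hM.fluxForm (grad u) (grad u) + 2 * hM.fluxForm (grad u) (hM.lift m β u)
      + hM.fluxForm (hM.lift m β u) (hM.lift m β u) with hP
    have hP0 : 0 ≤ P := by linarith
    -- `‖∇u‖² ≤ 2 ‖∇u + R u‖² + 2 ‖R u‖²`
    have h9 : hM.fluxForm (grad u) (grad u) ≤
        2 * P + 2 * hM.fluxForm (hM.lift m β u) (hM.lift m β u) := by linarith
    have h10 := mul_le_mul_of_nonneg_right hD h1
    have h11 := mul_le_mul_of_nonneg_right hD hP0
    have h12 := mul_le_mul_of_nonneg_right hD h3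
    calc _ ≤ 4 * D * (hM.massForm u u + P + stab L m α u u) := by linarith
      _ = _ := by rw [hP]; ring
  cases m with
  | IP =>
    have := hlarge trivial u
    have := hsmall (.inl trivial)
    simp only [DGMethod.symmCoeff, DGMethod.liftCoeff]
    linarith
  | NIPG =>
    have := hsmall (.inr rfl)
    simp only [DGMethod.symmCoeff, DGMethod.liftCoeff]
    linarith
  | IIPG =>
    have := hlarge trivial u
    have := hsmall (.inl trivial)
    simp only [DGMethod.symmCoeff, DGMethod.liftCoeff]
    linarith
  | LDG => exact hlifted rfl rfl
  | Brezzi => exact hlifted rfl rfl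
  | Bassi =>
    have := hlarge trivial u
    have := hsmall (.inl trivial)
    simp only [DGMethod.symmCoeff, DGMethod.liftCoeff]
    linarith

include hM in
lemma memLp_value (u : DGSpace k M) (K : Fin M.numElts) : MemLp (value u K) 2 (dA L M K) :=
  (memLp_two_iff_integrable_sq (continuous_value u K).aestronglyMeasurable).2
    (hM.integrable_dA K ((continuous_value u K).pow 2).continuousOn)

include hM in
lemma integrable_mul_value {f : Fin M.numElts → R2 → ℝ} (hf : IsL2 L f) (u : DGSpace k M)
    (K : Fin M.numElts) : Integrable (fun x => f K x * value u K x) (dA L M K) :=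
  (hf K).integrable_mul (hM.memLp_value u K)

include hM in
/-- A coercive form is definite, so that the finite dimensional discrete problem is uniquely
solvable; testing with the solution gives the stability estimate. -/
lemma existsUnique_isDiscreteSolution {m : DGMethod} {α c : ℝ} (hα : 0 ≤ α) (hc : 0 < c)
    {β : Fin M.numEdges → E3}
    (hcoer : ∀ u : DGSpace k M, c * dgNorm L m α u ^ 2 ≤ dgForm L m α β u u)
    {f : Fin M.numElts → R2 → ℝ} (hf : IsL2 L f) :
    (∃! u : DGSpace k M, IsDiscreteSolution L m α β f u) ∧
      ∀ u : DGSpace k M, IsDiscreteSolution L m α β f u →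
        dgNorm L m α u ≤ c⁻¹ * l2Norm L f := by
  have hdef : ∀ u : DGSpace k M, hM.methodForm m α β u u = 0 → u = 0 := fun u hu => by
    have h := hcoer u
    rw [hM.dgForm_eq_methodForm, hu] at h
    have h0 := nonpos_of_mul_nonpos_right h hc
    rw [hM.dgNorm_sq m hα] at h0
    refine hM.massForm_definite u (le_antisymm ?_ (hM.massForm_self_nonneg u))
    linarith [hM.fluxForm_self_nonneg (grad u), hM.stab_self_nonneg m hα u]
  refine ⟨?_, fun u hu => ?_⟩
  · let l : DGSpace k M →ₗ[ℝ] ℝ :=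
      { toFun := fun v => ∑ K, ∫ x, f K x * value v K x ∂(dA L M K)
        map_add' := fun u v => by
          rw [← Finset.sum_add_distrib]
          refine Finset.sum_congr rfl fun K _ => ?_
          rw [← integral_add (hM.integrable_mul_value hf u K) (hM.integrable_mul_value hf v K)]
          simp only [value_add, mul_add]
        map_smul' := fun r u => by
          rw [RingHom.id_apply, smul_eq_mul, Finset.mul_sum]
          refine Finset.sum_congr rfl fun K _ => ?_
          rw [← integral_const_mul]
          simp only [value_smul, mul_left_comm] }
    obtain ⟨u, hu⟩ := exists_apply_eq_of_definite (hM.methodForm m α β) hdef l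
    refine ⟨u, fun v => by rw [hM.dgForm_eq_methodForm, hu]; rfl, fun u' hu' => ?_⟩
    refine sub_eq_zero.1 (hdef _ ?_)
    have h : ∀ v, hM.methodForm m α β u' v = hM.methodForm m α β u v := fun v => by
      rw [hu, ← hM.dgForm_eq_methodForm, hu' v]; rfl
    rw [LinearMap.map_sub₂, h, sub_self]
  · have hfK : ∀ K, Integrable (fun x => f K x ^ 2) (dA L M K) := fun K => (hf K).integrable_sq
    have hl2 : l2Norm L f ^ 2 = ∑ K, ∫ x, f K x ^ 2 ∂(dA L M K) :=
      Real.sq_sqrt (Finset.sum_nonneg fun K _ => integral_nonneg fun _ => sq_nonneg _)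
    have hrhs : ∑ K, ∫ x, f K x * value u K x ∂(dA L M K) ≤
        (2 * c)⁻¹ * l2Norm L f ^ 2 + c / 2 * hM.massForm u u := by
      rw [hl2, massForm_apply, Finset.mul_sum, Finset.mul_sum, ← Finset.sum_add_distrib]
      refine Finset.sum_le_sum fun K _ => ?_
      rw [← integral_const_mul, ← integral_const_mul,
        ← integral_add ((hfK K).const_mul _) ((hM.integrable_value_mul_value u u K).const_mul _)]
      refine integral_mono (hM.integrable_mul_value hf u K) (((hfK K).const_mul _).add
        ((hM.integrable_value_mul_value u u K).const_mul _)) fun x => ?_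
      have h0 : 0 ≤ (2 * c)⁻¹ * (f K x - c * value u K x) ^ 2 := by positivity
      have h1 : (2 * c)⁻¹ * (f K x - c * value u K x) ^ 2 = (2 * c)⁻¹ * f K x ^ 2
          + c / 2 * (value u K x * value u K x) - f K x * value u K x := by
        field_simp
        ring
      exact sub_nonneg.1 (h1 ▸ h0)
    have hmass : hM.massForm u u ≤ dgNorm L m α u ^ 2 := by
      rw [hM.dgNorm_sq m hα]
      linarith [hM.fluxForm_self_nonneg (grad u), hM.stab_self_nonneg m hα u]
    have h := hcoer u
    rw [hu u] at h
    have h1 : c * dgNorm L m α u ^ 2 ≤ c⁻¹ * l2Norm L f ^ 2 := by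
      have h2 : c / 2 * hM.massForm u u ≤ c / 2 * dgNorm L m α u ^ 2 := by gcongr
      have h3 : (2 * c)⁻¹ = c⁻¹ / 2 := by field_simp
      rw [h3] at hrhs
      linarith
    have h4 : dgNorm L m α u ^ 2 ≤ (c⁻¹ * l2Norm L f) ^ 2 := by
      rw [← le_inv_mul_iff₀ hc] at h1
      linarith
    exact (pow_le_pow_iff_left₀ (Real.sqrt_nonneg _)
      (mul_nonneg (inv_nonneg.2 hc.le) (Real.sqrt_nonneg _)) two_ne_zero).1 h4

include hM in
lemma isBilinearMap_dgForm (m : DGMethod) (α : ℝ) (β : Fin M.numEdges → E3) :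
    IsBilinearMap ℝ (dgForm L m α β : DGSpace k M → DGSpace k M → ℝ) := by
  constructor <;> intros <;> simp only [hM.dgForm_eq_methodForm, map_add, map_smul,
    LinearMap.add_apply, LinearMap.smul_apply]

end IsRegularMesh

end SurfaceDG

theorem lemma4p6
    (Γ U : Set SurfaceDG.E3) (hΓ : SurfaceDG.IsClosedSmoothSurface Γ) (hU : SurfaceDG.IsTube Γ U)
    (k : ℕ) (hk : 1 ≤ k) (L : SurfaceDG.LagrangeElement k) (κ : ℝ) (hκ : 0 < κ) :
    ∃ h₀ > 0, ∃ α₀ > 0, ∀ (m : SurfaceDG.DGMethod) (α B : ℝ), 0 < α →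
      (∃ C > 0, ∀ M : SurfaceDG.SurfaceMesh Γ U, M.ShapeRegular κ → M.meshSize ≤ h₀ →
        ∀ β : Fin M.numEdges → SurfaceDG.E3, (∀ e, ‖β e‖ ≤ B) →
          IsBilinearMap ℝ (SurfaceDG.dgForm L m α β) ∧
          ∀ u v : SurfaceDG.DGSpace k M,
            |SurfaceDG.dgForm L m α β u v|
              ≤ C * SurfaceDG.dgNorm L m α u * SurfaceDG.dgNorm L m α v) ∧
      ((m.NeedsLargePenalty → α₀ ≤ α) →
        (∃ c > 0, ∀ M : SurfaceDG.SurfaceMesh Γ U, M.ShapeRegular κ → M.meshSize ≤ h₀ →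
          ∀ β : Fin M.numEdges → SurfaceDG.E3, (∀ e, ‖β e‖ ≤ B) →
            ∀ u : SurfaceDG.DGSpace k M,
              c * SurfaceDG.dgNorm L m α u ^ 2 ≤ SurfaceDG.dgForm L m α β u u) ∧
        (∃ C > 0, ∀ M : SurfaceDG.SurfaceMesh Γ U, M.ShapeRegular κ → M.meshSize ≤ h₀ →
          ∀ β : Fin M.numEdges → SurfaceDG.E3, (∀ e, ‖β e‖ ≤ B) →
            ∀ f : Fin M.numElts → SurfaceDG.R2 → ℝ, SurfaceDG.IsL2 L f →
              (∃! u : SurfaceDG.DGSpace k M, SurfaceDG.IsDiscreteSolution L m α β f u) ∧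
              ∀ u : SurfaceDG.DGSpace k M, SurfaceDG.IsDiscreteSolution L m α β f u →
                SurfaceDG.dgNorm L m α u ≤ C * SurfaceDG.l2Norm L f)) := by
  obtain ⟨h₀, hh₀, a, b, ha, hb, hreg⟩ := SurfaceDG.exists_isRegularMesh hΓ hU hk L hκ
  obtain ⟨C, hC0, hC⟩ := SurfaceDG.exists_eval_sq_le L
  set T := 8 * C * b ^ 5 / a ^ 4 with hT
  have hT0 : 0 < T := by positivity
  refine ⟨h₀, hh₀, 4 * (3 + 3 * T), by positivity, fun m α B hα => ?_⟩
  set D := 1 + (3 + 6 * T) * (1 + B ^ 2) / α with hD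
  have hD1 : 1 ≤ D := by
    rw [hD, le_add_iff_nonneg_right]
    positivity
  have hlift : ∀ (M : SurfaceDG.SurfaceMesh Γ U) (hM : SurfaceDG.IsRegularMesh L M a b)
      (β : Fin M.numEdges → SurfaceDG.E3), (∀ e, ‖β e‖ ≤ B) → ∀ u : SurfaceDG.DGSpace k M,
      hM.fluxForm (hM.lift m β u) (hM.lift m β u) ≤ D * SurfaceDG.stab L m α u u := by
    intro M hM β hβ u
    have h1 := hM.mul_fluxForm_lift_le hk hC0 hC m hα.le hβ u
    have h2 := hM.stab_self_nonneg m hα.le u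
    rw [← hT] at h1
    rw [← le_div_iff₀' hα] at h1
    refine h1.trans ?_
    have h3 : D * SurfaceDG.stab L m α u u = SurfaceDG.stab L m α u u +
        (3 + 6 * T) * (1 + B ^ 2) * SurfaceDG.stab L m α u u / α := by
      rw [hD]
      ring
    linarith
  have hcoer : (m.NeedsLargePenalty → 4 * (3 + 3 * T) ≤ α) → ∀ M : SurfaceDG.SurfaceMesh Γ U,
      M.ShapeRegular κ → M.meshSize ≤ h₀ → ∀ β : Fin M.numEdges → SurfaceDG.E3,
      (∀ e, ‖β e‖ ≤ B) → ∀ u : SurfaceDG.DGSpace k M,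
      (4 * D)⁻¹ * SurfaceDG.dgNorm L m α u ^ 2 ≤ SurfaceDG.dgForm L m α β u u := by
    intro hlarge M hMκ hMh β hβ
    have hM := hreg M hMκ hMh
    refine hM.le_dgForm_self hα.le hD1 (hlift M hM β hβ) fun hm u => ?_
    have hne : m ≠ .LDG := by
      rintro rfl
      exact hm
    have h1 := hM.mul_fluxForm_lift_le_of_ne hk hC0 hC hne hα.le β u
    rw [← hT] at h1
    have h2 := mul_le_mul_of_nonneg_right (hlarge hm)
      (hM.fluxForm_self_nonneg (hM.lift m β u))
    have h3 : 0 < 3 + 3 * T := by positivity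
    refine le_of_mul_le_mul_left ?_ h3
    linarith
  refine ⟨⟨6 * D, by positivity, fun M hMκ hMh β hβ => ?_⟩, fun hlarge =>
    ⟨⟨(4 * D)⁻¹, by positivity, hcoer hlarge⟩,
      ⟨(4 * D)⁻¹⁻¹, by positivity, fun M hMκ hMh β hβ f hf => ?_⟩⟩⟩
  · have hM := hreg M hMκ hMh
    exact ⟨hM.isBilinearMap_dgForm m α β, hM.abs_dgForm_le hα.le hD1 (hlift M hM β hβ)⟩
  · exact (hreg M hMκ hMh).existsUnique_isDiscreteSolution hα.le (by positivity)
      (hcoer hlarge M hMκ hMh β hβ) hf
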